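/- Let $\mathbb T=\{|z|=1\}$. An analytic expanding circle map is a map $\tau$, analytic in a neighbourhood of $\mathbb T$, with $\tau(\mathbb T)\subseteq\mathbb T$ and $|\tau'(z)|>1$ for all $z\in\mathbb T$. Put $\omega=1$ if $\tau$ preserves the orientation of $\mathbb T$ and $\omega=-1$ otherwise. For $0<r<1<R$ let $\mathbb A=\{r<|z|<R\}$, and let $H^2(\mathbb A)$ be the space of holomorphic functions $f$ on $\mathbb A$ with $\sup_{r<\rho<R}\int_0^{2\pi}|f(\rho e^{i\theta})|^2d\theta<\infty$, with inner product $$\langle f,g\rangle=\lim_{\rho\uparrow R}\frac1{2\pi}\int_0^{2\pi}\overline{f(\rho e^{i\theta})}g(\rho e^{i\theta})\,d\theta+\lim_{\rho\downarrow r}\frac1{2\pi}\int_0^{2\pi}\overline{f(\rho e^{i\theta})}g(\rho e^{i\theta})\,d\theta .$$ Let $\psi_m(z)=z^m$ ($m\in\mathbb Z$), and for $\bar N\in\mathbb N_0$, $N=2\bar N+1$, let $P_N$ be the orthogonal projection of $H^2(\mathbb A)$ onto $\operatorname{span}\{\psi_{-\bar N},\dots,\psi_{\bar N}\}$. Put $$L_{k,l}=\frac1{2\pi}\int_0^{2\pi}\psi_k(\tau(e^{i\theta}))\,\psi_l(e^{i\theta})\,d\theta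 .$$ **Theorem.** Let $\tau$ be an analytic expanding circle map. There is $\varepsilon>0$ such that the following holds for every annulus $\mathbb A$ with $1-\varepsilon<r<1<R<1+\varepsilon$, where $rR=1$ is required in addition if $\tau$ reverses orientation. There is $d\in\mathbb N$ such that over a neighbourhood of each point of $\mathbb A$ the map $\tau|_{\mathbb A}$ has a complete system of exactly $d$ holomorphic inverse branches $\phi_1,\dots,\phi_d$ with values in $\mathbb A$, mapping points of $\mathbb T$ to points of $\mathbb T$; and for $s\in\{0,1\}$ the formula $$(\mathcal L_sf)(z)=\omega\sum_{j=1}^d\phi_j'(z)\Big(\frac{z}{\phi_j(z)}\Big)^{s}f(\phi_j(z))$$ defines a bounded operator $\mathcal L=\mathcal L_s$ on $H^2(\mathbb A)$. Here $\mathcal L_1$ is the Perron–Frobenius operator with respect to arc length, that is, $(\mathcal L_1f)(z)=\sum_{\zeta\in\mathbb T,\,\tau(\zeta)=z}f(\zeta)/|\tau'(\zeta)|$ for $z\in\mathbb T$; and, for orientation-preserving $\tau$, $\mathcal L_0f=\sum_j\phi_j'\cdot(f\circ\phi_j)$. Moreover, for $\mathcal L=\mathcal L_s$: (a) $\mathcal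 L$ is compact on $H^2(\mathbb A)$. (b) For every $\bar N$ and $|l|\le\bar N$, $P_N\mathcal LP_N\psi_l=\sum_{k=-\bar N}^{\bar N}M_{kl}\psi_k$, where $M_{kl}=L_{-k,l}$ if $s=1$, and $M_{kl}=L_{-k-1,l+1}$ if $s=0$. (c) There is $a>0$ with $\|\mathcal L-P_N\mathcal LP_N\|=O(e^{-aN})$ as $N\to\infty$. (d) The non-zero points of the spectrum $\sigma(\mathcal L)$ are at most countably many eigenvalues of finite algebraic multiplicity, and $\sigma(\mathcal L)$ has no accumulation point other than possibly $0$. (i) If $\lambda^{(N)}\in\sigma(P_N\mathcal LP_N)$ for all $N$ and $\lambda^{(N)}\to\lambda$, then $\lambda\in\sigma(\mathcal L)$. (ii) For every $\lambda\in\sigma(\mathcal L)$ there are $\lambda^{(N)}\in\sigma(P_N\mathcal LP_N)$ with $\lambda^{(N)}\to\lambda$. More precisely, there are enumerations $\lambda_0,\lambda_1,\dots$ of the non-zero eigenvalues of $\mathcal L$ and of each $P_N\mathcal LP_N$, repeated according to algebraic multiplicity (and continued by $0$ if there are only finitely many), such that for every $n$ with $\lambda_n(\mathcal L)\neq0$ there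 is $a>0$ with $$|\lambda_n(P_N\mathcal LP_N)-\lambda_n(\mathcal L)|=O(e^{-aN})\quad(N\to\infty).$$ Throughout, $N$ runs through the odd numbers $2\bar N+1$. -/

import Mathlib

open Set Filter Topology

noncomputable section

namespace CircleEDMD

/-- An open annulus `{z | inner < |z| < outer}` centred at the origin, with
`0 < inner < 1 < outer`, so that it contains the unit circle. -/
structure UnitAnnulus where
  inner : ℝ
  outer : ℝ
  inner_pos : 0 < inner
  inner_lt_one : inner < 1
  one_lt_outer : 1 < outer

namespace UnitAnnulus

/-- The annulus as a subset of the plane. -/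
def carrier (A : UnitAnnulus) : Set ℂ := {z | A.inner < ‖z‖ ∧ ‖z‖ < A.outer}

theorem isOpen_carrier (A : UnitAnnulus) : IsOpen A.carrier :=
  (isOpen_lt continuous_const continuous_norm).inter
    (isOpen_lt continuous_norm continuous_const)

theorem ne_zero {A : UnitAnnulus} {z : ℂ} (hz : z ∈ A.carrier) : z ≠ 0 := by
  rintro rfl
  have h1 := hz.1
  have h2 := A.inner_pos
  simp only [norm_zero] at h1
  linarith

end UnitAnnulus

/-- Membership in the Hardy space `H²(A)`: holomorphic on `A`, with uniformly bounded
square means on the concentric circles in `A`. Functions are extended by zero outside of `A`,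
so that equality of functions is equality on `A`. -/
structure MemHardy (A : UnitAnnulus) (f : ℂ → ℂ) : Prop where
  differentiableOn : DifferentiableOn ℂ f A.carrier
  eq_zero : ∀ z, z ∉ A.carrier → f z = 0
  bounded : ∃ C : ℝ, ∀ ρ ∈ Ioo A.inner A.outer,
    Real.circleAverage (fun z => ‖f z‖ ^ 2) 0 ρ ≤ C

theorem circle_subset {A : UnitAnnulus} {ρ : ℝ} (hρ : ρ ∈ Ioo A.inner A.outer) :
    Metric.sphere (0 : ℂ) ρ ⊆ A.carrier := by
  intro z hz
  have h : ‖z‖ = ρ := by simpa using hz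
  exact ⟨h ▸ hρ.1, h ▸ hρ.2⟩

theorem continuousOn_circle {A : UnitAnnulus} {f : ℂ → ℂ}
    (hf : DifferentiableOn ℂ f A.carrier) {ρ : ℝ} (hρ : ρ ∈ Ioo A.inner A.outer) :
    ContinuousOn f (Metric.sphere (0 : ℂ) ρ) :=
  hf.continuousOn.mono (circle_subset hρ)

theorem circleIntegrable_normSq {A : UnitAnnulus} {f : ℂ → ℂ}
    (hf : DifferentiableOn ℂ f A.carrier) {ρ : ℝ} (hρ : ρ ∈ Ioo A.inner A.outer) :
    CircleIntegrable (fun z => ‖f z‖ ^ 2) 0 ρ :=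
  ((continuousOn_circle hf hρ).norm.pow 2).circleIntegrable (A.inner_pos.trans hρ.1).le

theorem MemHardy.zero (A : UnitAnnulus) : MemHardy A 0 :=
  ⟨differentiableOn_const 0, fun _ _ => rfl, 0, fun ρ _ => by simp [Real.circleAverage_def]⟩

theorem MemHardy.add {A : UnitAnnulus} {f g : ℂ → ℂ} (hf : MemHardy A f) (hg : MemHardy A g) :
    MemHardy A (f + g) := by
  refine ⟨hf.differentiableOn.add hg.differentiableOn, fun z hz => ?_, ?_⟩
  · simp [hf.eq_zero z hz, hg.eq_zero z hz]
  · obtain ⟨C, hC⟩ := hf.bounded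
    obtain ⟨D, hD⟩ := hg.bounded
    refine ⟨2 * C + 2 * D, fun ρ hρ => ?_⟩
    have h1 := circleIntegrable_normSq hf.differentiableOn hρ
    have h2 := circleIntegrable_normSq hg.differentiableOn hρ
    have h3 := circleIntegrable_normSq (hf.differentiableOn.add hg.differentiableOn) hρ
    have key : Real.circleAverage (fun z => ‖(f + g) z‖ ^ 2) 0 ρ ≤
        Real.circleAverage ((2 : ℝ) • (fun z => ‖f z‖ ^ 2) + (2 : ℝ) • (fun z => ‖g z‖ ^ 2)) 0 ρ := by
      refine Real.circleAverage_mono h3 ((h1.const_smul).add (h2.const_smul)) fun z _ => ?_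
      have := norm_add_le (f z) (g z)
      simp only [Pi.add_apply, Pi.smul_apply, smul_eq_mul]
      nlinarith [sq_nonneg (‖f z‖ - ‖g z‖), norm_nonneg (f z + g z)]
    rw [Real.circleAverage_add h1.const_smul h2.const_smul, Real.circleAverage_smul,
      Real.circleAverage_smul, smul_eq_mul, smul_eq_mul] at key
    linarith [hC ρ hρ, hD ρ hρ]

theorem MemHardy.smul {A : UnitAnnulus} {f : ℂ → ℂ} (c : ℂ) (hf : MemHardy A f) :
    MemHardy A (c • f) := by
  refine ⟨hf.differentiableOn.const_smul c, fun z hz => by simp [hf.eq_zero z hz], ?_⟩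
  obtain ⟨C, hC⟩ := hf.bounded
  refine ⟨‖c‖ ^ 2 * C, fun ρ hρ => ?_⟩
  have : (fun z => ‖(c • f) z‖ ^ 2) = (‖c‖ ^ 2) • (fun z => ‖f z‖ ^ 2) := by
    ext z; simp [mul_pow]
  rw [this, Real.circleAverage_smul, smul_eq_mul]
  exact mul_le_mul_of_nonneg_left (hC ρ hρ) (by positivity)

/-- The Hardy space `H²(A)` as a space of functions. -/
def hardySubmodule (A : UnitAnnulus) : Submodule ℂ (ℂ → ℂ) where
  carrier := {f | MemHardy A f}
  add_mem' := MemHardy.add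
  zero_mem' := MemHardy.zero A
  smul_mem' c _ hf := hf.smul c

/-- The Hardy space `H²(A)` of the annulus `A`. -/
def HardySpace (A : UnitAnnulus) : Type := hardySubmodule A

instance (A : UnitAnnulus) : AddCommGroup (HardySpace A) :=
  inferInstanceAs (AddCommGroup (hardySubmodule A))

instance (A : UnitAnnulus) : Module ℂ (HardySpace A) :=
  inferInstanceAs (Module ℂ (hardySubmodule A))

instance (A : UnitAnnulus) : CoeFun (HardySpace A) (fun _ => ℂ → ℂ) := ⟨fun f => f.1⟩

theorem HardySpace.mem {A : UnitAnnulus} (f : HardySpace A) : MemHardy A f := f.2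

/-- The `n`-th Laurent coefficient, computed on the circle of radius `ρ`. -/
def laurentCoeff (f : ℂ → ℂ) (ρ : ℝ) (n : ℤ) : ℂ :=
  Real.circleAverage (fun z => z ^ (-n) * f z) 0 ρ

theorem laurentCoeff_eq {A : UnitAnnulus} {f : ℂ → ℂ}
    (hf : DifferentiableOn ℂ f A.carrier) {ρ : ℝ} (hρ : ρ ∈ Ioo A.inner A.outer) (n : ℤ) :
    laurentCoeff f ρ n = laurentCoeff f 1 n := by
  have h1 : (1 : ℝ) ∈ Ioo A.inner A.outer := ⟨A.inner_lt_one, A.one_lt_outer⟩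
  have main : ∀ a b : ℝ, a ∈ Ioo A.inner A.outer → b ∈ Ioo A.inner A.outer → a ≤ b →
      laurentCoeff f b n = laurentCoeff f a n := by
    intro a b ha hb hab
    have ha0 : 0 < a := A.inner_pos.trans ha.1
    have hb0 : 0 < b := A.inner_pos.trans hb.1
    have hsub : Metric.closedBall (0 : ℂ) b \ Metric.ball 0 a ⊆ A.carrier := by
      intro z hz
      simp only [Set.mem_sdiff, Metric.mem_closedBall, dist_zero_right, Metric.mem_ball, not_lt] at hz
      exact ⟨ha.1.trans_le hz.2, hz.1.trans_lt hb.2⟩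
    have hd : DifferentiableOn ℂ (fun z => z ^ (-n) * f z) A.carrier := by
      refine DifferentiableOn.mul (fun z hz => ?_) hf
      exact (differentiableAt_zpow.2 (Or.inl (UnitAnnulus.ne_zero hz))).differentiableWithinAt
    have := Complex.circleIntegral_sub_center_inv_smul_eq_of_differentiable_on_annulus_off_countable
      (c := 0) ha0 hab (f := fun z => z ^ (-n) * f z) (s := ∅) countable_empty
      (hd.continuousOn.mono hsub) (fun z hz => by
        refine hd.differentiableAt (A.isOpen_carrier.mem_nhds (hsub ?_))
        have h := hz.1
        refine ⟨Metric.ball_subset_closedBall h.1, fun h' => h.2 (Metric.ball_subset_closedBall h')⟩)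
    rw [laurentCoeff, laurentCoeff, Real.circleAverage_eq_circleIntegral hb0.ne',
      Real.circleAverage_eq_circleIntegral ha0.ne', this]
  rcases le_total ρ 1 with h | h
  · exact (main ρ 1 hρ h1 h).symm
  · exact main 1 ρ h1 hρ h

theorem hasSum_circleAverage_normSq {A : UnitAnnulus} {f : ℂ → ℂ}
    (hf : DifferentiableOn ℂ f A.carrier) {ρ : ℝ} (hρ : ρ ∈ Ioo A.inner A.outer) :
    HasSum (fun n : ℤ => ‖laurentCoeff f 1 n‖ ^ 2 * (ρ ^ n) ^ 2)
      (Real.circleAverage (fun z => ‖f z‖ ^ 2) 0 ρ) := by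
  have hρ0 : 0 < ρ := A.inner_pos.trans hρ.1
  have hpi : (0 : ℝ) < 2 * Real.pi := Real.two_pi_pos
  have hcont : Continuous (fun θ : ℝ => f (circleMap 0 ρ θ)) := by
    refine (continuousOn_circle hf hρ).comp_continuous (continuous_circleMap 0 ρ) fun θ => ?_
    exact circleMap_mem_sphere 0 hρ0.le θ
  have hL2 : MeasureTheory.MemLp (fun θ : ℝ => f (circleMap 0 ρ θ)) 2
      (MeasureTheory.volume.restrict (Ioc 0 (2 * Real.pi))) := by
    rw [MeasureTheory.memLp_two_iff_integrable_sq_norm hcont.aestronglyMeasurable]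
    exact ((hcont.norm.pow 2).integrableOn_Icc).mono_set Ioc_subset_Icc_self
  have h := hasSum_sq_fourierCoeffOn hpi hL2
  have hcoef : ∀ n : ℤ, fourierCoeffOn hpi (fun θ : ℝ => f (circleMap 0 ρ θ)) n =
      (ρ : ℂ) ^ n * laurentCoeff f 1 n := by
    intro n
    rw [← laurentCoeff_eq hf hρ n, fourierCoeffOn_eq_integral, laurentCoeff,
      Real.circleAverage_def, mul_smul_comm, ← intervalIntegral.integral_const_mul]
    rw [sub_zero, one_div]
    congr 1
    refine intervalIntegral.integral_congr fun θ _ => ?_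
    simp only [smul_eq_mul]
    rw [fourier_coe_apply, ← mul_assoc]
    congr 1
    rw [circleMap_zero, mul_zpow, ← mul_assoc, ← zpow_add₀ (by exact_mod_cast hρ0.ne'),
      add_neg_cancel, zpow_zero, one_mul, ← Complex.exp_int_mul]
    congr 1
    have : (Real.pi : ℂ) ≠ 0 := by exact_mod_cast Real.pi_ne_zero
    push_cast
    field_simp
  rw [sub_zero] at h
  have e1 : (fun n : ℤ => ‖fourierCoeffOn hpi (fun θ : ℝ => f (circleMap 0 ρ θ)) n‖ ^ 2) =
      fun n : ℤ => ‖laurentCoeff f 1 n‖ ^ 2 * (ρ ^ n) ^ 2 := by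
    funext n
    rw [hcoef, norm_mul, norm_zpow, Complex.norm_real, Real.norm_of_nonneg hρ0.le, mul_pow,
      mul_comm]
  rw [e1] at h
  exact h

theorem tendsto_laurentTerm {A : UnitAnnulus} (f : ℂ → ℂ) (n : ℤ) {t : ℝ}
    (ht : t ∈ Icc A.inner A.outer) :
    Tendsto (fun ρ : ℝ => ‖laurentCoeff f 1 n‖ ^ 2 * (ρ ^ n) ^ 2) (𝓝[Ioo A.inner A.outer] t)
      (𝓝 (‖laurentCoeff f 1 n‖ ^ 2 * (t ^ n) ^ 2)) := by
  have ht0 : t ≠ 0 := (A.inner_pos.trans_le ht.1).ne'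
  have : ContinuousAt (fun ρ : ℝ => ‖laurentCoeff f 1 n‖ ^ 2 * (ρ ^ n) ^ 2) t :=
    continuousAt_const.mul ((continuousAt_zpow₀ t n (Or.inl ht0)).pow 2)
  exact this.tendsto.mono_left nhdsWithin_le_nhds

theorem UnitAnnulus.neBot {A : UnitAnnulus} {t : ℝ} (ht : t ∈ Icc A.inner A.outer) :
    (𝓝[Ioo A.inner A.outer] t).NeBot := by
  rw [← mem_closure_iff_nhdsWithin_neBot, closure_Ioo (A.inner_lt_one.trans A.one_lt_outer).ne]
  exact ht

theorem summable_laurentTerm {A : UnitAnnulus} {f : ℂ → ℂ} (hf : MemHardy A f)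
    {t : ℝ} (ht : t ∈ Icc A.inner A.outer) :
    Summable (fun n : ℤ => ‖laurentCoeff f 1 n‖ ^ 2 * (t ^ n) ^ 2) := by
  obtain ⟨C, hC⟩ := hf.bounded
  have hne := UnitAnnulus.neBot ht
  refine summable_of_sum_le (c := C) (fun n => by positivity) fun F => ?_
  refine le_of_tendsto (tendsto_finsetSum F fun n _ => tendsto_laurentTerm f n ht) ?_
  filter_upwards [self_mem_nhdsWithin] with ρ hρ
  have h := hasSum_circleAverage_normSq hf.differentiableOn hρ
  exact (sum_le_hasSum F (fun n _ => by positivity) h).trans (hC ρ hρ)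

theorem UnitAnnulus.inner_mem (A : UnitAnnulus) : A.inner ∈ Icc A.inner A.outer :=
  ⟨le_rfl, (A.inner_lt_one.trans A.one_lt_outer).le⟩

theorem UnitAnnulus.outer_mem (A : UnitAnnulus) : A.outer ∈ Icc A.inner A.outer :=
  ⟨(A.inner_lt_one.trans A.one_lt_outer).le, le_rfl⟩

theorem UnitAnnulus.zpow_sq_le {A : UnitAnnulus} {ρ : ℝ} (hρ : ρ ∈ Ioo A.inner A.outer) (n : ℤ) :
    (ρ ^ n) ^ 2 ≤ (A.outer ^ n) ^ 2 + (A.inner ^ n) ^ 2 := by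
  have hρ0 : 0 < ρ := A.inner_pos.trans hρ.1
  rcases le_total 0 n with hn | hn
  · have h1 : ρ ^ n ≤ A.outer ^ n := zpow_le_zpow_left₀ hn hρ0.le hρ.2.le
    have h2 : (ρ ^ n) ^ 2 ≤ (A.outer ^ n) ^ 2 := pow_le_pow_left₀ (by positivity) h1 2
    linarith [sq_nonneg (A.inner ^ n)]
  · have h1 : ρ ^ n ≤ A.inner ^ n := by
      obtain ⟨m, rfl⟩ : ∃ m : ℕ, n = -(m : ℤ) := ⟨n.natAbs, by omega⟩
      rw [zpow_neg, zpow_neg, zpow_natCast, zpow_natCast]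
      exact inv_anti₀ (pow_pos A.inner_pos m) (pow_le_pow_left₀ A.inner_pos.le hρ.1.le m)
    have h2 : (ρ ^ n) ^ 2 ≤ (A.inner ^ n) ^ 2 := pow_le_pow_left₀ (by positivity) h1 2
    linarith [sq_nonneg (A.outer ^ n)]

theorem tendsto_circleAverage_normSq {A : UnitAnnulus} {f : ℂ → ℂ} (hf : MemHardy A f)
    {t : ℝ} (ht : t ∈ Icc A.inner A.outer) :
    Tendsto (fun ρ => Real.circleAverage (fun z => ‖f z‖ ^ 2) 0 ρ) (𝓝[Ioo A.inner A.outer] t)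
      (𝓝 (∑' n : ℤ, ‖laurentCoeff f 1 n‖ ^ 2 * (t ^ n) ^ 2)) := by
  have hdom := (summable_laurentTerm hf A.outer_mem).add (summable_laurentTerm hf A.inner_mem)
  have hlim := tendsto_tsum_of_dominated_convergence hdom
    (fun n => tendsto_laurentTerm f n ht) (by
      filter_upwards [self_mem_nhdsWithin] with ρ hρ n
      rw [Real.norm_of_nonneg (by positivity), ← mul_add]
      exact mul_le_mul_of_nonneg_left (UnitAnnulus.zpow_sq_le hρ n) (by positivity))
  refine hlim.congr' ?_
  filter_upwards [self_mem_nhdsWithin] with ρ hρ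
  exact (hasSum_circleAverage_normSq hf.differentiableOn hρ).tsum_eq

/-- The mean over the circle of radius `ρ` of the product `conj f * g`. -/
def circleInner (f g : ℂ → ℂ) (ρ : ℝ) : ℂ :=
  Real.circleAverage (fun z => (starRingEnd ℂ) (f z) * g z) 0 ρ

theorem circleIntegrable_conj_mul {A : UnitAnnulus} {f g : ℂ → ℂ} (hf : MemHardy A f)
    (hg : MemHardy A g) {ρ : ℝ} (hρ : ρ ∈ Ioo A.inner A.outer) :
    CircleIntegrable (fun z => (starRingEnd ℂ) (f z) * g z) 0 ρ :=
  ((Complex.continuous_conj.comp_continuousOn (continuousOn_circle hf.differentiableOn hρ)).mul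
    (continuousOn_circle hg.differentiableOn hρ)).circleIntegrable (A.inner_pos.trans hρ.1).le

theorem circleInner_self (f : ℂ → ℂ) (ρ : ℝ) :
    circleInner f f ρ = (Real.circleAverage (fun z => ‖f z‖ ^ 2) 0 ρ : ℝ) := by
  have : (fun z => (starRingEnd ℂ) (f z) * f z) = fun z => (((‖f z‖ ^ 2 : ℝ)) : ℂ) := by
    funext z
    rw [Complex.conj_mul']
    push_cast
    rfl
  rw [circleInner, this, Real.circleAverage_def, Real.circleAverage_def,
    intervalIntegral.integral_ofReal]
  simp

theorem circleInner_add {A : UnitAnnulus} {f g h : ℂ → ℂ} (hf : MemHardy A f)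
    (hg : MemHardy A g) (hh : MemHardy A h) {ρ : ℝ} (hρ : ρ ∈ Ioo A.inner A.outer) :
    circleInner (f + g) h ρ = circleInner f h ρ + circleInner g h ρ := by
  rw [circleInner, circleInner, circleInner,
    ← Real.circleAverage_add (circleIntegrable_conj_mul hf hh hρ)
      (circleIntegrable_conj_mul hg hh hρ)]
  congr 1
  funext z
  simp [add_mul]

theorem circleInner_smul (c : ℂ) (f g : ℂ → ℂ) (ρ : ℝ) :
    circleInner (c • f) g ρ = (starRingEnd ℂ) c * circleInner f g ρ := by
  rw [circleInner, circleInner, ← smul_eq_mul, ← Real.circleAverage_smul]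
  congr 1
  funext z
  simp [mul_assoc]

theorem circleInner_conj (f g : ℂ → ℂ) (ρ : ℝ) :
    (starRingEnd ℂ) (circleInner g f ρ) = circleInner f g ρ := by
  rw [circleInner, circleInner, Real.circleAverage_def, Real.circleAverage_def,
    Complex.real_smul, Complex.real_smul, map_mul, Complex.conj_ofReal,
    ← intervalIntegral.intervalIntegral_conj]
  congr 2
  funext θ
  simp [mul_comm]

theorem circleInner_polarization {A : UnitAnnulus} {f g : ℂ → ℂ} (hf : MemHardy A f)
    (hg : MemHardy A g) {ρ : ℝ} (hρ : ρ ∈ Ioo A.inner A.outer) :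
    circleInner f g ρ = (1 / 4) * (circleInner (f + g) (f + g) ρ
      - circleInner (f + (-1 : ℂ) • g) (f + (-1 : ℂ) • g) ρ
      + Complex.I * circleInner (f + (-Complex.I) • g) (f + (-Complex.I) • g) ρ
      - Complex.I * circleInner (f + Complex.I • g) (f + Complex.I • g) ρ) := by
  have expand : ∀ c : ℂ, circleInner (f + c • g) (f + c • g) ρ =
      circleInner f f ρ + c * circleInner f g ρ + (starRingEnd ℂ) c * circleInner g f ρ
        + (starRingEnd ℂ) c * c * circleInner g g ρ := by
    intro c
    have hcg := hg.smul c
    have hs := hf.add hcg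
    have e1 : ∀ u : ℂ → ℂ, MemHardy A u → circleInner u (f + c • g) ρ =
        circleInner u f ρ + c * circleInner u g ρ := by
      intro u hu
      rw [← circleInner_conj, circleInner_add hf hcg hu hρ, circleInner_smul, map_add, map_mul,
        Complex.conj_conj, circleInner_conj, circleInner_conj]
    rw [circleInner_add hf hcg hs hρ, circleInner_smul, e1 f hf, e1 g hg]
    ring
  have h1 := expand 1
  rw [one_smul] at h1
  rw [h1, expand, expand, expand]
  simp only [map_one, map_neg, Complex.conj_I]
  have hI : Complex.I ^ 2 = -1 := Complex.I_sq
  ring_nf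
  simp only [hI]
  ring

theorem exists_tendsto_circleInner {A : UnitAnnulus} {f g : ℂ → ℂ} (hf : MemHardy A f)
    (hg : MemHardy A g) {t : ℝ} (ht : t ∈ Icc A.inner A.outer) :
    ∃ l, Tendsto (circleInner f g) (𝓝[Ioo A.inner A.outer] t) (𝓝 l) := by
  have hself : ∀ u : ℂ → ℂ, MemHardy A u →
      ∃ l, Tendsto (circleInner u u) (𝓝[Ioo A.inner A.outer] t) (𝓝 l) := by
    intro u hu
    refine ⟨_, ((Complex.continuous_ofReal.tendsto _).comp
      (tendsto_circleAverage_normSq hu ht)).congr fun ρ => ?_⟩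
    exact (circleInner_self u ρ).symm
  obtain ⟨a, ha⟩ := hself _ (hf.add hg)
  obtain ⟨b, hb⟩ := hself _ (hf.add (hg.smul (-1)))
  obtain ⟨c, hc⟩ := hself _ (hf.add (hg.smul (-Complex.I)))
  obtain ⟨d, hd⟩ := hself _ (hf.add (hg.smul Complex.I))
  refine ⟨_, (((((ha.sub hb).add (hc.const_mul Complex.I)).sub
    (hd.const_mul Complex.I)).const_mul (1 / 4)).congr' ?_)⟩
  filter_upwards [self_mem_nhdsWithin] with ρ hρ
  exact (circleInner_polarization hf hg hρ).symm

/-- The boundary integral of `conj f * g` over the boundary circle of radius `t`, normalised to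
total mass one: the limit of the means over the circles inside `A`. -/
def boundaryInner (A : UnitAnnulus) (t : ℝ) (f g : ℂ → ℂ) : ℂ :=
  limUnder (𝓝[Ioo A.inner A.outer] t) (circleInner f g)

theorem tendsto_boundaryInner {A : UnitAnnulus} {f g : ℂ → ℂ} (hf : MemHardy A f)
    (hg : MemHardy A g) {t : ℝ} (ht : t ∈ Icc A.inner A.outer) :
    Tendsto (circleInner f g) (𝓝[Ioo A.inner A.outer] t) (𝓝 (boundaryInner A t f g)) :=
  tendsto_nhds_limUnder (exists_tendsto_circleInner hf hg ht)

theorem boundaryInner_eq {A : UnitAnnulus} {f g : ℂ → ℂ}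
    {t : ℝ} (ht : t ∈ Icc A.inner A.outer) {l : ℂ}
    (h : Tendsto (circleInner f g) (𝓝[Ioo A.inner A.outer] t) (𝓝 l)) :
    boundaryInner A t f g = l := by
  have hne := UnitAnnulus.neBot ht
  exact h.limUnder_eq

theorem boundaryInner_self {A : UnitAnnulus} {f : ℂ → ℂ} (hf : MemHardy A f)
    {t : ℝ} (ht : t ∈ Icc A.inner A.outer) :
    boundaryInner A t f f = (∑' n : ℤ, ‖laurentCoeff f 1 n‖ ^ 2 * (t ^ n) ^ 2 : ℝ) := by
  refine boundaryInner_eq ht (((Complex.continuous_ofReal.tendsto _).comp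
      (tendsto_circleAverage_normSq hf ht)).congr fun ρ => ?_)
  exact (circleInner_self f ρ).symm

theorem boundaryInner_add {A : UnitAnnulus} {f g h : ℂ → ℂ} (hf : MemHardy A f)
    (hg : MemHardy A g) (hh : MemHardy A h) {t : ℝ} (ht : t ∈ Icc A.inner A.outer) :
    boundaryInner A t (f + g) h = boundaryInner A t f h + boundaryInner A t g h := by
  refine boundaryInner_eq ht (((tendsto_boundaryInner hf hh ht).add
    (tendsto_boundaryInner hg hh ht)).congr' ?_)
  filter_upwards [self_mem_nhdsWithin] with ρ hρ
  exact (circleInner_add hf hg hh hρ).symm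

theorem boundaryInner_smul {A : UnitAnnulus} {f g : ℂ → ℂ} (c : ℂ) (hf : MemHardy A f)
    (hg : MemHardy A g) {t : ℝ} (ht : t ∈ Icc A.inner A.outer) :
    boundaryInner A t (c • f) g = (starRingEnd ℂ) c * boundaryInner A t f g :=
  boundaryInner_eq ht (((tendsto_boundaryInner hf hg ht).const_mul _).congr fun ρ =>
    (circleInner_smul c f g ρ).symm)

theorem boundaryInner_conj {A : UnitAnnulus} {f g : ℂ → ℂ} (hf : MemHardy A f)
    (hg : MemHardy A g) {t : ℝ} (ht : t ∈ Icc A.inner A.outer) :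
    (starRingEnd ℂ) (boundaryInner A t g f) = boundaryInner A t f g :=
  (boundaryInner_eq ht (((Complex.continuous_conj.tendsto _).comp
    (tendsto_boundaryInner hg hf ht)).congr fun ρ => circleInner_conj f g ρ)).symm

theorem eq_zero_of_laurentCoeff {A : UnitAnnulus} {f : ℂ → ℂ} (hf : MemHardy A f)
    (h : ∀ n, laurentCoeff f 1 n = 0) : f = 0 := by
  funext z
  by_cases hz : z ∈ A.carrier
  · have hρ : ‖z‖ ∈ Ioo A.inner A.outer := ⟨hz.1, hz.2⟩
    have h0 := hasSum_circleAverage_normSq hf.differentiableOn hρ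
    simp only [h, norm_zero, ne_eq, OfNat.ofNat_ne_zero, not_false_eq_true, zero_pow, zero_mul]
      at h0
    have h1 : Real.circleAverage (fun z => ‖f z‖ ^ 2) 0 ‖z‖ = 0 := h0.unique hasSum_zero
    have hcont : Continuous (fun θ : ℝ => ‖f (circleMap 0 ‖z‖ θ)‖ ^ 2) := by
      refine (((continuousOn_circle hf.differentiableOn hρ).norm.pow 2).comp_continuous
        (continuous_circleMap 0 ‖z‖) fun θ => ?_)
      exact circleMap_mem_sphere 0 (norm_nonneg z) θ
    have h2 := (Real.circleAverage_eq_integral_add (f := fun z => ‖f z‖ ^ 2) (c := 0) (R := ‖z‖)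
      (z.arg - Real.pi)).symm.trans h1
    by_contra hne
    have hpos : 0 < ∫ θ in (0 : ℝ)..(2 * Real.pi),
        ‖f (circleMap 0 ‖z‖ (θ + (z.arg - Real.pi)))‖ ^ 2 := by
      have hc2 : Continuous
          (fun θ : ℝ => ‖f (circleMap 0 ‖z‖ (θ + (z.arg - Real.pi)))‖ ^ 2) :=
        hcont.comp (continuous_id.add continuous_const)
      refine intervalIntegral.integral_pos Real.two_pi_pos hc2.continuousOn
        (fun x _ => by positivity)
        ⟨Real.pi, ⟨Real.pi_pos.le, by linarith [Real.pi_pos]⟩, ?_⟩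
      have : circleMap 0 ‖z‖ (Real.pi + (z.arg - Real.pi)) = z := by
        rw [circleMap_zero, add_sub_cancel]
        exact Complex.norm_mul_exp_arg_mul_I z
      rw [this]
      have : f z ≠ 0 := hne
      positivity
    rw [smul_eq_mul, mul_eq_zero] at h2
    rcases h2 with h2 | h2
    · exact (inv_pos.2 Real.two_pi_pos).ne' h2
    · exact hpos.ne' h2
  · exact hf.eq_zero z hz

/-- The inner product of `H²(A)`: the sum of the two normalised boundary integrals. -/
@[reducible] def hardyCore (A : UnitAnnulus) : InnerProductSpace.Core ℂ (HardySpace A) where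
  inner f g := boundaryInner A A.inner f g + boundaryInner A A.outer f g
  conj_inner_symm f g := by
    rw [map_add, boundaryInner_conj f.mem g.mem A.inner_mem,
      boundaryInner_conj f.mem g.mem A.outer_mem]
  re_inner_nonneg f := by
    rw [boundaryInner_self f.mem A.inner_mem, boundaryInner_self f.mem A.outer_mem,
      ← Complex.ofReal_add]
    exact add_nonneg (tsum_nonneg fun n => by positivity) (tsum_nonneg fun n => by positivity)
  add_left f g h := by
    change boundaryInner A A.inner ((f : ℂ → ℂ) + g) h +
      boundaryInner A A.outer ((f : ℂ → ℂ) + g) h = _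
    rw [boundaryInner_add f.mem g.mem h.mem A.inner_mem,
      boundaryInner_add f.mem g.mem h.mem A.outer_mem]
    ring
  smul_left f g c := by
    change boundaryInner A A.inner (c • (f : ℂ → ℂ)) g +
      boundaryInner A A.outer (c • (f : ℂ → ℂ)) g = _
    rw [boundaryInner_smul c f.mem g.mem A.inner_mem,
      boundaryInner_smul c f.mem g.mem A.outer_mem]
    ring
  definite f hf := by
    have h1 := summable_laurentTerm f.mem A.outer_mem
    have h0 : ∑' n : ℤ, ‖laurentCoeff f 1 n‖ ^ 2 * (A.outer ^ n) ^ 2 = 0 := by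
      rw [boundaryInner_self f.mem A.inner_mem, boundaryInner_self f.mem A.outer_mem,
        ← Complex.ofReal_add, Complex.ofReal_eq_zero] at hf
      have h2 : 0 ≤ ∑' n : ℤ, ‖laurentCoeff f 1 n‖ ^ 2 * (A.inner ^ n) ^ 2 :=
        tsum_nonneg fun n => by positivity
      have h3 : 0 ≤ ∑' n : ℤ, ‖laurentCoeff f 1 n‖ ^ 2 * (A.outer ^ n) ^ 2 :=
        tsum_nonneg fun n => by positivity
      linarith
    have hc : ∀ n, laurentCoeff f 1 n = 0 := by
      intro n
      have h2 := h1.hasSum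
      rw [h0, hasSum_zero_iff_of_nonneg (fun n => by positivity)] at h2
      have h3 := congrFun h2 n
      have h4 : A.outer ^ n ≠ 0 := zpow_ne_zero n (by linarith [A.one_lt_outer])
      simpa [h4] using h3
    exact Subtype.ext (eq_zero_of_laurentCoeff f.mem hc)

instance (A : UnitAnnulus) : NormedAddCommGroup (HardySpace A) :=
  (hardyCore A).toNormedAddCommGroup

instance (A : UnitAnnulus) : InnerProductSpace ℂ (HardySpace A) :=
  InnerProductSpace.ofCore (hardyCore A).toCore

theorem memHardy_zpow (A : UnitAnnulus) (m : ℤ) :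
    MemHardy A (A.carrier.indicator fun z => z ^ m) := by
  refine ⟨?_, fun z hz => indicator_of_notMem hz _,
    (A.outer ^ m) ^ 2 + (A.inner ^ m) ^ 2, fun ρ hρ => ?_⟩
  · refine DifferentiableOn.congr (f := fun z : ℂ => z ^ m) (fun z hz => ?_)
      (fun z hz => indicator_of_mem hz _)
    exact (differentiableAt_zpow.2 (Or.inl (UnitAnnulus.ne_zero hz))).differentiableWithinAt
  · rw [Real.circleAverage_const_on_circle (a := (ρ ^ m) ^ 2)]
    · exact UnitAnnulus.zpow_sq_le hρ m
    · intro z hz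
      rw [abs_of_pos (A.inner_pos.trans hρ.1)] at hz
      have h : ‖z‖ = ρ := by simpa using hz
      rw [indicator_of_mem (circle_subset hρ hz), norm_zpow, h]

/-- The Laurent monomial `ψ_m(z) = z ^ m` as an element of `H²(A)`. -/
def mode (A : UnitAnnulus) (m : ℤ) : HardySpace A :=
  ⟨A.carrier.indicator fun z => z ^ m, memHardy_zpow A m⟩

/-- The span of the modes `ψ_m` with `-n ≤ m ≤ n`; its dimension is `2 * n + 1`. -/
def modeSpace (A : UnitAnnulus) (n : ℕ) : Submodule ℂ (HardySpace A) :=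
  Submodule.span ℂ (mode A '' Icc (-(n : ℤ)) n)

instance (A : UnitAnnulus) (n : ℕ) : FiniteDimensional ℂ (modeSpace A n) :=
  FiniteDimensional.span_of_finite ℂ ((Set.finite_Icc _ _).image _)

/-- The Galerkin truncation `P L P`, with `P` the orthogonal projection of `H²(A)` onto the span
of `ψ_{-n}, …, ψ_n`. -/
def truncation {A : UnitAnnulus} (L : HardySpace A →L[ℂ] HardySpace A) (n : ℕ) :
    HardySpace A →L[ℂ] HardySpace A :=
  (modeSpace A n).starProjection ∘L L ∘L (modeSpace A n).starProjection

/-- An analytic expanding map of the unit circle: analytic in a neighbourhood of each point of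
the circle, leaving the circle invariant, and with `|τ'| > 1` on the circle. -/
structure IsAnalyticExpandingCircleMap (τ : ℂ → ℂ) : Prop where
  analytic : AnalyticOnNhd ℂ τ (Metric.sphere 0 1)
  mapsTo : MapsTo τ (Metric.sphere 0 1) (Metric.sphere 0 1)
  expanding : ∀ z ∈ Metric.sphere (0 : ℂ) 1, 1 < ‖deriv τ z‖

/-- `τ` preserves the orientation of the unit circle: if `τ (exp (i θ)) = exp (i g(θ))` with `g`
real, then `g'(θ) = z τ'(z) / τ(z)` at `z = exp (i θ)`, and this is positive. -/
def OrientationPreserving (τ : ℂ → ℂ) : Prop :=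
  ∀ z ∈ Metric.sphere (0 : ℂ) 1, 0 < (z * deriv τ z / τ z).re

open Classical in
/-- `1` for orientation preserving circle maps and `-1` for orientation reversing ones. -/
def orientationSign (τ : ℂ → ℂ) : ℂ := if OrientationPreserving τ then 1 else -1

/-- `φ 0, …, φ (d - 1)` is a complete system of inverse branches, over the open set `U ⊆ A`, of
the restriction of `τ` to the annulus `A`; over points of the unit circle their values lie on the
unit circle. -/
structure IsInverseBranches (τ : ℂ → ℂ) (A : UnitAnnulus) (U : Set ℂ) {d : ℕ}
    (φ : Fin d → ℂ → ℂ) : Prop where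
  isOpen : IsOpen U
  subset : U ⊆ A.carrier
  differentiableOn : ∀ j, DifferentiableOn ℂ (φ j) U
  mem : ∀ j, ∀ z ∈ U, φ j z ∈ A.carrier
  right_inv : ∀ j, ∀ z ∈ U, τ (φ j z) = z
  existsUnique : ∀ z ∈ U, ∀ ζ ∈ A.carrier, τ ζ = z → ∃! j, φ j z = ζ
  circle : ∀ j, ∀ z ∈ U, ‖z‖ = 1 → ‖φ j z‖ = 1

/-- The sum `ω ∑_j φ_j'(z) (z / φ_j(z)) ^ s f(φ_j(z))` over the inverse branches `φ_j`, where `ω`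
is the orientation sign of `τ`. For `s = 0` this is the sum of `ω φ_j' f(φ_j)`, the transfer
operator for densities with respect to `dz`. For `s = 1` the weight `ω z φ_j'(z) / φ_j(z)` is
equal to `|φ_j'(z)|`, the derivative of the inverse branch in the angular coordinate, on the unit
circle, and the sum is the transfer operator for densities with respect to arc length. -/
def branchSum (τ : ℂ → ℂ) (s : ℤ) {d : ℕ} (φ : Fin d → ℂ → ℂ) (f : ℂ → ℂ) (z : ℂ) : ℂ :=
  orientationSign τ * ∑ j, deriv (φ j) z * (z / φ j z) ^ s * f (φ j z)

/-- The Perron-Frobenius operator of the circle map `τ` with respect to arc length, at a point `z`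
of the unit circle: the sum of `f(ζ) / |τ'(ζ)|` over the preimages `ζ` of `z` on the circle. -/
def circlePerronFrobenius (τ : ℂ → ℂ) (f : ℂ → ℂ) (z : ℂ) : ℂ :=
  ∑ᶠ ζ ∈ {ζ : ℂ | ‖ζ‖ = 1 ∧ τ ζ = z}, f ζ / (‖deriv τ ζ‖ : ℂ)

/-- `L_{kl} = (1 / 2π) ∫_0^{2π} ψ_k(τ(exp (i θ))) ψ_l(exp (i θ)) dθ`. -/
def fourierEntry (τ : ℂ → ℂ) (k l : ℤ) : ℂ :=
  1 / (2 * Real.pi) * ∫ θ in (0 : ℝ)..(2 * Real.pi),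
    τ (Complex.exp (θ * Complex.I)) ^ k * Complex.exp (θ * Complex.I) ^ l

/-- The generalised eigenspace of `T` at `μ`; its dimension is the algebraic multiplicity. -/
def genEigenspace {A : UnitAnnulus} (T : HardySpace A →L[ℂ] HardySpace A) (μ : ℂ) :
    Submodule ℂ (HardySpace A) :=
  Module.End.maxGenEigenspace (T : HardySpace A →ₗ[ℂ] HardySpace A) μ

/-- `e 0, e 1, …` enumerates the non-zero eigenvalues of `T`, each repeated according to its
(finite) algebraic multiplicity. If there are only finitely many of them, then the sequence is
continued by zeros. -/
structure IsEigenvalueEnumeration {A : UnitAnnulus} (T : HardySpace A →L[ℂ] HardySpace A)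
    (e : ℕ → ℂ) : Prop where
  finiteDimensional : ∀ μ : ℂ, μ ≠ 0 → FiniteDimensional ℂ (genEigenspace T μ)
  encard_eq : ∀ μ : ℂ, μ ≠ 0 →
    {n | e n = μ}.encard = (Module.finrank ℂ (genEigenspace T μ) : ℕ∞)
  eq_zero : ∀ n, e n = 0 → e (n + 1) = 0

end CircleEDMD

end

/-! Substituting z = τ(ζ) in the integral for the k-th Laurent coefficient of ℒ_s f gives the mean
of τ^(s-1-k) ζ^(1-s) f over a circle |ζ| = ρ; the sign ω compensates for a reversed contour. The
operator is built from these functionals (`IsExpandingOn.exists_transferOperator`), and the formula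
with inverse branches is recovered afterwards.

The mean does not depend on ρ. Expansion provides radii p, q inside the annulus such that |τ| stays
above a number larger than R on |ζ| = p and below a number smaller than r on |ζ| = q. Using p for k
≥ 0 and q for k < 0, the coefficients decay geometrically relative to the norm of ψ_k. Since both
circles are interior, only a geometrically damped norm of the coefficients of f enters. This gain on
both sides bounds the truncation error by C θ^n with θ < 1 (`exists_coeff_operator`); compactness
follows because the truncations have finite rank. The matrix entries are the functionals evaluated
on the modes.

Summing the Laurent series of ℒf as two geometric series yields the difference of two integrals with
kernel 1/(τ - z), and the residue theorem turns it into a sum over the preimages of z in the annulus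
(`IsExpandingOn.transferOperator_eq_sum`). For f = τ' and s = 0 this sum is ω times the number of
preimages, which is thus continuous and integer valued, hence a constant d. So d local inverses with
distinct values exhaust each fibre.

The spectral part is abstract. Riesz theory splits off the generalised eigenspace at μ ≠ 0, and the
implicit function theorem continues it to an invariant subspace of every nearby operator, with
eigenvalues ν satisfying |ν - μ|^k ≤ C ‖T' - T‖ (`eventually_exists_invariant_subspace`). So
multiplicity near μ cannot be lost. If the eigenvalues of the truncations are enumerated greedily,
always taking the remaining one nearest to the next eigenvalue of ℒ, then a pigeonhole count shows
that the m-th terms converge, with exponential rate a / k (`exists_convergent_enumerations`). -/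

noncomputable section

namespace CircleEDMD

/-! ### Riesz theory of compact operators -/

section RieszTheory

variable {H : Type*} [NormedAddCommGroup H] [NormedSpace ℂ H]

/-- Riesz's lemma picks bounded x_n in V_(n+1) at distance at least 1 from V_n. For m < n, T x_n - T
x_m is μ_n times x_n minus an element of V_n, so the images are δ-separated and have no convergent
subsequence. The scalars may vary with n: a constant sequence serves kernels of powers, a varying
one serves spans of eigenvectors. -/
theorem isCompactOperator_no_chain {T : H →L[ℂ] H} (hT : IsCompactOperator T)
    {V : ℕ → Submodule ℂ H} (hV : StrictMono V) (hclosed : ∀ n, IsClosed (V n : Set H))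
    {δ : ℝ} (hδ : 0 < δ) {μ : ℕ → ℂ} (hμ : ∀ n, δ ≤ ‖μ n‖)
    (h : ∀ n, ∀ x ∈ V (n + 1), T x - μ n • x ∈ V n) : False := by
  obtain ⟨c, hc⟩ := NormedField.exists_one_lt_norm ℂ
  have hμ0 : ∀ n, μ n ≠ 0 := fun n h0 => by
    have := hμ n
    rw [h0, norm_zero] at this
    linarith
  have key : ∀ n, ∃ x ∈ V (n + 1), ‖x‖ ≤ ‖c‖ + 1 ∧ ∀ y ∈ V n, 1 ≤ ‖x - y‖ := by
    intro n
    have h₁ : IsClosed ((V n).comap (V (n + 1)).subtype : Set (V (n + 1))) :=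
      (hclosed n).preimage continuous_subtype_val
    have h₂ : ∃ x : V (n + 1), x ∉ (V n).comap (V (n + 1)).subtype := by
      obtain ⟨x, hx, hx'⟩ := SetLike.exists_of_lt (hV n.lt_succ_self)
      exact ⟨⟨x, hx⟩, hx'⟩
    obtain ⟨⟨x, hx⟩, hxn, hxy⟩ := riesz_lemma_of_norm_lt hc (lt_add_one ‖c‖) h₁ h₂
    exact ⟨x, hx, hxn, fun y hy => hxy ⟨y, hV.monotone n.le_succ hy⟩ hy⟩
  choose x hxV hxn hxy using key
  have hT' : ∀ n, T (x n) ∈ V (n + 1) := fun n => by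
    have := (V (n + 1)).add_mem (hV.monotone n.le_succ (h n _ (hxV n)))
      ((V (n + 1)).smul_mem (μ n) (hxV n))
    simpa using this
  have hsep : ∀ m n, m < n → δ ≤ ‖T (x n) - T (x m)‖ := by
    intro m n hmn
    have hu : T (x m) - (T (x n) - μ n • x n) ∈ V n :=
      (V n).sub_mem (hV.monotone hmn (hT' m)) (h n _ (hxV n))
    have h1 := hxy n _ ((V n).smul_mem (μ n)⁻¹ hu)
    have h2 : T (x n) - T (x m) =
        μ n • (x n - (μ n)⁻¹ • (T (x m) - (T (x n) - μ n • x n))) := by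
      rw [smul_sub, smul_inv_smul₀ (hμ0 n)]
      abel
    rw [h2, norm_smul]
    nlinarith [hμ n, norm_nonneg (μ n)]
  obtain ⟨K, hK, hK'⟩ := hT.image_closedBall_subset_compact (‖c‖ + 1)
  obtain ⟨y, -, ψ, hψ, hψy⟩ := hK.tendsto_subseq (fun n => hK' ⟨x n, by simpa using hxn n, rfl⟩)
  replace hψy := hψy.cauchySeq
  rw [Metric.cauchySeq_iff'] at hψy
  obtain ⟨N, hN⟩ := hψy δ hδ
  have h3 : ‖T (x (ψ (N + 1))) - T (x (ψ N))‖ < δ := by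
    simpa [dist_eq_norm_sub] using hN (N + 1)
  exact h3.not_ge (hsep _ _ (hψ N.lt_succ_self))

/-- Every term of the binomial expansion except the constant one contains a factor T. Hence the
Fredholm alternative also applies to powers of T - μ. -/
theorem isCompactOperator_pow_sub {T : H →L[ℂ] H} (hT : IsCompactOperator T) (μ : ℂ) (p : ℕ) :
    IsCompactOperator ((T - μ • 1) ^ p - ((-μ) ^ p) • (1 : H →L[ℂ] H) : H →L[ℂ] H) := by
  induction p with
  | zero => simpa using isCompactOperator_zero
  | succ p ih =>
    have h : (T - μ • 1) ^ (p + 1) - ((-μ) ^ (p + 1)) • (1 : H →L[ℂ] H) =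
        T * (T - μ • 1) ^ p - μ • ((T - μ • 1) ^ p - ((-μ) ^ p) • (1 : H →L[ℂ] H)) := by
      rw [pow_succ' (T - μ • 1), sub_mul, smul_mul_assoc, one_mul, pow_succ' (-μ), smul_sub,
        smul_smul, neg_mul, neg_smul]
      abel
    rw [h]
    exact (hT.comp_clm _).sub (ih.smul μ)

/-- If the kernels of the powers of T - μ grew strictly for ever, they would form a chain forbidden
by `isCompactOperator_no_chain`. -/
theorem exists_ker_pow_stable {T : H →L[ℂ] H} (hT : IsCompactOperator T) {μ : ℂ} (hμ : μ ≠ 0) :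
    ∃ p : ℕ, ∀ x : H, ∀ k : ℕ, ((T - μ • 1) ^ k : H →L[ℂ] H) x = 0 →
      ((T - μ • 1) ^ p : H →L[ℂ] H) x = 0 := by
  set S : H →L[ℂ] H := T - μ • 1 with hS
  set V : ℕ → Submodule ℂ H := fun n => LinearMap.ker ((S ^ n : H →L[ℂ] H) : H →ₗ[ℂ] H) with hV
  have hmem : ∀ n x, x ∈ V n ↔ (S ^ n) x = 0 := fun n x => LinearMap.mem_ker
  have hle : ∀ n, V n ≤ V (n + 1) := fun n x hx => by
    rw [hmem] at hx ⊢
    rw [pow_succ', mul_apply_eq_comp, hx, map_zero]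
  have hstab : ∃ p, V (p + 1) ≤ V p := by
    by_contra! hcon
    refine isCompactOperator_no_chain hT (V := V) (μ := fun _ => μ)
      (strictMono_nat_of_lt_succ fun n => lt_of_le_not_ge (hle n) (hcon n))
      (fun n => (S ^ n).isClosed_ker) (norm_pos_iff.2 hμ) (fun _ => le_rfl) fun n x hx => ?_
    rw [hmem] at hx ⊢
    rw [pow_succ, mul_apply_eq_comp] at hx
    simpa [hS] using hx
  obtain ⟨p, hp⟩ := hstab
  refine ⟨p, fun x k => ?_⟩
  induction k generalizing x with
  | zero => intro h; simp at h; simp [h]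
  | succ k ih =>
    intro h
    rw [pow_succ, mul_apply_eq_comp] at h
    rw [← hmem]
    refine hp ?_
    rw [hmem, pow_succ, mul_apply_eq_comp]
    exact ih _ h

variable [CompleteSpace H]

/-- Infinitely many eigenvalues of modulus at least δ would give independent eigenvectors v_0, v_1,
…, and their successive spans form a forbidden chain: T - ν_n annihilates the last vector v_n. -/
theorem isCompactOperator_finite_spectrum {T : H →L[ℂ] H} (hT : IsCompactOperator T)
    {δ : ℝ} (hδ : 0 < δ) : {μ ∈ spectrum ℂ T | δ ≤ ‖μ‖}.Finite := by
  by_contra hinf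
  have hinf : {μ ∈ spectrum ℂ T | δ ≤ ‖μ‖}.Infinite := hinf
  set ν : ℕ ↪ {μ ∈ spectrum ℂ T | δ ≤ ‖μ‖} := hinf.natEmbedding
  have hν0 : ∀ n, (ν n : ℂ) ≠ 0 := fun n h0 => by
    have := (ν n).2.2
    rw [h0, norm_zero] at this
    linarith
  have hev : ∀ n, ∃ v, Module.End.HasEigenvector (T : H →ₗ[ℂ] H) (ν n : ℂ) v := fun n =>
    ((hT.hasEigenvalue_iff_mem_spectrum (hν0 n)).2 (ν n).2.1).exists_hasEigenvector
  choose v hv using hev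
  have hinj : Function.Injective fun n => (ν n : ℂ) :=
    Subtype.val_injective.comp ν.injective
  have hli : LinearIndependent ℂ v :=
    Module.End.eigenvectors_linearIndependent' (T : H →ₗ[ℂ] H) _ hinj v hv
  set V : ℕ → Submodule ℂ H := fun n => Submodule.span ℂ (v '' Iio n) with hVdef
  have hfd : ∀ n, FiniteDimensional ℂ (V n) := fun n =>
    FiniteDimensional.span_of_finite ℂ ((Set.finite_Iio n).image v)
  refine isCompactOperator_no_chain hT (V := V) (strictMono_nat_of_lt_succ fun n => ?_)
    (fun n => (V n).closed_of_finiteDimensional) hδ (fun n => (ν n).2.2) fun n x hx => ?_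
  · refine lt_of_le_of_ne (Submodule.span_mono (image_mono (Iio_subset_Iio n.le_succ)))
      fun heq => ?_
    have h1 : v n ∈ V n := heq ▸ Submodule.subset_span ⟨n, Nat.lt_succ_self n, rfl⟩
    exact hli.notMem_span_image (s := Iio n) (x := n) (by simp) h1
  · induction hx using Submodule.span_induction with
    | mem x hx =>
      obtain ⟨i, hi, rfl⟩ := hx
      have h1 : T (v i) = (ν i : ℂ) • v i := (hv i).apply_eq_smul
      rw [h1, ← sub_smul]
      rcases (Nat.lt_succ_iff.1 hi).eq_or_lt with rfl | hlt
      · simp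
      · exact (V n).smul_mem _ (Submodule.subset_span ⟨i, hlt, rfl⟩)
    | zero => simp
    | add x y _ _ hx hy =>
      have : T (x + y) - (ν n : ℂ) • (x + y) =
          (T x - (ν n : ℂ) • x) + (T y - (ν n : ℂ) • y) := by
        rw [map_add, smul_add]; abel
      rw [this]
      exact (V n).add_mem hx hy
    | smul c x _ hx =>
      have : T (c • x) - (ν n : ℂ) • c • x = c • (T x - (ν n : ℂ) • x) := by
        rw [map_smul, smul_sub, smul_comm]
      rw [this]
      exact (V n).smul_mem c hx

theorem isUnit_sub_smul_of_not_hasEigenvalue {T : H →L[ℂ] H} (hT : IsCompactOperator T) {μ : ℂ}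
    (hμ : μ ≠ 0) (h : ∀ x, T x = μ • x → x = 0) : IsUnit (T - μ • 1) := by
  have h2 := (hT.hasEigenvalue_or_mem_resolventSet hμ).resolve_left fun hev => by
    obtain ⟨x, hx⟩ := hev.exists_hasEigenvector
    exact hx.2 (h x hx.apply_eq_smul)
  rw [spectrum.mem_resolventSet_iff, ← IsUnit.neg_iff, neg_sub, Algebra.algebraMap_eq_smul_one]
    at h2
  exact h2

/-- The spectral decomposition of a compact operator at a nonzero point `μ`: the generalised
eigenspace is finite dimensional and is the range of a continuous projection which commutes with
the operator, and the operator minus `μ` is invertible on the kernel of the projection. -/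
theorem exists_spectral_projection {T : H →L[ℂ] H} (hT : IsCompactOperator T) {μ : ℂ}
    (hμ : μ ≠ 0) : ∃ (E : Submodule ℂ H) (p : ℕ) (P : H →L[ℂ] E),
      E = Module.End.maxGenEigenspace (T : H →ₗ[ℂ] H) μ ∧ FiniteDimensional ℂ E ∧
      (∀ x ∈ E, ((T - μ • 1) ^ p : H →L[ℂ] H) x = 0) ∧ (∀ x : E, P x = x) ∧
      (∀ x, T (P x) = P (T x)) ∧
      IsUnit (T - μ • 1 - T ∘L E.subtypeL ∘L P) := by
  obtain ⟨p, hp⟩ := exists_ker_pow_stable hT hμ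
  set S : H →L[ℂ] H := T - μ • 1 with hS
  set E : Submodule ℂ H := LinearMap.ker ((S ^ p : H →L[ℂ] H) : H →ₗ[ℂ] H) with hE
  have hmem : ∀ x, x ∈ E ↔ (S ^ p) x = 0 := fun x => LinearMap.mem_ker
  have hEmax : E = Module.End.maxGenEigenspace (T : H →ₗ[ℂ] H) μ := by
    have hpow : ∀ (k : ℕ) (x : H), ((T : H →ₗ[ℂ] H) - μ • 1 : Module.End ℂ H) ^ k • x =
        (S ^ k) x := by
      intro k
      induction k with
      | zero => intro x; simp
      | succ k ih =>
        intro x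
        rw [pow_succ, pow_succ, mul_smul, mul_apply_eq_comp, ih]
        congr 1
    ext x
    rw [hmem, Module.End.mem_maxGenEigenspace]
    constructor
    · exact fun h => ⟨p, by rw [← Module.End.smul_def, hpow, h]⟩
    · rintro ⟨k, hk⟩
      refine hp x k ?_
      rw [← hpow, Module.End.smul_def, hk]
  have hclosed : IsClosed (E : Set H) := (S ^ p).isClosed_ker
  have hμp : (-μ) ^ p ≠ 0 := pow_ne_zero _ (neg_ne_zero.2 hμ)
  have hK := isCompactOperator_pow_sub hT μ p
  rw [← hS] at hK
  -- The power S ^ p vanishes on E, so a multiple of the compact operator S ^ p - (-μ) ^ p restricts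
  -- to the identity of E.
  have hfin : FiniteDimensional ℂ E := by
    have hK2 := hK.smul (-((-μ) ^ p)⁻¹)
    have hmaps : ∀ x ∈ E, (-((-μ) ^ p)⁻¹ • (S ^ p - ((-μ) ^ p) • (1 : H →L[ℂ] H)) :
        H →L[ℂ] H) x = x := by
      intro x hx
      rw [hmem] at hx
      simp [hx, smul_smul, hμp]
    have h1 : IsCompactOperator ((-((-μ) ^ p)⁻¹ • (S ^ p - ((-μ) ^ p) • (1 : H →L[ℂ] H)) :
        H →L[ℂ] H) : H →ₗ[ℂ] H) := hK2
    have h2 := h1.restrict (V := E) (fun x hx => by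
      change (-((-μ) ^ p)⁻¹ • (S ^ p - ((-μ) ^ p) • (1 : H →L[ℂ] H)) :
        H →L[ℂ] H) x ∈ E
      rw [hmaps x hx]; exact hx) hclosed
    refine FiniteDimensional.of_isCompactOperator_id (𝕜 := ℂ) (E := E) ?_
    convert! h2 using 1
    funext x
    exact Subtype.ext (hmaps x x.2).symm
  -- An arbitrary continuous projection onto E is corrected to the one along the range of S ^ p. As
  -- range and kernel of S ^ p meet only in 0, W = S ^ p + P₀ is injective, and it is invertible
  -- because it is a compact perturbation of a nonzero scalar.
  obtain ⟨P₀, hP₀⟩ := Submodule.ClosedComplemented.of_finiteDimensional E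
  have hinter : ∀ x, (S ^ p) x ∈ E → (S ^ p) x = 0 := by
    intro x hx
    rw [hmem, ← mul_apply_eq_comp, ← pow_add] at hx
    exact hp x _ hx
  set W : H →L[ℂ] H := S ^ p + E.subtypeL ∘L P₀ with hW
  have hWapp : ∀ x, W x = (S ^ p) x + P₀ x := fun x => rfl
  have hWunit : IsUnit W := by
    have hc : IsCompactOperator (W - ((-μ) ^ p) • (1 : H →L[ℂ] H) : H →L[ℂ] H) := by
      have h1 : W - ((-μ) ^ p) • (1 : H →L[ℂ] H) =
          (S ^ p - ((-μ) ^ p) • (1 : H →L[ℂ] H)) + E.subtypeL ∘L P₀ := by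
        rw [hW]; abel
      rw [h1]
      have hP₀c : IsCompactOperator P₀ := by
        have := FiniteDimensional.proper ℂ E
        exact isCompactOperator_of_locallyCompactSpace_dom P₀
      exact hK.add (hP₀c.clm_comp E.subtypeL)
    have h2 := isUnit_sub_smul_of_not_hasEigenvalue hc (neg_ne_zero.2 hμp) fun x h3 => ?_
    · rwa [neg_smul, sub_neg_eq_add, sub_add_cancel] at h2
    · replace h3 : (W - ((-μ) ^ p) • (1 : H →L[ℂ] H)) x = -((-μ) ^ p) • x := h3
      have h4 : W x = 0 := by
        simpa [sub_eq_iff_eq_add] using h3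
      rw [hWapp] at h4
      have h5 : (S ^ p) x = 0 := by
        refine hinter x ?_
        rw [eq_neg_of_add_eq_zero_left h4]
        exact E.neg_mem (P₀ x).2
      have h6 := hP₀ ⟨x, (hmem x).2 h5⟩
      rw [h5, zero_add] at h4
      have h7 : (P₀ x : H) = x := congrArg Subtype.val h6
      rw [← h7, h4]
  obtain ⟨w, hw⟩ := hWunit
  have hw1 : ∀ x, W ((↑w⁻¹ : H →L[ℂ] H) x) = x := fun x => by
    rw [← mul_apply_eq_comp, ← hw, Units.mul_inv]; rfl
  have hw2 : ∀ x, (↑w⁻¹ : H →L[ℂ] H) (W x) = x := fun x => by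
    rw [← mul_apply_eq_comp, ← hw, Units.inv_mul]; rfl
  -- Writing y = W x = S ^ p x + P₀ x exhibits P₀ W⁻¹ y as the component of y in E.
  set P : H →L[ℂ] E := P₀ ∘L (↑w⁻¹ : H →L[ℂ] H) with hP
  have hPE : ∀ x : E, P x = x := by
    intro x
    have h1 : W x = x := by
      rw [hWapp, (hmem x).1 x.2, zero_add, hP₀]
    have h2 := hw2 x
    rw [h1] at h2
    change P₀ ((↑w⁻¹ : H →L[ℂ] H) x) = x
    rw [h2, hP₀]
  have hPS : ∀ x, P ((S ^ p) x) = 0 := by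
    intro x
    set x' := (↑w⁻¹ : H →L[ℂ] H) ((S ^ p) x) with hx'
    have h1 : (S ^ p) x' + P₀ x' = (S ^ p) x := by rw [← hWapp, hx', hw1]
    have h2 : (S ^ p) (x - x') = P₀ x' := by rw [map_sub, ← h1]; abel
    have h3 := hinter (x - x') (h2 ▸ (P₀ x').2)
    change P₀ x' = 0
    rw [h2] at h3
    exact Subtype.ext h3
  have hdec : ∀ y : H, ∃ x, y = (S ^ p) x + P y := fun y =>
    ⟨(↑w⁻¹ : H →L[ℂ] H) y, by
      change y = _ + (P₀ ((↑w⁻¹ : H →L[ℂ] H) y) : H)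
      rw [← hWapp, hw1]⟩
  have hcomm : ∀ x, T ((S ^ p) x) = (S ^ p) (T x) := by
    have h1 : Commute T (S ^ p) :=
      ((Commute.refl T).sub_right ((Commute.one_right T).smul_right μ)).pow_right p
    exact fun x => congrArg (fun A : H →L[ℂ] H => A x) h1.eq
  have hTE : ∀ x ∈ E, T x ∈ E := by
    intro x hx
    rw [hmem] at hx ⊢
    rw [← hcomm, hx, map_zero]
  refine ⟨E, p, P, hEmax, hfin, fun x hx => (hmem x).1 hx, hPE, fun y => ?_, ?_⟩
  · obtain ⟨x, hx⟩ := hdec y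
    have h1 : T y = (S ^ p) (T x) + T (P y) := by
      conv_lhs => rw [hx]
      rw [map_add, hcomm]
    rw [h1, map_add, hPS, zero_add]
    exact (congrArg Subtype.val (hPE ⟨_, hTE _ (P y).2⟩)).symm
  · have hc : IsCompactOperator (T - T ∘L E.subtypeL ∘L P : H →L[ℂ] H) :=
      hT.sub (hT.comp_clm _)
    have h2 := isUnit_sub_smul_of_not_hasEigenvalue hc hμ fun y h3 => ?_
    · rw [sub_right_comm] at h2
      exact h2
    -- Injectivity: with y = S ^ p x + P y the equation becomes S (S ^ p x) = μ P y. This vector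
    -- lies both in E and in the range of S ^ p, so it vanishes; then P y = 0, and S ^ p x = 0 by
    -- stability of the kernels.
    · replace h3 : T y - T (P y) = μ • y := h3
      obtain ⟨x, hx⟩ := hdec y
      have h4 : S y = T (P y) := by
        have : S y = T y - μ • y := by simp [hS]
        rw [this, ← h3]; abel
      have h5 : S (P y) = T (P y) - μ • (P y : H) := by simp [hS]
      have h6 : S ((S ^ p) x) = μ • (P y : H) := by
        have : S y = S ((S ^ p) x) + S (P y) := by
          conv_lhs => rw [hx]
          rw [map_add]
        rw [h4, h5] at this
        rw [eq_comm, ← add_sub_assoc, sub_eq_iff_eq_add, add_comm] at this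
        exact add_left_cancel this
      have h7 : S ((S ^ p) x) = (S ^ p) (S x) := by
        rw [← mul_apply_eq_comp, ← mul_apply_eq_comp, ← pow_succ,
          ← pow_succ']
      have h8 : (P y : H) = 0 := by
        have := hinter (S x) (by rw [← h7, h6]; exact E.smul_mem _ (P y).2)
        rw [← h7, h6] at this
        exact (smul_eq_zero.1 this).resolve_left hμ
      have h9 : (S ^ p) x = 0 := by
        refine hp x (p + 1) ?_
        rw [pow_succ', mul_apply_eq_comp, h6, h8, smul_zero]
      rw [hx, h8, h9, add_zero]

end RieszTheory

/-! ### Differentiability of operator-valued maps -/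

section Calculus

variable {U V W : Type*} [NormedAddCommGroup U] [NormedSpace ℂ U] [NormedAddCommGroup V]
  [NormedSpace ℂ V] [NormedAddCommGroup W] [NormedSpace ℂ W]

theorem isBigO_sub_of_contDiffAt {F : U → W} {x : U} (hF : ContDiffAt ℂ 1 F x) :
    (fun y => F y - F x) =O[𝓝 x] fun y => y - x :=
  (hF.differentiableAt one_ne_zero).isBigO_sub

/-- A quadratic remainder identifies the partial derivative in the second variable, which is all
that the implicit function theorem needs. -/
theorem fderiv_comp_inr_of_quadratic {Φ : U × V → W} {u : U} {v : V}
    (hΦ : ContDiffAt ℂ 1 Φ (u, v)) {G : V →L[ℂ] W} {C : ℝ}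
    (h : ∀ y, ‖Φ (u, v + y) - Φ (u, v) - G y‖ ≤ C * ‖y‖ ^ 2) :
    fderiv ℂ Φ (u, v) ∘L .inr ℂ U V = G := by
  have h1 : HasFDerivAt (fun y => Φ (u, y)) (fderiv ℂ Φ (u, v) ∘L .inr ℂ U V) v :=
    (hΦ.differentiableAt one_ne_zero).hasFDerivAt.comp v (hasFDerivAt_prodMk_right u v)
  refine h1.unique ?_
  rw [hasFDerivAt_iff_isLittleO_nhds_zero]
  refine (Asymptotics.IsBigO.of_bound C (Eventually.of_forall fun y => ?_)).trans_isLittleO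
    (Asymptotics.isLittleO_norm_pow_id one_lt_two)
  rw [norm_pow, norm_norm]
  exact h y

theorem contDiffAt_clm_pow {f : U → (V →L[ℂ] V)} {x : U} (hf : ContDiffAt ℂ 1 f x) (n : ℕ) :
    ContDiffAt ℂ 1 (fun y => f y ^ n) x := by
  induction n with
  | zero => simpa using! contDiffAt_const
  | succ n ih =>
    have h : (fun y => f y ^ (n + 1)) = fun y => (f y ^ n) ∘L f y := by
      funext y
      exact pow_succ _ _
    rw [h]
    exact ih.clm_comp hf

theorem eventually_isUnit_clm [CompleteSpace V] {f : U → (V →L[ℂ] V)} {x : U}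
    (hf : ContDiffAt ℂ 1 f x) (h : IsUnit (f x)) : ∀ᶠ y in 𝓝 x, IsUnit (f y) := by
  have h1 := hf.continuousAt
  have h2 : {A : V →L[ℂ] V | IsUnit A} ∈ 𝓝 (f x) := Units.isOpen.mem_nhds h
  exact h1 h2

end Calculus

/-! ### Continuation of invariant subspaces -/

section Perturbation

variable {H : Type*} [NormedAddCommGroup H] [NormedSpace ℂ H]

/-- Left multiplication by a unit minus right multiplication by a nilpotent, on operators between
two spaces, is invertible. -/
theorem isInvertible_comp_sub_comp {E : Type*} [NormedAddCommGroup E] [NormedSpace ℂ E]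
    {B : H →L[ℂ] H} (hB : IsUnit B) {N : E →L[ℂ] E} (hN : IsNilpotent N)
    {G : (E →L[ℂ] H) →L[ℂ] (E →L[ℂ] H)} (hG : ∀ Y, G Y = B ∘L Y - Y ∘L N) :
    G.IsInvertible := by
  set a : (E →L[ℂ] H) →L[ℂ] (E →L[ℂ] H) := ContinuousLinearMap.compL ℂ E H H B with ha
  set n : (E →L[ℂ] H) →L[ℂ] (E →L[ℂ] H) := (ContinuousLinearMap.compL ℂ E E H).flip N with hn
  have haY : ∀ Y, a Y = B ∘L Y := fun Y => rfl
  have hnY : ∀ Y, n Y = Y ∘L N := fun Y => rfl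
  have hau : IsUnit a := by
    obtain ⟨b, rfl⟩ := hB
    set c : (E →L[ℂ] H) →L[ℂ] (E →L[ℂ] H) :=
      ContinuousLinearMap.compL ℂ E H H (↑b⁻¹ : H →L[ℂ] H) with hc
    have hcY : ∀ Y, c Y = (↑b⁻¹ : H →L[ℂ] H) ∘L Y := fun Y => rfl
    refine ⟨⟨a, c, ?_, ?_⟩, rfl⟩
    · ext1 Y
      rw [mul_apply_eq_comp, haY, hcY, ← ContinuousLinearMap.comp_assoc]
      change ((b : H →L[ℂ] H) * (↑b⁻¹ : H →L[ℂ] H)) ∘L Y = Y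
      rw [Units.mul_inv]
      rfl
    · ext1 Y
      rw [mul_apply_eq_comp, haY, hcY, ← ContinuousLinearMap.comp_assoc]
      change ((↑b⁻¹ : H →L[ℂ] H) * (b : H →L[ℂ] H)) ∘L Y = Y
      rw [Units.inv_mul]
      rfl
  have hnn : IsNilpotent n := by
    obtain ⟨k, hk⟩ := hN
    have hpow : ∀ (j : ℕ) (Y : E →L[ℂ] H), (n ^ j) Y = Y ∘L (N ^ j) := by
      intro j
      induction j with
      | zero => intro Y; rw [pow_zero, pow_zero]; rfl
      | succ j ih =>
        intro Y
        rw [pow_succ, mul_apply_eq_comp, ih, hnY, pow_succ', ContinuousLinearMap.comp_assoc]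
        rfl
    refine ⟨k, ?_⟩
    ext1 Y
    rw [hpow, hk]
    ext x
    simp
  have hcomm : Commute n a := by
    ext1 Y
    rw [mul_apply_eq_comp, mul_apply_eq_comp, haY, hnY, hnY, haY, ContinuousLinearMap.comp_assoc]
  -- Left and right multiplications commute, and a unit plus a commuting nilpotent is a unit.
  have hu : IsUnit (a + -n) := hnn.neg.isUnit_add_left_of_commute hau hcomm.neg_left
  have hGe : G = a + -n := by
    ext1 Y
    rw [hG]
    change _ = a Y + -(n Y)
    rw [haY, hnY, sub_eq_add_neg]
  rw [hGe]
  obtain ⟨u, hu⟩ := hu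
  rw [← hu]
  exact ContinuousLinearMap.IsInvertible.of_inverse (g := ↑u⁻¹) u.mul_inv u.inv_mul

variable [CompleteSpace H]

/-- Perturbation of an isolated invariant subspace. If `E` is a finite dimensional spectral
subspace of `T` for the eigenvalue `μ`, then every operator `T'` close to `T` has an invariant
subspace of the same dimension, on which all eigenvalues of `T'` are close to `μ`. -/
theorem eventually_exists_invariant_subspace {T : H →L[ℂ] H} {μ : ℂ} {E : Submodule ℂ H} {p : ℕ}
    [FiniteDimensional ℂ E] {P : H →L[ℂ] E}
    (hE : ∀ x ∈ E, ((T - μ • 1) ^ p : H →L[ℂ] H) x = 0) (hP : ∀ x : E, P x = x)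
    (hcomm : ∀ x, T (P x) = P (T x)) (hunit : IsUnit (T - μ • 1 - T ∘L E.subtypeL ∘L P)) :
    ∃ C : ℝ, ∀ᶠ T' in 𝓝 T, ∃ W : Submodule ℂ H, FiniteDimensional ℂ W ∧
      Module.finrank ℂ W = Module.finrank ℂ E ∧ (∀ x ∈ W, T' x ∈ W) ∧
      ∀ ν : ℂ, ∀ x ∈ W, x ≠ 0 → T' x = ν • x → ‖ν - μ‖ ^ p ≤ C * ‖T' - T‖ := by
  have : CompleteSpace E := FiniteDimensional.complete ℂ E
  set ι : E →L[ℂ] H := E.subtypeL with hι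
  set J : E →L[ℂ] E := P ∘L T ∘L ι with hJ
  have hPι : P ∘L ι = ContinuousLinearMap.id ℂ E := by ext1 x; exact hP x
  have hTι : T ∘L ι = ι ∘L J := by
    ext1 x
    change T x = P (T x)
    rw [← hcomm, hP]
  have hJpow : ∀ (k : ℕ) (x : E), (((J - μ • 1) ^ k : E →L[ℂ] E) x : H) =
      ((T - μ • 1) ^ k : H →L[ℂ] H) x := by
    intro k
    induction k with
    | zero => intro x; rfl
    | succ k ih =>
      intro x
      rw [pow_succ, pow_succ, mul_apply_eq_comp, mul_apply_eq_comp, ih]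
      congr 1
      have h1 : T x = J x := congrArg (fun A : E →L[ℂ] H => A x) hTι
      change (J x : H) - μ • (x : H) = T x - μ • (x : H)
      rw [h1]
  have hnil : (J - μ • 1) ^ p = 0 := by
    ext1 x
    exact Subtype.ext (by rw [hJpow, hE x x.2]; rfl)
  -- A zero (T', X) of Φ satisfies T' X = X (P T' X), so the range of X is T'-invariant and T' acts
  -- on it as P T' X. The inclusion ι of E is the solution at T.
  set Φ : (H →L[ℂ] H) × (E →L[ℂ] H) → (E →L[ℂ] H) :=
    fun u => u.1 ∘L u.2 - u.2 ∘L (P ∘L u.1 ∘L u.2) with hΦ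
  have hΦc : ContDiff ℂ 1 Φ := by
    have h1 : ContDiff ℂ 1 fun u : (H →L[ℂ] H) × (E →L[ℂ] H) => u.1 ∘L u.2 :=
      contDiff_fst.clm_comp contDiff_snd
    exact h1.sub (contDiff_snd.clm_comp (contDiff_const.clm_comp h1))
  have hΦι : Φ (T, ι) = 0 := by
    simp only [hΦ]
    rw [hTι, ← ContinuousLinearMap.comp_assoc P, hPι, ContinuousLinearMap.id_comp, sub_self]
  have hΦat : ContDiffAt ℂ 1 Φ (T, ι) := hΦc.contDiffAt
  -- The derivative is T Y - T ι P Y - Y J. Subtracting μ from both coefficients changes nothing and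
  -- makes the left one a unit and the right one nilpotent.
  have hpart : ∀ Y, (fderiv ℂ Φ (T, ι) ∘L .inr ℂ (H →L[ℂ] H) (E →L[ℂ] H)) Y =
      (T - μ • 1 - T ∘L ι ∘L P) ∘L Y - Y ∘L (J - μ • 1) := by
    set G : (E →L[ℂ] H) →L[ℂ] (E →L[ℂ] H) :=
      ContinuousLinearMap.compL ℂ E H H (T - μ • 1 - T ∘L ι ∘L P) -
        (ContinuousLinearMap.compL ℂ E E H).flip (J - μ • 1) with hG
    have hGY : ∀ Y, G Y = (T - μ • 1 - T ∘L ι ∘L P) ∘L Y - Y ∘L (J - μ • 1) := fun Y => rfl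
    have hq : ∀ Y, Φ (T, ι + Y) - Φ (T, ι) - G Y = -(Y ∘L (P ∘L T ∘L Y)) := by
      intro Y
      rw [hΦι, hGY]
      ext x
      have e1 : T (P (Y x)) = P (T (Y x)) := hcomm _
      have e2 : T x = P (T x) := congrArg (fun A : E →L[ℂ] H => A x) hTι
      simp only [hΦ, sub_apply, add_apply,
        ContinuousLinearMap.comp_apply, neg_apply,
        smul_apply, one_apply_eq_self, map_sub, map_add, map_smul,
        hJ, hι, Submodule.subtypeL_apply, e1, zero_apply]
      rw [← e2]
      abel
    have hb : ∀ Y, ‖Φ (T, ι + Y) - Φ (T, ι) - G Y‖ ≤ (‖P‖ * ‖T‖) * ‖Y‖ ^ 2 := by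
      intro Y
      rw [hq]
      refine (norm_neg (Y ∘L (P ∘L T ∘L Y))).le.trans ?_
      calc ‖Y ∘L (P ∘L T ∘L Y)‖ ≤ ‖Y‖ * (‖P‖ * (‖T‖ * ‖Y‖)) :=
            (ContinuousLinearMap.opNorm_comp_le _ _).trans (by
              gcongr
              exact (ContinuousLinearMap.opNorm_comp_le _ _).trans (by
                gcongr; exact ContinuousLinearMap.opNorm_comp_le _ _))
        _ = _ := by ring
    intro Y
    rw [fderiv_comp_inr_of_quadratic hΦat hb, hGY]
  have hinv : (fderiv ℂ Φ (T, ι) ∘L .inr ℂ (H →L[ℂ] H) (E →L[ℂ] H)).IsInvertible :=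
    isInvertible_comp_sub_comp hunit ⟨p, hnil⟩ hpart
  set X : (H →L[ℂ] H) → (E →L[ℂ] H) := hΦat.implicitFunction one_ne_zero hinv with hX
  have hXT : X T = ι := hΦat.implicitFunction_apply_self one_ne_zero hinv
  have hXd : ContDiffAt ℂ 1 X T := hΦat.contDiffAt_implicitFunction one_ne_zero hinv
  have hXeq : ∀ᶠ T' in 𝓝 T, Φ (T', X T') = 0 := by
    have := hΦat.eventually_apply_implicitFunction one_ne_zero hinv
    rwa [hΦι] at this
  -- F vanishes at T and is continuously differentiable, so its norm is O(‖T' - T‖); on an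
  -- eigenvector for ν it acts as (ν - μ) ^ p.
  set F : (H →L[ℂ] H) → (E →L[ℂ] E) := fun T' => (P ∘L T' ∘L X T' - μ • 1) ^ p with hF
  have hFd : ContDiffAt ℂ 1 F T :=
    contDiffAt_clm_pow
      ((contDiffAt_const.clm_comp (contDiffAt_id.clm_comp hXd)).sub contDiffAt_const) p
  have hFT : F T = 0 := by
    simp only [hF]
    rw [hXT, ← hJ, hnil]
  have hFO := isBigO_sub_of_contDiffAt hFd
  simp only [hFT, sub_zero] at hFO
  obtain ⟨C, hC⟩ := hFO.bound
  -- At T this operator is the identity. Its invertibility nearby makes X T' injective, so the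
  -- dimension is preserved.
  have hPX : ∀ᶠ T' in 𝓝 T, IsUnit (P ∘L X T') := by
    refine eventually_isUnit_clm (contDiffAt_const.clm_comp hXd) ?_
    rw [hXT, hPι]
    exact isUnit_one
  refine ⟨C, ?_⟩
  filter_upwards [hC, hPX, hXeq] with T' hC hPX hXeq
  have hinj : Function.Injective (X T') := by
    obtain ⟨u, hu⟩ := hPX
    intro x y hxy
    have h1 : (u : E →L[ℂ] E) x = (u : E →L[ℂ] E) y := by
      rw [hu]; exact congrArg P hxy
    have h2 : ∀ z, (↑u⁻¹ : E →L[ℂ] E) ((u : E →L[ℂ] E) z) = z := fun z => by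
      rw [← mul_apply_eq_comp, Units.inv_mul]; rfl
    rw [← h2 x, h1, h2]
  have hinter : ∀ e, T' (X T' e) = X T' (P (T' (X T' e))) := fun e => by
    have := congrArg (fun A : E →L[ℂ] H => A e) hXeq
    exact sub_eq_zero.1 this
  refine ⟨LinearMap.range (X T' : E →ₗ[ℂ] H), inferInstance,
    LinearMap.finrank_range_of_inj hinj, ?_, ?_⟩
  · rintro _ ⟨e, rfl⟩
    exact ⟨_, (hinter e).symm⟩
  · rintro ν _ ⟨e, rfl⟩ hne hev
    have hev : T' (X T' e) = ν • X T' e := hev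
    have he : e ≠ 0 := by
      rintro rfl
      exact hne (map_zero (X T' : E →ₗ[ℂ] H))
    have h1 : P (T' (X T' e)) = ν • e := by
      apply hinj
      rw [← hinter, hev, map_smul]
    have h2 : ∀ k : ℕ, ((P ∘L T' ∘L X T' - μ • 1) ^ k : E →L[ℂ] E) e = (ν - μ) ^ k • e := by
      intro k
      induction k with
      | zero => simp
      | succ k ih =>
        have h3 : (P ∘L T' ∘L X T' - μ • 1 : E →L[ℂ] E) e = (ν - μ) • e := by
          change P (T' (X T' e)) - μ • e = _
          rw [h1, sub_smul]
        rw [pow_succ, mul_apply_eq_comp, h3, map_smul, ih, smul_smul, pow_succ, mul_comm]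
    have h3 : ‖(ν - μ) ^ p • e‖ ≤ ‖F T'‖ * ‖e‖ := by
      rw [← h2 p]
      exact (F T').le_opNorm e
    rw [norm_smul, norm_pow] at h3
    exact (le_of_mul_le_mul_right h3 (norm_pos_iff.2 he)).trans hC

end Perturbation

/-! ### Algebraic multiplicities and invariant subspaces -/

section Multiplicity

variable {H : Type*} [AddCommGroup H] [Module ℂ H]

theorem finrank_finset_sup_le {ι : Type*} (F : Finset ι) (V : ι → Submodule ℂ H)
    (hV : ∀ i ∈ F, FiniteDimensional ℂ (V i)) :
    FiniteDimensional ℂ (F.sup V : Submodule ℂ H) ∧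
      Module.finrank ℂ (F.sup V : Submodule ℂ H) ≤ ∑ i ∈ F, Module.finrank ℂ (V i) := by
  classical
  induction F using Finset.induction_on with
  | empty =>
    rw [Finset.sup_empty, Finset.sum_empty, finrank_bot]
    exact ⟨inferInstance, le_rfl⟩
  | insert a s ha ih =>
    obtain ⟨h1, h2⟩ := ih fun i hi => hV i (Finset.mem_insert_of_mem hi)
    have h3 := hV a (Finset.mem_insert_self a s)
    rw [Finset.sup_insert, Finset.sum_insert ha]
    exact ⟨inferInstance, (Submodule.finrank_add_le_finrank_add_finrank _ _).trans (by gcongr)⟩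

theorem hasEigenvalue_of_maxGenEigenspace_ne_bot {f : Module.End ℂ H} {ν : ℂ}
    (h : f.maxGenEigenspace ν ≠ ⊥) : f.HasEigenvalue ν :=
  Module.End.HasUnifEigenvalue.lt (k := ⊤) zero_lt_one h

/-- The dimension of an invariant subspace is bounded by the sum of the algebraic multiplicities
of the eigenvalues belonging to it. -/
theorem finrank_le_sum_of_invariant {f : Module.End ℂ H} {W : Submodule ℂ H}
    [FiniteDimensional ℂ W] (hW : ∀ x ∈ W, f x ∈ W) {F : Finset ℂ}
    (hF : ∀ ν, ∀ x ∈ W, x ≠ 0 → f x = ν • x → ν ∈ F)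
    (hfin : ∀ ν ∈ F, FiniteDimensional ℂ (f.maxGenEigenspace ν)) :
    Module.finrank ℂ W ≤ ∑ ν ∈ F, Module.finrank ℂ (f.maxGenEigenspace ν) := by
  obtain ⟨h1, h2⟩ := finrank_finset_sup_le F f.maxGenEigenspace hfin
  refine le_trans (Submodule.finrank_mono ?_) h2
  set g : Module.End ℂ W := f.restrict hW with hg
  have htop := Module.End.iSup_maxGenEigenspace_eq_top g
  have hmap : W = (⊤ : Submodule ℂ W).map W.subtype := by
    rw [Submodule.map_top, Submodule.range_subtype]
  rw [hmap, ← htop, Submodule.map_iSup]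
  refine iSup_le fun ν => ?_
  by_cases hbot : g.maxGenEigenspace ν = ⊥
  · rw [hbot, Submodule.map_bot]
    exact bot_le
  · have hνF : ν ∈ F := by
      obtain ⟨x, hx⟩ := (hasEigenvalue_of_maxGenEigenspace_ne_bot hbot).exists_hasEigenvector
      exact hF ν x x.2 (fun h => hx.2 (Subtype.ext h)) (congrArg Subtype.val hx.apply_eq_smul)
    have h3 : (g.maxGenEigenspace ν).map W.subtype ≤ f.maxGenEigenspace ν := by
      rw [hg, ← Submodule.inf_genEigenspace]
      exact inf_le_right
    exact h3.trans (Finset.le_sup (f := f.maxGenEigenspace) hνF)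

/-- Eigenvectors for nonzero eigenvalues lie in the range, so it suffices to restrict to it. -/
theorem finite_nonzero_eigenvalues_of_finite_range {f : Module.End ℂ H}
    [FiniteDimensional ℂ (LinearMap.range f)] : {ν | ν ≠ 0 ∧ f.HasEigenvalue ν}.Finite := by
  have hR : ∀ x ∈ LinearMap.range f, f x ∈ LinearMap.range f := fun x _ => ⟨x, rfl⟩
  refine (Module.End.finite_hasEigenvalue (f.restrict hR)).subset ?_
  rintro ν ⟨hν, hev⟩
  obtain ⟨x, hx⟩ := hev.exists_hasEigenvector
  have hxR : x ∈ LinearMap.range f := ⟨ν⁻¹ • x, by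
    rw [map_smul, hx.apply_eq_smul, smul_smul, inv_mul_cancel₀ hν, one_smul]⟩
  refine Module.End.hasEigenvalue_of_hasEigenvector (x := ⟨x, hxR⟩)
    ⟨Module.End.mem_eigenspace_iff.2 (Subtype.ext hx.apply_eq_smul), fun h => hx.2 ?_⟩
  exact congrArg Subtype.val h

end Multiplicity

/-! ### Enumerations with multiplicity -/

section Enumeration

/-- Enumerate a finite multiset of nonzero numbers by successively choosing, among those which
are left, one that is nearest to the next term of a given sequence. -/
theorem exists_greedy_enumeration (s : Multiset ℂ) (h0 : (0 : ℂ) ∉ s) (e : ℕ → ℂ) :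
    ∃ x : ℕ → ℂ, (∀ μ, μ ≠ 0 → {n | x n = μ}.encard = (s.count μ : ℕ∞)) ∧
      (∀ n, x n = 0 → x (n + 1) = 0) ∧
      ∀ m ν, ((Finset.range m).filter fun i => x i = ν).card < s.count ν →
        ‖x m - e m‖ ≤ ‖ν - e m‖ := by
  induction hn : Multiset.card s generalizing s e with
  | zero =>
    rw [Multiset.card_eq_zero] at hn
    subst hn
    refine ⟨fun _ => 0, fun μ hμ => ?_, fun _ _ => rfl, fun m ν h => by simp at h⟩
    simp [hμ.symm]
  | succ k ih =>
    have hs : s.toFinset.Nonempty := by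
      rw [Multiset.toFinset_nonempty]
      rintro rfl
      simp at hn
    -- The inequality between counts in the last clause expresses that ν is still available at step
    -- m. The element nearest to `e 0` goes first; the others are enumerated against the shifted
    -- sequence.
    obtain ⟨ν₀, hν₀, hmin⟩ := s.toFinset.exists_min_image (fun ν => ‖ν - e 0‖) hs
    rw [Multiset.mem_toFinset] at hν₀
    obtain ⟨x, hx1, hx2, hx3⟩ := ih (s.erase ν₀) (fun h => h0 (Multiset.mem_of_mem_erase h))
      (fun n => e (n + 1)) (by rw [Multiset.card_erase_of_mem hν₀, hn]; rfl)
    have hne : ν₀ ≠ 0 := fun h => h0 (h ▸ hν₀)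
    set y : ℕ → ℂ := fun n => Nat.casesOn n ν₀ x with hy
    have hy0 : y 0 = ν₀ := rfl
    have hyS : ∀ n, y (n + 1) = x n := fun _ => rfl
    refine ⟨y, fun μ hμ => ?_, fun n h => ?_, fun m ν h => ?_⟩
    · have hset : {n | y n = μ} = (if ν₀ = μ then {0} else ∅) ∪ Nat.succ '' {n | x n = μ} := by
        ext n
        cases n with
        | zero => by_cases hc : ν₀ = μ <;> simp [hc, hy0]
        | succ n => by_cases hc : ν₀ = μ <;> simp [hc, hyS]
      have himg : (Nat.succ '' {n | x n = μ}).encard = ((s.erase ν₀).count μ : ℕ∞) := by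
        rw [Nat.succ_injective.encard_image, hx1 μ hμ]
      rw [hset, encard_union_eq, himg]
      · by_cases hc : ν₀ = μ
        · subst hc
          rw [if_pos rfl, encard_singleton, Multiset.count_erase_self]
          have : 1 ≤ s.count ν₀ := Multiset.one_le_count_iff_mem.2 hν₀
          rw [← Nat.cast_one, ← Nat.cast_add]
          congr 1
          omega
        · rw [if_neg hc, encard_empty, zero_add, Multiset.count_erase_of_ne (Ne.symm hc)]
      · rw [Set.disjoint_left]
        rintro n hn ⟨i, -, rfl⟩
        by_cases hc : ν₀ = μ <;> simp [hc] at hn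
    · cases n with
      | zero => exact absurd h hne
      | succ n => exact hx2 n h
    · cases m with
      | zero =>
        refine hmin ν ?_
        rw [Multiset.mem_toFinset]
        exact Multiset.one_le_count_iff_mem.1 (Nat.one_le_iff_ne_zero.2 (by omega))
      | succ m =>
        refine hx3 m ν ?_
        -- Splitting off index 0 from the count matches the removal of one copy of ν₀.
        rw [Finset.card_filter, Finset.sum_range_succ'] at h
        simp only [hyS, hy0] at h
        rw [Finset.card_filter]
        by_cases hc : ν₀ = ν
        · subst hc
          rw [Multiset.count_erase_self]
          simp only [if_true] at h
          omega
        · rw [Multiset.count_erase_of_ne (Ne.symm hc)]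
          simpa [hc] using h

/-- The index set consists of pairs of a point of Λ and one of its m μ copies. It is countable: if
finite it is listed and continued by zeros, otherwise it is in bijection with ℕ. -/
theorem exists_enumeration {Λ : Set ℂ} (hΛ : Λ.Countable) (m : ℂ → ℕ)
    (hm : ∀ μ, μ ≠ 0 → μ ∉ Λ → m μ = 0) (h0 : (0 : ℂ) ∉ Λ) :
    ∃ e : ℕ → ℂ, (∀ μ, μ ≠ 0 → {n | e n = μ}.encard = (m μ : ℕ∞)) ∧
      ∀ n, e n = 0 → e (n + 1) = 0 := by
  have := hΛ.to_subtype
  let X := Σ μ : Λ, Fin (m μ)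
  have hfib : ∀ μ : ℂ, μ ≠ 0 → {x : X | (x.1 : ℂ) = μ}.encard = (m μ : ℕ∞) := by
    intro μ hμ
    by_cases hμΛ : μ ∈ Λ
    · have : {x : X | (x.1 : ℂ) = μ} =
          (fun i : Fin (m μ) => (⟨⟨μ, hμΛ⟩, i⟩ : X)) '' univ := by
        ext ⟨⟨ν, hν⟩, i⟩
        constructor
        · rintro (rfl : ν = μ)
          exact ⟨i, mem_univ i, rfl⟩
        · rintro ⟨j, -, hj⟩
          exact (congrArg (fun x : X => (x.1 : ℂ)) hj).symm
      rw [this, Function.Injective.encard_image, encard_univ, ENat.card_eq_coe_fintype_card,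
        Fintype.card_fin]
      intro i j hij
      exact eq_of_heq (Sigma.mk.inj hij).2
    · rw [hm μ hμ hμΛ, Nat.cast_zero, encard_eq_zero, Set.eq_empty_iff_forall_notMem]
      rintro x rfl
      exact hμΛ x.1.2
  rcases finite_or_infinite X with hX | hX
  · obtain ⟨k, ⟨f⟩⟩ := Finite.exists_equiv_fin X
    refine ⟨fun n => if h : n < k then ((f.symm ⟨n, h⟩).1 : ℂ) else 0, fun μ hμ => ?_,
      fun n hn => ?_⟩
    · have : {n | (if h : n < k then ((f.symm ⟨n, h⟩).1 : ℂ) else 0) = μ} =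
          (fun x => (f x : ℕ)) '' {x : X | (x.1 : ℂ) = μ} := by
        ext n
        simp only [mem_ofPred_eq, mem_image]
        constructor
        · intro h
          split_ifs at h with hn
          · exact ⟨_, h, by simp⟩
          · exact absurd h.symm hμ
        · rintro ⟨x, hx, rfl⟩
          simpa using hx
      rw [this, Function.Injective.encard_image, hfib μ hμ]
      exact Fin.val_injective.comp f.injective
    · by_cases h : n < k
      · simp only [h, dite_true] at hn
        exact absurd (hn ▸ (f.symm ⟨n, h⟩).1.2) h0
      · have h' : ¬ n + 1 < k := by omega
        simp only [h', dite_false]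
  · obtain ⟨f⟩ : Nonempty (X ≃ ℕ) := nonempty_equiv_of_countable
    refine ⟨fun n => ((f.symm n).1 : ℂ), fun μ hμ => ?_, fun n hn => ?_⟩
    · have : {n | ((f.symm n).1 : ℂ) = μ} = f '' {x : X | (x.1 : ℂ) = μ} := by
        ext n
        simp only [mem_ofPred_eq, mem_image]
        constructor
        · exact fun h => ⟨_, h, by simp⟩
        · rintro ⟨x, hx, rfl⟩
          simpa using hx
      rw [this, f.injective.encard_image, hfib μ hμ]
    · exact absurd (hn ▸ (f.symm n).1.2) h0

end Enumeration

/-! ### Approximation of the eigenvalues of a compact operator -/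

section SpectralApproximation

variable {H : Type*} [NormedAddCommGroup H] [NormedSpace ℂ H]

/-- The nonzero eigenvalues of a finite rank operator, with their algebraic multiplicities. -/
theorem exists_eigenvalue_multiset {T : H →L[ℂ] H}
    (hfin : FiniteDimensional ℂ (LinearMap.range (T : H →ₗ[ℂ] H))) :
    ∃ s : Multiset ℂ, 0 ∉ s ∧ ∀ μ, μ ≠ 0 → s.count μ =
      Module.finrank ℂ (Module.End.maxGenEigenspace (T : H →ₗ[ℂ] H) μ) := by
  have hF := finite_nonzero_eigenvalues_of_finite_range (f := (T : H →ₗ[ℂ] H))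
  refine ⟨∑ ν ∈ hF.toFinset, Multiset.replicate
    (Module.finrank ℂ (Module.End.maxGenEigenspace (T : H →ₗ[ℂ] H) ν)) ν, fun h => ?_,
    fun μ hμ => ?_⟩
  · obtain ⟨ν, hν, h⟩ := Multiset.mem_sum.1 h
    rw [hF.mem_toFinset] at hν
    exact hν.1 (Multiset.eq_of_mem_replicate h).symm
  · rw [Multiset.count_sum']
    simp only [Multiset.count_replicate]
    rw [Finset.sum_ite_eq' hF.toFinset μ]
    split_ifs with h
    · rfl
    · by_contra hne
      refine h (hF.mem_toFinset.2 ⟨hμ, hasEigenvalue_of_maxGenEigenspace_ne_bot fun hb => hne ?_⟩)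
      rw [hb, finrank_bot]

variable [CompleteSpace H]

theorem finiteDimensional_maxGenEigenspace {T : H →L[ℂ] H} (hT : IsCompactOperator T) {μ : ℂ}
    (hμ : μ ≠ 0) :
    FiniteDimensional ℂ (Module.End.maxGenEigenspace (T : H →ₗ[ℂ] H) μ) := by
  obtain ⟨E, p, P, hE, hfin, -⟩ := exists_spectral_projection hT hμ
  exact hE ▸ hfin

/-- Lower semicontinuity of the multiplicity, in quantitative form: the continued invariant subspace
has the dimension of the generalised eigenspace at μ, and all its eigenvalues belong to F. -/
theorem eventually_finrank_maxGenEigenspace_le {T : H →L[ℂ] H} (hT : IsCompactOperator T)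
    {μ : ℂ} (hμ : μ ≠ 0) : ∃ (k : ℕ) (C : ℝ), k ≠ 0 ∧ 0 ≤ C ∧ ∀ᶠ (T' : H →L[ℂ] H) in 𝓝 T,
      IsCompactOperator T' → ∀ F : Finset ℂ, 0 ∉ F →
      (∀ ν, Module.End.HasEigenvalue (T' : H →ₗ[ℂ] H) ν → ‖ν - μ‖ ^ k ≤ C * ‖T' - T‖ → ν ∈ F) →
      Module.finrank ℂ (Module.End.maxGenEigenspace (T : H →ₗ[ℂ] H) μ) ≤
        ∑ ν ∈ F, Module.finrank ℂ (Module.End.maxGenEigenspace (T' : H →ₗ[ℂ] H) ν) := by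
  obtain ⟨E, p, P, hE, hfin, hEp, hP, hcomm, hunit⟩ := exists_spectral_projection hT hμ
  -- Passing to p + 1 ensures a nonzero exponent, so that a k-th root can be taken later.
  have hEp' : ∀ x ∈ E, ((T - μ • 1) ^ (p + 1) : H →L[ℂ] H) x = 0 := fun x hx => by
    rw [pow_succ', mul_apply_eq_comp, hEp x hx, map_zero]
  obtain ⟨C, hC⟩ := eventually_exists_invariant_subspace hEp' hP hcomm hunit
  refine ⟨p + 1, max C 0, p.succ_ne_zero, le_max_right _ _, ?_⟩
  filter_upwards [hC] with T' ⟨W, hWfin, hWrank, hWinv, hWeig⟩ hT' F hF0 hF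
  rw [← hE, ← hWrank]
  refine finrank_le_sum_of_invariant (f := (T' : H →ₗ[ℂ] H)) hWinv (fun ν x hx hx0 hxν => ?_)
    fun ν hν => finiteDimensional_maxGenEigenspace hT' fun h => hF0 (h ▸ hν)
  refine hF ν (Module.End.hasEigenvalue_of_hasEigenvector
    ⟨Module.End.mem_eigenspace_iff.2 hxν, hx0⟩) ?_
  refine (hWeig ν x hx hx0 hxν).trans ?_
  gcongr
  exact le_max_left _ _

theorem countable_spectrum {T : H →L[ℂ] H} (hT : IsCompactOperator T) :
    (spectrum ℂ T \ {0}).Countable := by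
  have h : spectrum ℂ T \ {0} ⊆ ⋃ n : ℕ, {μ ∈ spectrum ℂ T | 1 / ((n : ℝ) + 1) ≤ ‖μ‖} := by
    rintro μ ⟨hμ, hμ0⟩
    obtain ⟨n, hn⟩ := exists_nat_one_div_lt (norm_pos_iff.2 hμ0)
    exact mem_iUnion.2 ⟨n, hμ, hn.le⟩
  exact (countable_iUnion fun n =>
    (isCompactOperator_finite_spectrum hT (by positivity)).countable).mono h

theorem accPt_spectrum {T : H →L[ℂ] H} (hT : IsCompactOperator T) {μ : ℂ}
    (h : AccPt μ (𝓟 (spectrum ℂ T))) : μ = 0 := by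
  by_contra hμ
  have hpos : 0 < ‖μ‖ / 2 := by positivity
  have hfin := isCompactOperator_finite_spectrum hT hpos
  have hinf : (Metric.ball μ (‖μ‖ / 2) ∩ spectrum ℂ T).Infinite := by
    rw [accPt_iff_frequently_nhdsNE] at h
    have h2 : ∃ᶠ x in 𝓝[≠] μ, x ∈ Metric.ball μ (‖μ‖ / 2) ∩ spectrum ℂ T :=
      (h.and_eventually (mem_nhdsWithin_of_mem_nhds (Metric.ball_mem_nhds μ hpos))).mono
        fun x hx => ⟨hx.2, hx.1⟩
    exact Set.Infinite.of_accPt (accPt_iff_frequently_nhdsNE.2 h2)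
  refine hinf (hfin.subset ?_)
  rintro ν ⟨hν, hνs⟩
  refine ⟨hνs, ?_⟩
  rw [mem_ball_iff_norm] at hν
  have h2 : ‖μ‖ ≤ ‖ν‖ + ‖ν - μ‖ := by
    have := norm_sub_le ν (ν - μ)
    rwa [sub_sub_cancel] at this
  linarith

theorem exists_eigenvalue_enumeration {T : H →L[ℂ] H} (hT : IsCompactOperator T) :
    ∃ e : ℕ → ℂ, (∀ μ, μ ≠ 0 → {n | e n = μ}.encard =
      (Module.finrank ℂ (Module.End.maxGenEigenspace (T : H →ₗ[ℂ] H) μ) : ℕ∞)) ∧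
      ∀ n, e n = 0 → e (n + 1) = 0 := by
  refine exists_enumeration (countable_spectrum hT)
    (fun μ => Module.finrank ℂ (Module.End.maxGenEigenspace (T : H →ₗ[ℂ] H) μ))
    (fun μ hμ hμ' => ?_) fun h => h.2 rfl
  by_contra hne
  have hbot : Module.End.maxGenEigenspace (T : H →ₗ[ℂ] H) μ ≠ ⊥ := fun h => hne (by
    rw [h, finrank_bot])
  exact hμ' ⟨(hT.hasEigenvalue_iff_mem_spectrum hμ).1 (hasEigenvalue_of_maxGenEigenspace_ne_bot
    hbot), hμ⟩

/-- Exponential convergence of the eigenvalues of finite rank operators that approximate a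
compact operator exponentially well in norm. -/
theorem exists_convergent_enumerations {T : H →L[ℂ] H} (hT : IsCompactOperator T)
    {S : ℕ → H →L[ℂ] H} (hS : ∀ n, IsCompactOperator (S n))
    (hfin : ∀ n, FiniteDimensional ℂ (LinearMap.range (S n : H →ₗ[ℂ] H))) {a : ℝ} (ha : 0 < a)
    (hST : (fun n : ℕ => T - S n) =O[atTop] fun n : ℕ => Real.exp (-a * (2 * n + 1))) :
    ∃ (e : ℕ → ℂ) (E : ℕ → ℕ → ℂ),
      ((∀ μ, μ ≠ 0 → {n | e n = μ}.encard =
        (Module.finrank ℂ (Module.End.maxGenEigenspace (T : H →ₗ[ℂ] H) μ) : ℕ∞)) ∧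
        ∀ n, e n = 0 → e (n + 1) = 0) ∧
      (∀ j, (∀ μ, μ ≠ 0 → {n | E j n = μ}.encard =
        (Module.finrank ℂ (Module.End.maxGenEigenspace (S j : H →ₗ[ℂ] H) μ) : ℕ∞)) ∧
        ∀ n, E j n = 0 → E j (n + 1) = 0) ∧
      ∀ m, e m ≠ 0 → ∃ b : ℝ, 0 < b ∧
        (fun n : ℕ => E n m - e m) =O[atTop] fun n : ℕ => Real.exp (-b * (2 * n + 1)) := by
  obtain ⟨e, he1, he2⟩ := exists_eigenvalue_enumeration hT
  choose s hs0 hs using fun n => exists_eigenvalue_multiset (hfin n)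
  choose E hE1 hE2 hE3 using fun n => exists_greedy_enumeration (s n) (hs0 n) e
  refine ⟨e, E, ⟨he1, he2⟩, fun j => ⟨fun μ hμ => by rw [hE1 j μ hμ, hs j μ hμ], hE2 j⟩, ?_⟩
  have hexp : ∀ {b : ℝ}, 0 < b →
      Tendsto (fun n : ℕ => Real.exp (-b * (2 * n + 1))) atTop (𝓝 0) := by
    intro b hb
    refine Real.tendsto_exp_atBot.comp ?_
    have h1 : Tendsto (fun n : ℕ => (2 * (n : ℝ) + 1)) atTop atTop :=
      tendsto_atTop_add_const_right _ _
        (tendsto_natCast_atTop_atTop.const_mul_atTop two_pos)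
    exact h1.const_mul_atTop_of_neg (neg_lt_zero.2 hb)
  have hSlim : Tendsto S atTop (𝓝 T) := by
    have h1 : Tendsto (fun n => T - S n) atTop (𝓝 0) := hST.trans_tendsto (hexp ha)
    have h2 := h1.const_sub T
    simpa using h2
  intro m
  induction m using Nat.strong_induction_on with
  | _ m IH =>
  intro hm
  have hlt : ∀ i, i < m → e i ≠ 0 := by
    intro i hi h0
    have : ∀ j, e (i + j) = 0 := fun j => by
      induction j with
      | zero => exact h0
      | succ j ih => exact he2 _ ih
    exact hm (by simpa [Nat.add_sub_cancel' hi.le] using this (m - i))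
  have hlim : ∀ i, i < m → Tendsto (fun n => E n i) atTop (𝓝 (e i)) := by
    intro i hi
    obtain ⟨b, hb, hO⟩ := IH i hi (hlt i hi)
    have h1 := (hO.trans_tendsto (hexp hb)).add_const (e i)
    simpa using h1
  set μ := e m with hμ
  obtain ⟨k, C, hk, hC, hev⟩ := eventually_finrank_maxGenEigenspace_le hT hm
  -- a radius which separates `μ` from zero and from the previous eigenvalues
  obtain ⟨δ, hδ, hδμ, hδe⟩ : ∃ δ > 0, δ ≤ ‖μ‖ ∧ ∀ i < m, e i ≠ μ → 2 * δ ≤ ‖e i - μ‖ := by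
    have h1 : ∀ M : ℕ, ∃ δ > 0, δ ≤ ‖μ‖ ∧ ∀ i < M, e i ≠ μ → 2 * δ ≤ ‖e i - μ‖ := by
      intro M
      induction M with
      | zero => exact ⟨‖μ‖, norm_pos_iff.2 hm, le_rfl, fun i hi => absurd hi (Nat.not_lt_zero i)⟩
      | succ M ih =>
        obtain ⟨δ, hδ, h1, h2⟩ := ih
        by_cases hM : e M = μ
        · refine ⟨δ, hδ, h1, fun i hi hne => h2 i ?_ hne⟩
          exact lt_of_le_of_ne (Nat.lt_succ_iff.1 hi) fun h => hne (h ▸ hM)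
        · have hpos : 0 < ‖e M - μ‖ := norm_pos_iff.2 (sub_ne_zero.2 hM)
          refine ⟨min δ (‖e M - μ‖ / 2), lt_min hδ (by positivity), (min_le_left _ _).trans h1,
            fun i hi hne => ?_⟩
          rcases (Nat.lt_succ_iff.1 hi).eq_or_lt with rfl | hi
          · linarith [min_le_right δ (‖e i - μ‖ / 2)]
          · linarith [min_le_left δ (‖e M - μ‖ / 2), h2 i hi hne]
    exact h1 m
  have hsmall : ∀ᶠ n in atTop, C * ‖S n - T‖ < δ ^ k := by
    have h1 : Tendsto (fun n => C * ‖S n - T‖) atTop (𝓝 0) := by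
      have := ((tendsto_sub_nhds_zero_iff.2 hSlim).norm).const_mul C
      simpa using this
    exact h1.eventually_lt_const (by positivity)
  have hnear : ∀ᶠ n in atTop, ∀ i < m, ‖E n i - e i‖ < δ := by
    have h1 : ∀ i ∈ Finset.range m, ∀ᶠ n in atTop, ‖E n i - e i‖ < δ := fun i hi => by
      have h2 := (tendsto_sub_nhds_zero_iff.2 (hlim i (Finset.mem_range.1 hi))).norm
      rw [norm_zero] at h2
      exact h2.eventually_lt_const hδ
    filter_upwards [(Filter.eventually_all_finset (Finset.range m)).2 h1] with n hn i hi
    exact hn i (Finset.mem_range.2 hi)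
  have hkey : ∀ᶠ n in atTop, ‖E n m - μ‖ ^ k ≤ C * ‖S n - T‖ := by
    filter_upwards [hSlim.eventually hev, hsmall, hnear] with n hn hsm hnr
    -- F collects the nonzero eigenvalues of `S n` in the small disc about μ; its radius is less
    -- than δ, so 0 is not in the disc.
    set F : Finset ℂ := (finite_nonzero_eigenvalues_of_finite_range
      (f := (S n : H →ₗ[ℂ] H))).toFinset.filter
        fun ν => ‖ν - μ‖ ^ k ≤ C * ‖S n - T‖ with hF
    have hFδ : ∀ ν, ‖ν - μ‖ ^ k ≤ C * ‖S n - T‖ → ‖ν - μ‖ < δ := fun ν hν =>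
      lt_of_pow_lt_pow_left₀ k hδ.le (hν.trans_lt hsm)
    have hF0 : (0 : ℂ) ∉ F := by
      simp [hF]
    have hsum := hn (hS n) F hF0 fun ν hν1 hν2 => by
      rw [hF, Finset.mem_filter, Set.Finite.mem_toFinset]
      refine ⟨⟨?_, hν1⟩, hν2⟩
      rintro rfl
      have := hFδ 0 hν2
      rw [zero_sub, norm_neg] at this
      linarith
    -- Some eigenvalue in F is not yet used up by the first m choices. Otherwise the multiplicity of
    -- μ would be at most the number of i < m with e i = μ, although m itself is a further index
    -- with this property.
    have hcount : ∃ ν ∈ F, ((Finset.range m).filter fun i => E n i = ν).card < (s n).count ν := by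
      by_contra! hcon
      have h1 : Module.finrank ℂ (Module.End.maxGenEigenspace (T : H →ₗ[ℂ] H) μ) ≤
          ((Finset.range m).filter fun i => e i = μ).card := by
        calc _ ≤ ∑ ν ∈ F, Module.finrank ℂ
              (Module.End.maxGenEigenspace (S n : H →ₗ[ℂ] H) ν) := hsum
          _ = ∑ ν ∈ F, (s n).count ν := Finset.sum_congr rfl fun ν hν =>
              (hs n ν fun h => hF0 (h ▸ hν)).symm
          _ ≤ ∑ ν ∈ F, ((Finset.range m).filter fun i => E n i = ν).card :=
              Finset.sum_le_sum hcon
          _ = ((Finset.range m).filter fun i => E n i ∈ F).card := by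
              rw [← Finset.card_biUnion]
              · congr 1
                ext i
                simp [and_comm]
              · intro x _ y _ hxy
                rw [Function.onFun, Finset.disjoint_left]
                intro i hi hi'
                exact hxy ((Finset.mem_filter.1 hi).2.symm.trans (Finset.mem_filter.1 hi').2)
          -- For i < m with E n i in F, both μ and e i are within δ of E n i; as δ separates μ from
          -- the other earlier values, e i = μ.
          _ ≤ _ := by
              refine Finset.card_le_card fun i hi => ?_
              rw [Finset.mem_filter, Finset.mem_range] at hi ⊢
              refine ⟨hi.1, ?_⟩
              by_contra hne
              have h2 := hFδ _ (Finset.mem_filter.1 hi.2).2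
              have h3 := hnr i hi.1
              have h4 := hδe i hi.1 hne
              have h5 : ‖e i - μ‖ ≤ ‖E n i - μ‖ + ‖E n i - e i‖ := by
                have := norm_sub_le (E n i - μ) (E n i - e i)
                rwa [show E n i - μ - (E n i - e i) = e i - μ by ring] at this
              linarith
      have h2 : (((Finset.range (m + 1)).filter fun i => e i = μ).card : ℕ∞) ≤
          (Module.finrank ℂ (Module.End.maxGenEigenspace (T : H →ₗ[ℂ] H) μ) : ℕ∞) := by
        rw [← he1 μ hm, ← Set.encard_coe_eq_coe_finsetCard]
        refine Set.encard_le_encard fun i hi => ?_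
        exact (Finset.mem_filter.1 hi).2
      rw [Nat.cast_le, Finset.range_add_one, Finset.filter_insert, if_pos rfl,
        Finset.card_insert_of_notMem (by simp)] at h2
      omega
    obtain ⟨ν, hν, hlt⟩ := hcount
    calc ‖E n m - μ‖ ^ k ≤ ‖ν - μ‖ ^ k := by
          gcongr
          exact hE3 n m ν hlt
      _ ≤ _ := (Finset.mem_filter.1 hν).2
  obtain ⟨K, hK0, hK⟩ := hST.exists_pos
  -- The k-th root in |E n m - μ| ^ k ≤ C ‖S n - T‖ divides the rate by k.
  refine ⟨a / k, by positivity, Asymptotics.IsBigO.of_bound ((C * K) ^ (k : ℝ)⁻¹) ?_⟩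
  filter_upwards [hkey, hK.bound] with n h1 h2
  rw [norm_sub_rev] at h2
  have hk' : (k : ℝ) ≠ 0 := Nat.cast_ne_zero.2 hk
  have h3 : ‖E n m - μ‖ ^ k ≤
      ((C * K) ^ (k : ℝ)⁻¹ * ‖Real.exp (-(a / k) * (2 * n + 1))‖) ^ k := by
    rw [mul_pow, Real.rpow_inv_natCast_pow (by positivity) hk,
      Real.norm_of_nonneg (Real.exp_pos _).le, ← Real.exp_nat_mul]
    rw [Real.norm_of_nonneg (Real.exp_pos _).le] at h2
    have h4 : (k : ℝ) * (-(a / k) * (2 * n + 1)) = -a * (2 * n + 1) := by field_simp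
    rw [h4, mul_assoc]
    exact h1.trans (by gcongr)
  exact le_of_pow_le_pow_left₀ hk (by positivity) h3

end SpectralApproximation

/-! ### Means over circles -/

section CircleAverage

theorem norm_circleAverage_le {F : ℂ → ℂ} {ρ C : ℝ} (hρ : 0 ≤ ρ)
    (h : ∀ z : ℂ, ‖z‖ = ρ → ‖F z‖ ≤ C) : ‖Real.circleAverage F 0 ρ‖ ≤ C := by
  have h1 : ‖∫ θ in (0 : ℝ)..(2 * Real.pi), F (circleMap 0 ρ θ)‖ ≤ C * |2 * Real.pi - 0| :=
    intervalIntegral.norm_integral_le_of_norm_le_const fun θ _ =>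
      h _ (by simpa using circleMap_mem_sphere 0 hρ θ)
  rw [sub_zero, abs_of_pos Real.two_pi_pos] at h1
  rw [Real.circleAverage_def, norm_smul, norm_inv, Real.norm_of_nonneg Real.two_pi_pos.le,
    inv_mul_le_iff₀ Real.two_pi_pos, mul_comm _ C]
  exact h1

/-- Dominated convergence. It serves to integrate Laurent series and geometric series term by term.
-/
theorem hasSum_circleAverage {ι : Type*} [Countable ι] {F : ι → ℂ → ℂ} {G : ℂ → ℂ} {u : ι → ℝ}
    {ρ : ℝ} (hρ : 0 ≤ ρ) (hu : Summable u) (hF : ∀ i, ContinuousOn (F i) (Metric.sphere 0 ρ))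
    (hle : ∀ i, ∀ z : ℂ, ‖z‖ = ρ → ‖F i z‖ ≤ u i)
    (hG : ∀ z : ℂ, ‖z‖ = ρ → HasSum (fun i => F i z) (G z)) :
    HasSum (fun i => Real.circleAverage (F i) 0 ρ) (Real.circleAverage G 0 ρ) := by
  have hmem : ∀ θ, circleMap 0 ρ θ ∈ Metric.sphere (0 : ℂ) ρ := circleMap_mem_sphere 0 hρ
  have hnorm : ∀ θ, ‖circleMap 0 ρ θ‖ = ρ := fun θ => by simpa using hmem θ
  simp only [Real.circleAverage_def]
  refine HasSum.const_smul _ ?_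
  refine intervalIntegral.hasSum_integral_of_dominated_convergence (fun i _ => u i)
    (fun i => ?_) (fun i => .of_forall fun θ _ => hle i _ (hnorm θ))
    (.of_forall fun θ _ => hu) (by simp) (.of_forall fun θ _ => hG _ (hnorm θ))
  exact ((hF i).comp_continuous (continuous_circleMap 0 ρ) hmem).aestronglyMeasurable

theorem circleAverage_zpow (m : ℤ) {ρ : ℝ} (hρ : ρ ≠ 0) :
    Real.circleAverage (fun z => z ^ m) 0 ρ = if m = 0 then 1 else 0 := by
  rw [Real.circleAverage_eq_circleIntegral hρ]
  have h : ∀ z : ℂ, z ∈ Metric.sphere (0 : ℂ) |ρ| → (z - 0)⁻¹ • z ^ m = (z - 0) ^ (m - 1) := by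
    intro z hz
    have hz0 : z ≠ 0 := by
      rintro rfl
      simp at hz
      exact hρ (by simpa using hz.symm)
    rw [sub_zero, smul_eq_mul, zpow_sub_one₀ hz0, mul_comm]
  have h2 : (∮ z in C(0, ρ), (z - 0)⁻¹ • z ^ m) = ∮ z in C(0, ρ), (z - 0) ^ (m - 1) := by
    simp only [circleIntegral]
    congr 1
    funext θ
    rw [h _ (circleMap_mem_sphere' 0 ρ θ)]
  rw [h2]
  split_ifs with hm
  · subst hm
    have h3 : (∮ z in C(0, ρ), (z - 0 : ℂ) ^ ((0 : ℤ) - 1)) = ∮ z in C(0, ρ), (z - 0)⁻¹ := by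
      simp
    rw [h3, circleIntegral.integral_sub_center_inv _ hρ]
    have : (2 * Real.pi * Complex.I : ℂ) ≠ 0 := Complex.two_pi_I_ne_zero
    rw [smul_eq_mul, inv_mul_cancel₀ this]
  · rw [circleIntegral.integral_sub_zpow_of_ne (by omega), smul_zero]

end CircleAverage

/-! ### Norms of the modes and geometric gain on interior circles -/

section Weights

theorem summable_pow_natAbs {θ : ℝ} (h0 : 0 ≤ θ) (h1 : θ < 1) :
    Summable fun n : ℤ => θ ^ n.natAbs := by
  have h := summable_geometric_of_lt_one h0 h1
  exact Summable.of_nat_of_neg (by simpa using h) (by simpa using h)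

/-- The norm of the mode `ψ_n` in `H²(A)`. -/
def weight (A : UnitAnnulus) (n : ℤ) : ℝ := √((A.inner ^ n) ^ 2 + (A.outer ^ n) ^ 2)

variable {A : UnitAnnulus}

theorem UnitAnnulus.outer_pos (A : UnitAnnulus) : 0 < A.outer := zero_lt_one.trans A.one_lt_outer

theorem weight_sq (n : ℤ) : weight A n ^ 2 = (A.inner ^ n) ^ 2 + (A.outer ^ n) ^ 2 :=
  Real.sq_sqrt (by positivity)

theorem outer_zpow_le_weight (n : ℤ) : A.outer ^ n ≤ weight A n :=
  Real.le_sqrt_of_sq_le (by linarith [sq_nonneg (A.inner ^ n)])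

theorem inner_zpow_le_weight (n : ℤ) : A.inner ^ n ≤ weight A n :=
  Real.le_sqrt_of_sq_le (by linarith [sq_nonneg (A.outer ^ n)])

theorem weight_pos (n : ℤ) : 0 < weight A n :=
  (zpow_pos A.outer_pos n).trans_le (outer_zpow_le_weight n)

theorem weight_le (n : ℤ) : weight A n ≤ A.inner ^ n + A.outer ^ n := by
  have h1 := zpow_pos A.inner_pos n
  have h2 := zpow_pos A.outer_pos n
  exact Real.sqrt_le_iff.2 ⟨by positivity, by nlinarith⟩

/-- The rate at which `ρ ^ n` decays relative to the weights. -/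
def UnitAnnulus.rate (A : UnitAnnulus) (ρ : ℝ) : ℝ := max (ρ / A.outer) (A.inner / ρ)

theorem UnitAnnulus.rate_pos {ρ : ℝ} (hρ : 0 < ρ) : 0 < A.rate ρ :=
  lt_max_of_lt_left (div_pos hρ A.outer_pos)

theorem UnitAnnulus.rate_lt_one {ρ : ℝ} (hρ : ρ ∈ Ioo A.inner A.outer) : A.rate ρ < 1 :=
  max_lt ((div_lt_one A.outer_pos).2 hρ.2) ((div_lt_one (A.inner_pos.trans hρ.1)).2 hρ.1)

/-- For n ≥ 0 the comparison is with the outer radius, for n ≤ 0 with the inner one. This geometric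
gain on interior circles underlies all later estimates. -/
theorem zpow_le_rate_mul_weight {ρ : ℝ} (hρ : ρ ∈ Ioo A.inner A.outer) (n : ℤ) :
    ρ ^ n ≤ A.rate ρ ^ n.natAbs * weight A n := by
  have hρ0 : 0 < ρ := A.inner_pos.trans hρ.1
  have hr := UnitAnnulus.rate_pos (A := A) hρ0
  obtain ⟨m, rfl | rfl⟩ := n.eq_nat_or_neg
  · rw [Int.natAbs_natCast]
    calc ρ ^ (m : ℤ) = (ρ / A.outer) ^ m * A.outer ^ (m : ℤ) := by
          rw [zpow_natCast, zpow_natCast, ← mul_pow, div_mul_cancel₀ _ A.outer_pos.ne']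
      _ ≤ _ := by
          have h1 : ρ / A.outer ≤ A.rate ρ := le_max_left _ _
          have h2 := outer_zpow_le_weight (A := A) m
          have h3 := A.outer_pos
          gcongr
  · rw [Int.natAbs_neg, Int.natAbs_natCast]
    calc ρ ^ (-(m : ℤ)) = (A.inner / ρ) ^ m * A.inner ^ (-(m : ℤ)) := by
          have := A.inner_pos.ne'
          rw [zpow_neg, zpow_neg, zpow_natCast, zpow_natCast, div_pow]
          field_simp
      _ ≤ _ := by
          have h1 : A.inner / ρ ≤ A.rate ρ := le_max_right _ _
          have h2 := inner_zpow_le_weight (A := A) (-(m : ℤ))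
          have h3 := A.inner_pos
          gcongr

theorem norm_zpow_le_add {s t : ℝ} (hs : 0 < s) {z : ℂ} (h1 : s ≤ ‖z‖) (h2 : ‖z‖ ≤ t) (n : ℤ) :
    ‖z ^ n‖ ≤ s ^ n + t ^ n := by
  have hz : 0 < ‖z‖ := hs.trans_le h1
  have ht : 0 < t := hz.trans_le h2
  rw [norm_zpow]
  rcases le_total 0 n with hn | hn
  · exact (zpow_le_zpow_left₀ hn hz.le h2).trans (le_add_of_nonneg_left (by positivity))
  · refine le_trans ?_ (le_add_of_nonneg_right (by positivity))
    obtain ⟨m, rfl⟩ : ∃ m : ℕ, n = -(m : ℤ) := ⟨n.natAbs, by omega⟩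
    rw [zpow_neg, zpow_neg, zpow_natCast, zpow_natCast]
    exact inv_anti₀ (pow_pos hs m) (pow_le_pow_left₀ hs.le h1 m)

end Weights

/-! ### Functions with prescribed Laurent coefficients -/

section Synthesis

variable {A : UnitAnnulus}

/-- The Laurent series with coefficients `b` as a function on the annulus. -/
def laurentSeries (A : UnitAnnulus) (b : ℤ → ℂ) : ℂ → ℂ :=
  A.carrier.indicator fun z => ∑' n : ℤ, b n * z ^ n

/-- A Weierstrass majorant, uniform on the closed annulus s ≤ |z| ≤ t. -/
theorem norm_coeff_mul_zpow_le {b : ℤ → ℂ} {M : ℝ} (hM : ∀ n, ‖b n‖ * weight A n ≤ M) {s t : ℝ}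
    (hs : s ∈ Ioo A.inner A.outer) (ht : t ∈ Ioo A.inner A.outer) {z : ℂ} (h1 : s ≤ ‖z‖)
    (h2 : ‖z‖ ≤ t) (n : ℤ) :
    ‖b n * z ^ n‖ ≤ M * (A.rate s ^ n.natAbs + A.rate t ^ n.natAbs) := by
  have hs0 : 0 < s := A.inner_pos.trans hs.1
  rw [norm_mul]
  calc ‖b n‖ * ‖z ^ n‖ ≤ ‖b n‖ * (A.rate s ^ n.natAbs * weight A n +
        A.rate t ^ n.natAbs * weight A n) := by
        gcongr
        exact (norm_zpow_le_add hs0 h1 h2 n).trans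
          (add_le_add (zpow_le_rate_mul_weight hs n) (zpow_le_rate_mul_weight ht n))
    _ = (‖b n‖ * weight A n) * (A.rate s ^ n.natAbs + A.rate t ^ n.natAbs) := by ring
    _ ≤ _ := by
        have := UnitAnnulus.rate_pos (A := A) hs0
        have := UnitAnnulus.rate_pos (A := A) (A.inner_pos.trans ht.1)
        gcongr
        exact hM n

theorem summable_rate {s t : ℝ} (hs : s ∈ Ioo A.inner A.outer) (ht : t ∈ Ioo A.inner A.outer)
    (M : ℝ) : Summable fun n : ℤ => M * (A.rate s ^ n.natAbs + A.rate t ^ n.natAbs) :=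
  ((summable_pow_natAbs (UnitAnnulus.rate_pos (A.inner_pos.trans hs.1)).le
    (UnitAnnulus.rate_lt_one hs)).add (summable_pow_natAbs
    (UnitAnnulus.rate_pos (A.inner_pos.trans ht.1)).le (UnitAnnulus.rate_lt_one ht))).mul_left M

theorem hasSum_laurentSeries {b : ℤ → ℂ} {M : ℝ} (hM : ∀ n, ‖b n‖ * weight A n ≤ M) {z : ℂ}
    (hz : z ∈ A.carrier) : HasSum (fun n : ℤ => b n * z ^ n) (laurentSeries A b z) := by
  have hz' : ‖z‖ ∈ Ioo A.inner A.outer := hz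
  have h := Summable.of_norm_bounded (summable_rate hz' hz' M) fun n =>
    norm_coeff_mul_zpow_le hM hz' hz' le_rfl le_rfl n
  rw [laurentSeries, indicator_of_mem hz]
  exact h.hasSum

theorem differentiableOn_laurentSeries {b : ℤ → ℂ} {M : ℝ} (hM : ∀ n, ‖b n‖ * weight A n ≤ M) :
    DifferentiableOn ℂ (laurentSeries A b) A.carrier := by
  intro z hz
  obtain ⟨s, hs1, hs2⟩ := exists_between hz.1
  obtain ⟨t, ht1, ht2⟩ := exists_between hz.2
  have hs : s ∈ Ioo A.inner A.outer := ⟨hs1, hs2.trans hz.2⟩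
  have ht : t ∈ Ioo A.inner A.outer := ⟨hz.1.trans ht1, ht2⟩
  set U : Set ℂ := {w | s < ‖w‖ ∧ ‖w‖ < t} with hU
  have hUo : IsOpen U := (isOpen_lt continuous_const continuous_norm).inter
    (isOpen_lt continuous_norm continuous_const)
  have hUA : U ⊆ A.carrier := fun w hw => ⟨hs1.trans hw.1, hw.2.trans ht2⟩
  have hd : DifferentiableOn ℂ (fun w : ℂ => ∑' n : ℤ, b n * w ^ n) U := by
    refine Complex.differentiableOn_tsum_of_summable_norm (summable_rate hs ht M)
      (fun n w hw => ?_) hUo fun n w hw => norm_coeff_mul_zpow_le hM hs ht hw.1.le hw.2.le n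
    exact ((differentiableAt_zpow.2 (Or.inl (UnitAnnulus.ne_zero (hUA hw)))).const_mul
      _).differentiableWithinAt
  have hd2 : DifferentiableOn ℂ (laurentSeries A b) U :=
    hd.congr fun w hw => indicator_of_mem (hUA hw) _
  exact (hd2.differentiableAt (hUo.mem_nhds ⟨hs2, ht1⟩)).differentiableWithinAt

theorem laurentCoeff_laurentSeries {b : ℤ → ℂ} {M : ℝ} (hM : ∀ n, ‖b n‖ * weight A n ≤ M)
    (k : ℤ) : laurentCoeff (laurentSeries A b) 1 k = b k := by
  have h1 : (1 : ℝ) ∈ Ioo A.inner A.outer := ⟨A.inner_lt_one, A.one_lt_outer⟩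
  have hsum := hasSum_circleAverage (F := fun (n : ℤ) z => z ^ (-k) * (b n * z ^ n))
    (G := fun z => z ^ (-k) * laurentSeries A b z) zero_le_one (summable_rate h1 h1 M)
    (fun n z hz => ?_) (fun n z hz => ?_) (fun z hz => ?_)
  · have hterm : ∀ n : ℤ, Real.circleAverage (fun z => z ^ (-k) * (b n * z ^ n)) 0 1 =
        if n = k then b k else 0 := by
      intro n
      have : EqOn (fun z : ℂ => z ^ (-k) * (b n * z ^ n)) (fun z => b n • z ^ (n - k))
          (Metric.sphere 0 |1|) := by
        intro z hz
        have hz0 : z ≠ 0 := by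
          rintro rfl
          simp at hz
        simp only [smul_eq_mul]
        rw [sub_eq_add_neg, zpow_add₀ hz0]
        ring
      rw [Real.circleAverage_congr_sphere this, Real.circleAverage_fun_smul,
        circleAverage_zpow _ one_ne_zero]
      by_cases hn : n = k
      · subst hn; simp
      · rw [if_neg (sub_ne_zero.2 hn), if_neg hn, smul_zero]
    simp only [hterm] at hsum
    exact hsum.unique (hasSum_ite_eq k (b k))
  · have hz0 : z ≠ 0 := by
      rintro rfl
      simp at hz
    exact (((continuousAt_zpow₀ z _ (Or.inl hz0)).mul (continuousAt_const.mul
      (continuousAt_zpow₀ z _ (Or.inl hz0)))).continuousWithinAt)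
  · rw [norm_mul, norm_zpow, hz, one_zpow, one_mul]
    exact norm_coeff_mul_zpow_le hM h1 h1 hz.ge hz.le n
  · refine (hasSum_laurentSeries hM ?_).mul_left _
    exact ⟨hz ▸ h1.1, hz ▸ h1.2⟩

/-- By Parseval on the circle of radius ρ, the square mean is a sum dominated termwise by the
weighted one, since ρ ^ (2 n) is at most the sum of the two boundary values. -/
theorem memHardy_laurentSeries {b : ℤ → ℂ}
    (hb : Summable fun n : ℤ => (‖b n‖ * weight A n) ^ 2) : MemHardy A (laurentSeries A b) := by
  have hM : ∀ n, ‖b n‖ * weight A n ≤ √(∑' n : ℤ, (‖b n‖ * weight A n) ^ 2) := fun n =>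
    Real.le_sqrt_of_sq_le (hb.le_tsum n fun _ _ => sq_nonneg _)
  have hd := differentiableOn_laurentSeries hM
  refine ⟨hd, fun z hz => indicator_of_notMem hz _, ∑' n : ℤ, (‖b n‖ * weight A n) ^ 2,
    fun ρ hρ => ?_⟩
  have h := hasSum_circleAverage_normSq hd hρ
  refine hasSum_le (fun n => ?_) h hb.hasSum
  rw [laurentCoeff_laurentSeries hM, mul_pow, weight_sq, add_comm]
  exact mul_le_mul_of_nonneg_left (UnitAnnulus.zpow_sq_le hρ n) (sq_nonneg _)

end Synthesis

/-! ### The Hardy space as a weighted sequence space -/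

section HardyIsometry

variable {A : UnitAnnulus}

theorem UnitAnnulus.one_mem (A : UnitAnnulus) : (1 : ℝ) ∈ Ioo A.inner A.outer :=
  ⟨A.inner_lt_one, A.one_lt_outer⟩

theorem circleIntegrable_zpow_mul {f : ℂ → ℂ} (hf : DifferentiableOn ℂ f A.carrier) (n : ℤ) :
    CircleIntegrable (fun z => z ^ (-n) * f z) 0 1 := by
  refine ContinuousOn.circleIntegrable zero_le_one ?_
  refine ContinuousOn.mul (fun z hz => ?_) (continuousOn_circle hf A.one_mem)
  exact (continuousAt_zpow₀ z _ (Or.inl (UnitAnnulus.ne_zero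
    (circle_subset A.one_mem hz)))).continuousWithinAt

/-- The Laurent coefficients as linear functionals on `H²(A)`. -/
def coeffₗ (A : UnitAnnulus) (n : ℤ) : HardySpace A →ₗ[ℂ] ℂ where
  toFun f := laurentCoeff f 1 n
  map_add' f g := by
    change Real.circleAverage (fun z => z ^ (-n) * ((f : ℂ → ℂ) + g) z) 0 1 = _
    rw [laurentCoeff, laurentCoeff,
      ← Real.circleAverage_fun_add (circleIntegrable_zpow_mul f.mem.differentiableOn n)
        (circleIntegrable_zpow_mul g.mem.differentiableOn n)]
    simp only [Pi.add_apply, mul_add]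
  map_smul' c f := by
    change Real.circleAverage (fun z => z ^ (-n) * (c • (f : ℂ → ℂ)) z) 0 1 = _
    rw [RingHom.id_apply, laurentCoeff, ← Real.circleAverage_fun_smul]
    simp only [Pi.smul_apply, smul_eq_mul, mul_left_comm]

theorem coeffₗ_apply (n : ℤ) (f : HardySpace A) : coeffₗ A n f = laurentCoeff f 1 n := rfl

/-- Parseval on each of the two boundary circles; the squared weights are the sums of the two
contributions. -/
theorem hasSum_norm_sq (f : HardySpace A) :
    HasSum (fun n : ℤ => (‖coeffₗ A n f‖ * weight A n) ^ 2) (‖f‖ ^ 2) := by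
  have h1 := summable_laurentTerm f.mem A.inner_mem
  have h2 := summable_laurentTerm f.mem A.outer_mem
  have h3 : ((‖f‖ ^ 2 : ℝ) : ℂ) = ((∑' n : ℤ, ‖laurentCoeff f 1 n‖ ^ 2 * (A.inner ^ n) ^ 2 +
      ∑' n : ℤ, ‖laurentCoeff f 1 n‖ ^ 2 * (A.outer ^ n) ^ 2 : ℝ) : ℂ) := by
    have h4 := inner_self_eq_norm_sq_to_K (𝕜 := ℂ) f
    have h5 : inner ℂ f f = boundaryInner A A.inner f f + boundaryInner A A.outer f f := rfl
    rw [h5, boundaryInner_self f.mem A.inner_mem, boundaryInner_self f.mem A.outer_mem] at h4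
    push_cast at h4 ⊢
    exact h4.symm
  rw [Complex.ofReal_inj.1 h3]
  refine (h1.hasSum.add h2.hasSum).congr_fun fun n => ?_
  rw [mul_pow, weight_sq, coeffₗ_apply]
  ring

theorem norm_coeff_mul_weight_le (n : ℤ) (f : HardySpace A) :
    ‖coeffₗ A n f‖ * weight A n ≤ ‖f‖ := by
  have h := le_hasSum (hasSum_norm_sq f) n fun _ _ => sq_nonneg _
  exact le_of_pow_le_pow_left₀ two_ne_zero (norm_nonneg f) h

/-- The Laurent coefficients as continuous linear functionals on `H²(A)`. -/
def coeff (A : UnitAnnulus) (n : ℤ) : HardySpace A →L[ℂ] ℂ :=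
  (coeffₗ A n).mkContinuous (weight A n)⁻¹ fun f => by
    rw [inv_mul_eq_div, le_div_iff₀ (weight_pos n)]
    exact norm_coeff_mul_weight_le n f

theorem coeff_apply (n : ℤ) (f : HardySpace A) : coeff A n f = laurentCoeff f 1 n := rfl

theorem norm_coeff_le (n : ℤ) (f : HardySpace A) : ‖coeff A n f‖ * weight A n ≤ ‖f‖ :=
  norm_coeff_mul_weight_le n f

theorem HardySpace.ext_coeff {f g : HardySpace A} (h : ∀ n, coeff A n f = coeff A n g) :
    f = g := by
  rw [← sub_eq_zero]
  refine Subtype.ext (eq_zero_of_laurentCoeff (f - g).mem fun n => ?_)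
  rw [← coeff_apply, map_sub, h, sub_self]

/-- The element of `H²(A)` with a given sequence of Laurent coefficients. -/
def ofCoeff (b : ℤ → ℂ) (hb : Summable fun n : ℤ => (‖b n‖ * weight A n) ^ 2) : HardySpace A :=
  ⟨laurentSeries A b, memHardy_laurentSeries hb⟩

theorem coeff_ofCoeff {b : ℤ → ℂ} (hb : Summable fun n : ℤ => (‖b n‖ * weight A n) ^ 2) (n : ℤ) :
    coeff A n (ofCoeff b hb) = b n :=
  laurentCoeff_laurentSeries (M := √(∑' n : ℤ, (‖b n‖ * weight A n) ^ 2)) (fun n =>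
    Real.le_sqrt_of_sq_le (hb.le_tsum n fun _ _ => sq_nonneg _)) n

theorem HardySpace.hasSum_apply (f : HardySpace A) {z : ℂ} (hz : z ∈ A.carrier) :
    HasSum (fun n : ℤ => coeff A n f * z ^ n) (f z) := by
  have hb : Summable fun n : ℤ => (‖coeff A n f‖ * weight A n) ^ 2 := (hasSum_norm_sq f).summable
  have h : f = ofCoeff _ hb := HardySpace.ext_coeff fun n => (coeff_ofCoeff hb n).symm
  have h2 := hasSum_laurentSeries (fun n => norm_coeff_le n f) hz
  have h3 : (f : ℂ → ℂ) = laurentSeries A fun n => coeff A n f := congrArg Subtype.val h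
  rw [← h3] at h2
  exact h2

theorem memℓp_coeff (f : HardySpace A) :
    Memℓp (fun n : ℤ => coeff A n f * weight A n) 2 := by
  refine memℓp_gen ((hasSum_norm_sq f).summable.congr fun n => ?_)
  rw [norm_mul, Complex.norm_real, Real.norm_of_nonneg (weight_pos n).le]
  simp
  rfl

/-- The identification of `H²(A)` with `ℓ²(ℤ)`. -/
def toL2 (A : UnitAnnulus) : HardySpace A →ₗᵢ[ℂ] lp (fun _ : ℤ => ℂ) 2 where
  toFun f := ⟨fun n => coeff A n f * weight A n, memℓp_coeff f⟩
  map_add' f g := by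
    ext n
    simp [add_mul]
    rfl
  map_smul' c f := by
    ext n
    simp [mul_assoc]
  norm_map' f := by
    have h := lp.norm_rpow_eq_tsum (p := 2) (by norm_num)
      (⟨fun n => coeff A n f * weight A n, memℓp_coeff f⟩ :
        lp (fun _ : ℤ => ℂ) 2)
    have h2 := (hasSum_norm_sq f).tsum_eq
    have h3 : ∀ n : ℤ, ‖coeff A n f * weight A n‖ ^ (2 : ENNReal).toReal =
        (‖coeffₗ A n f‖ * weight A n) ^ 2 := fun n => by
      rw [norm_mul, Complex.norm_real, Real.norm_of_nonneg (weight_pos n).le]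
      simp
      rfl
    simp only [h3, h2] at h
    have h4 : (2 : ENNReal).toReal = ((2 : ℕ) : ℝ) := by simp
    rw [h4, Real.rpow_natCast] at h
    exact (pow_left_inj₀ (norm_nonneg _) (norm_nonneg _) two_ne_zero).1 h

theorem toL2_apply (f : HardySpace A) (n : ℤ) : toL2 A f n = coeff A n f * weight A n := rfl

/-- Dividing by the weights gives coefficients that `ofCoeff` can synthesise. Being isometric and
onto, `toL2` transports completeness from ℓ². -/
theorem toL2_surjective : Function.Surjective (toL2 A) := by
  intro a
  have ha : Summable fun n : ℤ => (‖a n / weight A n‖ * weight A n) ^ 2 := by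
    have h := (lp.memℓp a).summable (by norm_num)
    refine h.congr fun n => ?_
    rw [norm_div, Complex.norm_real, Real.norm_of_nonneg (weight_pos n).le,
      div_mul_cancel₀ _ (weight_pos n).ne']
    simp
  refine ⟨ofCoeff (fun n => a n / weight A n) ha, ?_⟩
  ext n
  rw [toL2_apply, coeff_ofCoeff]
  exact div_mul_cancel₀ _ (Complex.ofReal_ne_zero.2 (weight_pos n).ne')

instance (A : UnitAnnulus) : CompleteSpace (HardySpace A) :=
  ((toL2 A).isometry.isUniformInducing.completeSpace_congr toL2_surjective).2 inferInstance

end HardyIsometry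

/-! ### Orthogonality of the modes -/

section Modes

variable {A : UnitAnnulus}

theorem coeff_mode (m n : ℤ) : coeff A n (mode A m) = if n = m then 1 else 0 := by
  have h : EqOn (fun z => z ^ (-n) * A.carrier.indicator (fun z => z ^ m) z)
      (fun z => z ^ (m - n)) (Metric.sphere 0 |1|) := by
    intro z hz
    rw [abs_one] at hz
    have hzA := circle_subset A.one_mem hz
    change z ^ (-n) * A.carrier.indicator (fun z => z ^ m) z = z ^ (m - n)
    rw [indicator_of_mem hzA, ← zpow_add₀ (UnitAnnulus.ne_zero hzA), neg_add_eq_sub]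
  change Real.circleAverage (fun z => z ^ (-n) * A.carrier.indicator (fun z => z ^ m) z) 0 1 = _
  rw [Real.circleAverage_congr_sphere h, circleAverage_zpow _ one_ne_zero]
  simp only [sub_eq_zero, eq_comm]

/-- In ℓ²(ℤ) the mode ψ_k becomes the k-th basis vector times the weight of k. -/
theorem inner_mode (k : ℤ) (f : HardySpace A) :
    inner ℂ (mode A k) f = (weight A k : ℂ) ^ 2 * coeff A k f := by
  classical
  rw [← (toL2 A).inner_map_map]
  have h : toL2 A (mode A k) = lp.single 2 k (weight A k : ℂ) := by
    ext n
    rw [toL2_apply, coeff_mode, lp.single_apply]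
    by_cases hn : n = k
    · subst hn; simp
    · simp [hn]
  rw [h, lp.inner_single_left, toL2_apply, RCLike.inner_apply, Complex.conj_ofReal]
  ring

/-- The modes are orthogonal, so the projection simply cuts off the Laurent series. -/
theorem starProjection_modeSpace (n : ℕ) (f : HardySpace A) :
    (modeSpace A n).starProjection f =
      ∑ k ∈ Finset.Icc (-(n : ℤ)) n, coeff A k f • mode A k := by
  refine Submodule.eq_starProjection_of_mem_of_inner_eq_zero
    (Submodule.sum_mem _ fun k hk => Submodule.smul_mem _ _ (Submodule.subset_span
      ⟨k, by simpa using hk, rfl⟩)) fun w hw => ?_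
  rw [← inner_conj_symm, map_eq_zero]
  induction hw using Submodule.span_induction with
  | mem w hw =>
    obtain ⟨k, hk, rfl⟩ := hw
    rw [inner_mode, map_sub, map_sum]
    simp only [map_smul, coeff_mode, smul_eq_mul, mul_ite, mul_one, mul_zero]
    rw [Finset.sum_ite_eq, if_pos (by simpa using hk), sub_self, mul_zero]
  | zero => rw [inner_zero_left]
  | add x y _ _ hx hy => rw [inner_add_left, hx, hy, add_zero]
  | smul c x _ hx => rw [inner_smul_left, hx, mul_zero]

theorem coeff_starProjection (n : ℕ) (f : HardySpace A) (k : ℤ) :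
    coeff A k ((modeSpace A n).starProjection f) =
      if k ∈ Finset.Icc (-(n : ℤ)) n then coeff A k f else 0 := by
  rw [starProjection_modeSpace, map_sum]
  simp only [map_smul, coeff_mode, smul_eq_mul, mul_ite, mul_one, mul_zero]
  rw [Finset.sum_ite_eq]

end Modes

/-! ### Operators given by rapidly decaying coefficient functionals -/

section CoefficientOperator

variable {A : UnitAnnulus}

theorem norm_le_of_coeff_le {θ M : ℝ} (h0 : 0 ≤ θ) (h1 : θ < 1) {f : HardySpace A}
    (h : ∀ k, ‖coeff A k f‖ * weight A k ≤ M * θ ^ k.natAbs) :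
    ‖f‖ ≤ M * ∑' k : ℤ, θ ^ k.natAbs := by
  have hs := summable_pow_natAbs h0 h1
  set c := ∑' k : ℤ, θ ^ k.natAbs with hc
  have hM : 0 ≤ M := by
    have := (mul_nonneg (norm_nonneg _) (weight_pos 0).le).trans (h 0)
    simpa using this
  -- The term k = 0 equals 1; this permits the final replacement of c by c ^ 2.
  have hc1 : 1 ≤ c := by
    have := hs.le_tsum 0 fun _ _ => by positivity
    simpa using this
  have h2 : ‖f‖ ^ 2 ≤ M ^ 2 * c := by
    refine hasSum_le (fun k => ?_) (hasSum_norm_sq f) (hs.hasSum.mul_left (M ^ 2))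
    have h3 : (‖coeffₗ A k f‖ * weight A k) ^ 2 ≤ (M * θ ^ k.natAbs) ^ 2 :=
      pow_le_pow_left₀ (mul_nonneg (norm_nonneg _) (weight_pos k).le) (h k) 2
    refine h3.trans ?_
    rw [mul_pow]
    have h4 : (θ ^ k.natAbs) ^ 2 ≤ θ ^ k.natAbs := by
      have := pow_le_one₀ h0 h1.le (n := k.natAbs)
      have := pow_nonneg h0 k.natAbs
      nlinarith
    gcongr
  refine le_of_pow_le_pow_left₀ two_ne_zero (by positivity) (h2.trans ?_)
  rw [mul_pow]
  gcongr
  nlinarith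

/-- The hypothesis is a two-sided gain: the output has the factor θ ^ (2 |k|), and the input enters
only through a norm damped by θ ^ |l|. One output factor makes the coefficients summable and the
other gives θ ^ n for |k| > n. For |k| ≤ n the argument is f - P f, whose damped norm is at most θ ^
n ‖f‖. -/
theorem exists_coeff_operator {θ K : ℝ} (h0 : 0 < θ) (h1 : θ < 1) (hK : 0 ≤ K)
    (Λ : ℤ → HardySpace A →ₗ[ℂ] ℂ)
    (hΛ : ∀ (f : HardySpace A) (M : ℝ),
      (∀ l, ‖coeff A l f‖ * weight A l * θ ^ l.natAbs ≤ M) →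
      ∀ k, ‖Λ k f‖ * weight A k ≤ K * (θ ^ k.natAbs) ^ 2 * M) :
    ∃ L : HardySpace A →L[ℂ] HardySpace A, (∀ k f, coeff A k (L f) = Λ k f) ∧
      ∃ C : ℝ, ∀ n, ‖L - truncation L n‖ ≤ C * θ ^ n := by
  set c := ∑' k : ℤ, θ ^ k.natAbs with hc
  have hpow : ∀ k : ℤ, θ ^ k.natAbs ≤ 1 := fun k => pow_le_one₀ h0.le h1.le
  have hpos : ∀ k : ℤ, 0 < θ ^ k.natAbs := fun k => pow_pos h0 _
  have hbound : ∀ (f : HardySpace A) (l : ℤ), ‖coeff A l f‖ * weight A l * θ ^ l.natAbs ≤ ‖f‖ :=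
    fun f l => (mul_le_of_le_one_right (mul_nonneg (norm_nonneg _) (weight_pos l).le)
      (hpow l)).trans (norm_coeff_le l f)
  have hΛ1 : ∀ (f : HardySpace A) k, ‖Λ k f‖ * weight A k ≤ K * ‖f‖ * θ ^ k.natAbs := by
    intro f k
    refine (hΛ f ‖f‖ (hbound f) k).trans ?_
    rw [sq, mul_right_comm, ← mul_assoc]
    exact mul_le_of_le_one_right (by positivity) (hpow k)
  have hsum : ∀ f : HardySpace A, Summable fun k : ℤ => (‖Λ k f‖ * weight A k) ^ 2 := by
    intro f
    refine Summable.of_nonneg_of_le (fun k => sq_nonneg _) (fun k => ?_)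
      ((summable_pow_natAbs h0.le h1).mul_left ((K * ‖f‖) ^ 2))
    refine (pow_le_pow_left₀ (mul_nonneg (norm_nonneg _) (weight_pos k).le) (hΛ1 f k) 2).trans ?_
    rw [mul_pow]
    have h4 : (θ ^ k.natAbs) ^ 2 ≤ θ ^ k.natAbs := by nlinarith [hpow k, hpos k]
    gcongr
  set Lₗ : HardySpace A →ₗ[ℂ] HardySpace A :=
    { toFun := fun f => ofCoeff (fun k => Λ k f) (hsum f)
      map_add' := fun f g => HardySpace.ext_coeff fun k => by
        rw [map_add, coeff_ofCoeff, coeff_ofCoeff, coeff_ofCoeff, map_add]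
      map_smul' := fun a f => HardySpace.ext_coeff fun k => by
        rw [map_smul, coeff_ofCoeff, coeff_ofCoeff, map_smul, RingHom.id_apply] } with hLₗ
  have hLₗc : ∀ k f, coeff A k (Lₗ f) = Λ k f := fun k f => coeff_ofCoeff (hsum f) k
  set L : HardySpace A →L[ℂ] HardySpace A := Lₗ.mkContinuous (K * c) fun f => by
    rw [mul_right_comm]
    refine norm_le_of_coeff_le h0.le h1 fun k => ?_
    rw [hLₗc]
    exact hΛ1 f k with hL
  have hLc : ∀ k f, coeff A k (L f) = Λ k f := hLₗc
  refine ⟨L, hLc, K * c, fun n => ?_⟩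
  have hc0 : 0 ≤ c := tsum_nonneg fun k => (hpos k).le
  refine ContinuousLinearMap.opNorm_le_bound _ (by positivity) fun f => ?_
  rw [show K * c * θ ^ n * ‖f‖ = K * ‖f‖ * θ ^ n * c by ring]
  refine norm_le_of_coeff_le h0.le h1 fun k => ?_
  set P := (modeSpace A n).starProjection with hP
  -- Inside the window the error comes from cutting off the argument, outside it from cutting off
  -- the image.
  have hcoef : coeff A k ((L - truncation L n) f) =
      if k ∈ Finset.Icc (-(n : ℤ)) n then Λ k (f - P f) else Λ k f := by
    have : (L - truncation L n) f = L f - P (L (P f)) := rfl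
    rw [this, map_sub, hLc, coeff_starProjection]
    split_ifs with hk
    · rw [hLc, map_sub]
    · rw [sub_zero]
  have hfar : ∀ l : ℤ, l ∉ Finset.Icc (-(n : ℤ)) n → θ ^ l.natAbs ≤ θ ^ n := fun l hl =>
    pow_le_pow_of_le_one h0.le h1.le (by rw [Finset.mem_Icc] at hl; omega)
  rw [hcoef]
  split_ifs with hk
  · have h2 := hΛ (f - P f) (θ ^ n * ‖f‖) (fun l => by
      rw [map_sub, coeff_starProjection]
      split_ifs with hl
      · rw [sub_self, norm_zero, zero_mul, zero_mul]
        positivity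
      · rw [sub_zero, mul_comm]
        exact mul_le_mul (hfar l hl) (norm_coeff_le l f)
          (mul_nonneg (norm_nonneg _) (weight_pos l).le) (by positivity)) k
    refine h2.trans ?_
    have h3 : (θ ^ k.natAbs) ^ 2 ≤ θ ^ k.natAbs := by nlinarith [hpow k, hpos k]
    calc K * (θ ^ k.natAbs) ^ 2 * (θ ^ n * ‖f‖) ≤ K * θ ^ k.natAbs * (θ ^ n * ‖f‖) := by gcongr
      _ = _ := by ring
  · have h2 := hΛ f ‖f‖ (hbound f) k
    refine h2.trans ?_
    calc K * (θ ^ k.natAbs) ^ 2 * ‖f‖ = K * (θ ^ k.natAbs * θ ^ k.natAbs) * ‖f‖ := by ring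
      _ ≤ K * (θ ^ n * θ ^ k.natAbs) * ‖f‖ := by
          have := hfar k hk
          have := (hpos k).le
          gcongr
      _ = _ := by ring

end CoefficientOperator

/-! ### Spectra of the truncations -/

section Truncation

variable {A : UnitAnnulus}

theorem finiteDimensional_range_truncation (L : HardySpace A →L[ℂ] HardySpace A) (n : ℕ) :
    FiniteDimensional ℂ
      (LinearMap.range (truncation L n : HardySpace A →ₗ[ℂ] HardySpace A)) := by
  refine Submodule.finiteDimensional_of_le (S₂ := modeSpace A n) ?_
  rintro _ ⟨f, rfl⟩
  exact Submodule.starProjection_apply_mem _ _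

theorem isCompactOperator_truncation (L : HardySpace A →L[ℂ] HardySpace A) (n : ℕ) :
    IsCompactOperator (truncation L n) := by
  have := FiniteDimensional.proper ℂ (modeSpace A n)
  have h : IsCompactOperator ((modeSpace A n).orthogonalProjectionOnto ∘L L ∘L
      (modeSpace A n).starProjection) := isCompactOperator_of_locallyCompactSpace_dom _
  exact h.clm_comp (modeSpace A n).subtypeL

/-- The truncation annihilates the mode of index n + 1. Zero is thus always available as a spectral
point, both to approximate 0 and where an enumeration has been padded by zeros. -/
theorem zero_mem_spectrum_truncation (L : HardySpace A →L[ℂ] HardySpace A) (n : ℕ) :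
    (0 : ℂ) ∈ spectrum ℂ (truncation L n) := by
  rw [spectrum.zero_mem_iff]
  intro h
  have h1 : truncation L n (mode A (n + 1)) = 0 := by
    have h2 : (modeSpace A n).starProjection (mode A (n + 1)) = 0 := by
      refine HardySpace.ext_coeff fun k => ?_
      rw [coeff_starProjection, coeff_mode, map_zero]
      split_ifs with h3 h4
      · rw [Finset.mem_Icc] at h3; omega
      · rfl
      · rfl
    change (modeSpace A n).starProjection (L ((modeSpace A n).starProjection _)) = 0
    rw [h2, map_zero, map_zero]
  have h3 := (ContinuousLinearMap.isUnit_iff_bijective.1 h).1 (h1.trans (map_zero _).symm)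
  have h4 := coeff_mode (A := A) (n + 1) (n + 1)
  rw [h3, map_zero, if_pos rfl] at h4
  exact zero_ne_one h4

theorem tendsto_exp_neg_odd {a : ℝ} (ha : 0 < a) :
    Tendsto (fun n : ℕ => Real.exp (-a * (2 * n + 1))) atTop (𝓝 0) := by
  refine Real.tendsto_exp_atBot.comp ?_
  have h1 : Tendsto (fun n : ℕ => (2 * (n : ℝ) + 1)) atTop atTop :=
    tendsto_atTop_add_const_right _ _ (tendsto_natCast_atTop_atTop.const_mul_atTop two_pos)
  exact h1.const_mul_atTop_of_neg (neg_lt_zero.2 ha)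

theorem isBigO_exp_of_le_pow {F : ℕ → HardySpace A →L[ℂ] HardySpace A} {θ C : ℝ} (h0 : 0 < θ)
    (h1 : θ < 1) (h : ∀ n, ‖F n‖ ≤ C * θ ^ n) :
    ∃ a : ℝ, 0 < a ∧ F =O[atTop] fun n : ℕ => Real.exp (-a * (2 * n + 1)) := by
  have hlog : Real.log θ < 0 := Real.log_neg h0 h1
  -- The halving comes from N = 2 n + 1: with a = -log θ / 2 one has θ ^ n = e ^ a · e ^ (-a N).
  refine ⟨-Real.log θ / 2, by linarith, Asymptotics.IsBigO.of_bound
    (|C| * Real.exp (-Real.log θ / 2)) (.of_forall fun n => ?_)⟩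
  rw [Real.norm_of_nonneg (Real.exp_pos _).le, mul_assoc, ← Real.exp_add]
  have h2 : -Real.log θ / 2 + -(-Real.log θ / 2) * (2 * n + 1) = Real.log θ * n := by ring
  rw [h2, ← Real.rpow_def_of_pos h0, Real.rpow_natCast]
  refine (h n).trans ?_
  gcongr
  exact le_abs_self C

variable {L : HardySpace A →L[ℂ] HardySpace A}

theorem tendsto_truncation {a : ℝ} (ha : 0 < a)
    (hL : (fun n : ℕ => L - truncation L n) =O[atTop] fun n : ℕ => Real.exp (-a * (2 * n + 1))) :
    Tendsto (truncation L) atTop (𝓝 L) := by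
  have h := (hL.trans_tendsto (tendsto_exp_neg_odd ha)).const_sub L
  simpa using h

/-- Invertible operators form an open set: if μ - T were invertible, u_n - S_n would be so for large
n. -/
theorem mem_spectrum_of_tendsto {T : HardySpace A →L[ℂ] HardySpace A}
    {S : ℕ → HardySpace A →L[ℂ] HardySpace A} (hS : Tendsto S atTop (𝓝 T)) {u : ℕ → ℂ} {μ : ℂ}
    (hu : ∀ n, u n ∈ spectrum ℂ (S n)) (h : Tendsto u atTop (𝓝 μ)) : μ ∈ spectrum ℂ T := by
  by_contra hμ
  rw [spectrum.notMem_iff] at hμ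
  have h1 : Tendsto (fun n => u n • (1 : HardySpace A →L[ℂ] HardySpace A) - S n) atTop
      (𝓝 (μ • (1 : HardySpace A →L[ℂ] HardySpace A) - T)) :=
    (h.smul_const _).sub hS
  rw [Algebra.algebraMap_eq_smul_one] at hμ
  have h2 : ∀ᶠ n in atTop, IsUnit (u n • (1 : HardySpace A →L[ℂ] HardySpace A) - S n) :=
    h1 (Units.isOpen.mem_nhds hμ)
  obtain ⟨n, hn⟩ := h2.exists
  refine hu n (spectrum.mem_resolventSet_iff.2 ?_)
  rwa [Algebra.algebraMap_eq_smul_one]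

theorem hasEigenvalue_of_enumeration {T : HardySpace A →L[ℂ] HardySpace A} {e : ℕ → ℂ}
    (he : IsEigenvalueEnumeration T e) {m : ℕ} (hm : e m ≠ 0) :
    Module.End.HasEigenvalue (T : HardySpace A →ₗ[ℂ] HardySpace A) (e m) := by
  refine hasEigenvalue_of_maxGenEigenspace_ne_bot fun hbot => ?_
  have h1 := he.encard_eq (e m) hm
  have h2 : Module.finrank ℂ (genEigenspace T (e m)) = 0 := by
    rw [genEigenspace, hbot, finrank_bot]
  rw [h2, Nat.cast_zero, encard_eq_zero] at h1
  exact Set.notMem_empty m (h1 ▸ (rfl : e m = e m))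

theorem exists_index_of_enumeration {T : HardySpace A →L[ℂ] HardySpace A} {e : ℕ → ℂ}
    (he : IsEigenvalueEnumeration T e) {μ : ℂ} (hμ : μ ≠ 0)
    (hev : Module.End.HasEigenvalue (T : HardySpace A →ₗ[ℂ] HardySpace A) μ) :
    ∃ m, e m = μ := by
  by_contra! hne
  have h1 := he.encard_eq μ hμ
  have h2 : {n | e n = μ} = ∅ := Set.eq_empty_of_forall_notMem hne
  rw [h2, encard_empty, eq_comm, Nat.cast_eq_zero] at h1
  have := he.finiteDimensional μ hμ
  obtain ⟨x, hx⟩ := hev.exists_hasEigenvector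
  have h3 : x ∈ genEigenspace T μ := Module.End.eigenspace_le_maxGenEigenspace hx.1
  rw [Submodule.finrank_eq_zero.1 h1] at h3
  exact hx.2 h3

/-- Spectral consequences of exponentially fast convergence of the truncations. -/
theorem spectrum_of_truncation_convergence {a : ℝ} (ha : 0 < a)
    (hL : (fun n : ℕ => L - truncation L n) =O[atTop] fun n : ℕ => Real.exp (-a * (2 * n + 1))) :
    IsCompactOperator L ∧
    (spectrum ℂ L \ {0}).Countable ∧
    (∀ μ ∈ spectrum ℂ L, μ ≠ 0 →
      Module.End.HasEigenvalue (L : HardySpace A →ₗ[ℂ] HardySpace A) μ ∧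
      FiniteDimensional ℂ (genEigenspace L μ)) ∧
    (∀ μ : ℂ, AccPt μ (𝓟 (spectrum ℂ L)) → μ = 0) ∧
    (∀ (u : ℕ → ℂ) (μ : ℂ), (∀ n, u n ∈ spectrum ℂ (truncation L n)) →
      Tendsto u atTop (𝓝 μ) → μ ∈ spectrum ℂ L) ∧
    (∀ μ ∈ spectrum ℂ L, ∃ u : ℕ → ℂ, (∀ n, u n ∈ spectrum ℂ (truncation L n)) ∧
      Tendsto u atTop (𝓝 μ)) ∧
    (∃ (e : ℕ → ℂ) (E : ℕ → ℕ → ℂ), IsEigenvalueEnumeration L e ∧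
      (∀ n, IsEigenvalueEnumeration (truncation L n) (E n)) ∧
      ∀ m, e m ≠ 0 → ∃ a : ℝ, 0 < a ∧
        (fun n : ℕ => E n m - e m) =O[atTop] fun n : ℕ => Real.exp (-a * (2 * n + 1))) := by
  have hlim := tendsto_truncation ha hL
  have hc : IsCompactOperator L :=
    isCompactOperator_of_tendsto hlim (.of_forall fun n => isCompactOperator_truncation L n)
  obtain ⟨e, E, ⟨he1, he2⟩, hE, hconv⟩ := exists_convergent_enumerations hc
    (isCompactOperator_truncation L) (finiteDimensional_range_truncation L) ha hL
  have he : IsEigenvalueEnumeration L e :=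
    ⟨fun μ hμ => finiteDimensional_maxGenEigenspace hc hμ, he1, he2⟩
  have hEe : ∀ n, IsEigenvalueEnumeration (truncation L n) (E n) := fun n =>
    ⟨fun μ hμ => finiteDimensional_maxGenEigenspace (isCompactOperator_truncation L n) hμ,
      (hE n).1, (hE n).2⟩
  refine ⟨hc, countable_spectrum hc, fun μ hμ hμ0 =>
    ⟨(hc.hasEigenvalue_iff_mem_spectrum hμ0).2 hμ, finiteDimensional_maxGenEigenspace hc hμ0⟩,
    fun μ h => accPt_spectrum hc h, fun u μ hu h => mem_spectrum_of_tendsto hlim hu h,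
    fun μ hμ => ?_, e, E, he, hEe, hconv⟩
  by_cases hμ0 : μ = 0
  · exact ⟨fun _ => 0, zero_mem_spectrum_truncation L, hμ0 ▸ tendsto_const_nhds⟩
  · obtain ⟨m, rfl⟩ := exists_index_of_enumeration he hμ0
      ((hc.hasEigenvalue_iff_mem_spectrum hμ0).2 hμ)
    obtain ⟨b, hb, hO⟩ := hconv m hμ0
    refine ⟨fun n => E n m, fun n => ?_, ?_⟩
    · change E n m ∈ spectrum ℂ (truncation L n)
      -- A padded entry is not an eigenvalue supplied by the enumeration, but 0 lies in the spectrum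
      -- anyway.
      by_cases h0 : E n m = 0
      · rw [h0]
        exact zero_mem_spectrum_truncation L n
      · exact ((isCompactOperator_truncation L n).hasEigenvalue_iff_mem_spectrum h0).1
          (hasEigenvalue_of_enumeration (hEe n) h0)
    · have h := (hO.trans_tendsto (tendsto_exp_neg_odd hb)).add_const (e m)
      simpa using h

end Truncation

/-! ### Growth of |τ| away from the circle -/

section RadialGrowth

/-- The logarithmic derivative `z τ'(z) / τ(z)`, which is the derivative of the map in logarithmic
coordinates. -/
def angularDeriv (τ : ℂ → ℂ) (z : ℂ) : ℂ := z * deriv τ z / τ z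

theorem hasDerivAt_log_norm_sq {g : ℝ → ℂ} {g' : ℂ} {t : ℝ} (hg : HasDerivAt g g' t)
    (h0 : g t ≠ 0) : HasDerivAt (fun t => Real.log (‖g t‖ ^ 2)) (2 * (g' / g t).re) t := by
  have h1 : ‖g t‖ ^ 2 ≠ 0 := by positivity
  have h2 := hg.norm_sq.log h1
  convert h2 using 1
  rw [Complex.inner, Complex.div_re, ← Complex.normSq_eq_norm_sq]
  simp only [Complex.mul_re, Complex.conj_re, Complex.conj_im]
  ring

variable {τ : ℂ → ℂ}

theorem IsAnalyticExpandingCircleMap.norm_eq_one (hτ : IsAnalyticExpandingCircleMap τ) {z : ℂ}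
    (hz : ‖z‖ = 1) : ‖τ z‖ = 1 := by
  have := hτ.mapsTo (x := z) (by simpa using hz)
  simpa using this

theorem IsAnalyticExpandingCircleMap.ne_zero (hτ : IsAnalyticExpandingCircleMap τ) {z : ℂ}
    (hz : ‖z‖ = 1) : τ z ≠ 0 := by
  rw [← norm_pos_iff, hτ.norm_eq_one hz]
  exact one_pos

theorem IsAnalyticExpandingCircleMap.norm_angularDeriv (hτ : IsAnalyticExpandingCircleMap τ)
    {z : ℂ} (hz : ‖z‖ = 1) : ‖angularDeriv τ z‖ = ‖deriv τ z‖ := by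
  rw [angularDeriv, norm_div, norm_mul, hz, hτ.norm_eq_one hz, one_mul, div_one]

/-- On the circle the angular derivative is real. -/
theorem IsAnalyticExpandingCircleMap.angularDeriv_im (hτ : IsAnalyticExpandingCircleMap τ)
    {z : ℂ} (hz : ‖z‖ = 1) : (angularDeriv τ z).im = 0 := by
  have hc : HasDerivAt (fun t : ℝ => z * Complex.exp (t * Complex.I)) (z * Complex.I) 0 := by
    have h1 : HasDerivAt (fun t : ℝ => (t : ℂ) * Complex.I) Complex.I 0 := by
      simpa using (Complex.ofRealCLM.hasDerivAt (x := (0 : ℝ))).mul_const Complex.I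
    simpa using h1.cexp.const_mul z
  have hτd : HasDerivAt τ (deriv τ z) ((fun t : ℝ => z * Complex.exp (t * Complex.I)) 0) := by
    simpa using (hτ.analytic z (by simpa using hz)).differentiableAt.hasDerivAt
  have hg := hτd.comp (0 : ℝ) hc
  have h0 : (τ ∘ fun t : ℝ => z * Complex.exp (t * Complex.I)) 0 ≠ 0 := by
    simpa using hτ.ne_zero hz
  have h1 := hasDerivAt_log_norm_sq hg h0
  -- Along the circle |τ| = 1, so the derivative of log |τ|², which is -2 times the imaginary part
  -- of the angular derivative, vanishes.
  have h2 : (fun t => Real.log (‖(τ ∘ fun t : ℝ => z * Complex.exp (t * Complex.I)) t‖ ^ 2)) =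
      fun _ => 0 := by
    funext t
    have : ‖z * Complex.exp (t * Complex.I)‖ = 1 := by
      rw [norm_mul, hz, Complex.norm_exp_ofReal_mul_I, one_mul]
    simp [hτ.norm_eq_one this]
  rw [h2] at h1
  have h3 := h1.unique (hasDerivAt_const (0 : ℝ) (0 : ℝ))
  have h4 : deriv τ z * (z * Complex.I) / (τ ∘ fun t : ℝ => z * Complex.exp (t * Complex.I)) 0 =
      angularDeriv τ z * Complex.I := by
    simp only [Function.comp_apply, Complex.ofReal_zero, zero_mul, Complex.exp_zero, mul_one,
      angularDeriv]
    ring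
  rw [h4, Complex.mul_I_re] at h3
  linarith

theorem IsAnalyticExpandingCircleMap.abs_angularDeriv_re (hτ : IsAnalyticExpandingCircleMap τ)
    {z : ℂ} (hz : ‖z‖ = 1) : |(angularDeriv τ z).re| = ‖deriv τ z‖ := by
  rw [← hτ.norm_angularDeriv hz, Complex.abs_re_eq_norm.2 (hτ.angularDeriv_im hz)]

theorem IsAnalyticExpandingCircleMap.continuousAt_angularDeriv
    (hτ : IsAnalyticExpandingCircleMap τ) {z : ℂ} (hz : ‖z‖ = 1) :
    ContinuousAt (angularDeriv τ) z := by
  have h := hτ.analytic z (by simpa using hz)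
  exact (continuousAt_id.mul h.deriv.continuousAt).div h.continuousAt (hτ.ne_zero hz)

/-- The orientation sign as a real number. -/
def realSign (τ : ℂ → ℂ) : ℝ := (orientationSign τ).re

theorem realSign_cases (τ : ℂ → ℂ) :
    (OrientationPreserving τ ∧ realSign τ = 1 ∧ orientationSign τ = 1) ∨
      (¬ OrientationPreserving τ ∧ realSign τ = -1 ∧ orientationSign τ = -1) := by
  by_cases h : OrientationPreserving τ <;> simp [realSign, orientationSign, h]

/-- On the circle the angular derivative is real with modulus greater than 1. It has no zero, so by
connectedness of the circle its sign is constant. -/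
theorem IsAnalyticExpandingCircleMap.realSign_mul_angularDeriv
    (hτ : IsAnalyticExpandingCircleMap τ) {z : ℂ} (hz : ‖z‖ = 1) :
    realSign τ * (angularDeriv τ z).re = ‖deriv τ z‖ := by
  have habs := hτ.abs_angularDeriv_re hz
  rcases realSign_cases τ with ⟨h, h1, -⟩ | ⟨h, h1, -⟩
  · have h2 : 0 < (angularDeriv τ z).re := h z (by simpa using hz)
    rw [h1, one_mul, ← habs, abs_of_pos h2]
  · rw [OrientationPreserving] at h
    push Not at h
    obtain ⟨w, hw, hw0⟩ := h
    have hneg : (angularDeriv τ z).re < 0 := by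
      by_contra! hz0
      have hpre : IsPreconnected (Metric.sphere (0 : ℂ) 1) :=
        isPreconnected_sphere (by rw [Complex.rank_real_complex]; norm_num) 0 1
      have hcont : ContinuousOn (fun z => (angularDeriv τ z).re) (Metric.sphere (0 : ℂ) 1) :=
        fun z hz => (Complex.continuous_re.continuousAt.comp
          (hτ.continuousAt_angularDeriv (by simpa using hz))).continuousWithinAt
      obtain ⟨x, hx, hx0⟩ := hpre.intermediate_value hw (show z ∈ _ by simpa using hz) hcont
        ⟨hw0, hz0⟩
      have h3 := hτ.abs_angularDeriv_re (show ‖x‖ = 1 by simpa using hx)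
      have h4 := hτ.expanding x hx
      simp only at hx0
      rw [hx0, abs_zero] at h3
      linarith
    rw [h1, ← habs, abs_of_neg hneg]
    ring

/-- Uniform expansion in an annular neighbourhood of the circle. -/
theorem IsAnalyticExpandingCircleMap.exists_annulus (hτ : IsAnalyticExpandingCircleMap τ) :
    ∃ ε l C : ℝ, 0 < ε ∧ ε < 1 ∧ 1 < l ∧ ∀ z : ℂ, 1 - ε < ‖z‖ → ‖z‖ < 1 + ε →
      DifferentiableAt ℂ τ z ∧ τ z ≠ 0 ∧ l ≤ realSign τ * (angularDeriv τ z).re ∧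
        ‖deriv τ z‖ ≤ C := by
  have hcomp : IsCompact (Metric.sphere (0 : ℂ) 1) := isCompact_sphere 0 1
  have hne : (Metric.sphere (0 : ℂ) 1).Nonempty := ⟨1, by simp⟩
  have hcont : ContinuousOn (fun z => ‖deriv τ z‖) (Metric.sphere (0 : ℂ) 1) := fun z hz =>
    (hτ.analytic z hz).deriv.continuousAt.norm.continuousWithinAt
  obtain ⟨z₀, hz₀, hmin⟩ := hcomp.exists_isMinOn hne hcont
  obtain ⟨z₁, hz₁, hmax⟩ := hcomp.exists_isMaxOn hne hcont
  set m := ‖deriv τ z₀‖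
  have hm : 1 < m := hτ.expanding z₀ hz₀
  -- The threshold (1 + m) / 2 lies strictly between 1 and the minimum m of |τ'| on the circle,
  -- leaving room for continuity.
  let V : Set ℂ := {z | DifferentiableAt ℂ τ z ∧ τ z ≠ 0 ∧
    (1 + m) / 2 ≤ realSign τ * (angularDeriv τ z).re ∧ ‖deriv τ z‖ ≤ ‖deriv τ z₁‖ + 1}
  have hV : ∀ z ∈ Metric.sphere (0 : ℂ) 1, V ∈ 𝓝 z := by
    intro z hz
    have hz1 : ‖z‖ = 1 := by simpa using hz
    have ha := hτ.analytic z hz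
    have e1 : ∀ᶠ w in 𝓝 z, DifferentiableAt ℂ τ w :=
      ha.eventually_analyticAt.mono fun w hw => hw.differentiableAt
    have e2 : ∀ᶠ w in 𝓝 z, τ w ≠ 0 := ha.continuousAt.eventually_ne (hτ.ne_zero hz1)
    have e3 : ∀ᶠ w in 𝓝 z, (1 + m) / 2 < realSign τ * (angularDeriv τ w).re := by
      have hc : ContinuousAt (fun w => realSign τ * (angularDeriv τ w).re) z :=
        continuousAt_const.mul (Complex.continuous_re.continuousAt.comp
          (hτ.continuousAt_angularDeriv hz1))
      refine hc.eventually (lt_mem_nhds ?_)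
      simp only
      rw [hτ.realSign_mul_angularDeriv hz1]
      have : m ≤ ‖deriv τ z‖ := hmin hz
      linarith
    have e4 : ∀ᶠ w in 𝓝 z, ‖deriv τ w‖ < ‖deriv τ z₁‖ + 1 := by
      refine ha.deriv.continuousAt.norm.eventually (gt_mem_nhds ?_)
      have : ‖deriv τ z‖ ≤ ‖deriv τ z₁‖ := hmax hz
      linarith
    filter_upwards [e1, e2, e3, e4] with w h1 h2 h3 h4 using ⟨h1, h2, h3.le, h4.le⟩
  -- Compactness makes the neighbourhoods uniform; a point z is compared with its radial projection
  -- z / |z|.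
  obtain ⟨δ, hδ, hsub⟩ := hcomp.exists_thickening_subset_open isOpen_interior
    (fun z hz => mem_interior_iff_mem_nhds.2 (hV z hz))
  refine ⟨min δ (1 / 2), (1 + m) / 2, ‖deriv τ z₁‖ + 1, by positivity,
    (min_le_right _ _).trans_lt (by norm_num), by linarith, fun z h1 h2 => ?_⟩
  have hδ1 := min_le_left δ (1 / 2)
  have hδ2 := min_le_right δ (1 / 2)
  have hz0 : 0 < ‖z‖ := by linarith
  have hmem : z ∈ Metric.thickening δ (Metric.sphere (0 : ℂ) 1) := by
    rw [Metric.mem_thickening_iff]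
    refine ⟨z / (‖z‖ : ℂ), ?_, ?_⟩
    · simp [hz0.ne']
    · have hzc : (‖z‖ : ℂ) ≠ 0 := by exact_mod_cast hz0.ne'
      have : z - z / (‖z‖ : ℂ) = z / (‖z‖ : ℂ) * ((‖z‖ - 1 : ℝ) : ℂ) := by
        push_cast
        field_simp
      rw [dist_eq_norm, this, norm_mul, norm_div, Complex.norm_real, Complex.norm_real,
        norm_norm, div_self hz0.ne', one_mul, Real.norm_eq_abs, abs_lt]
      constructor <;> linarith
  have hzV : z ∈ V := interior_subset (hsub hmem)
  exact hzV

/-- Radial growth: integration of the logarithmic derivative along rays. -/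
theorem monotoneOn_radial {σ l s t : ℝ} {ζ : ℂ} (hζ : ‖ζ‖ = 1)
    (h : ∀ z : ℂ, Real.exp s < ‖z‖ → ‖z‖ < Real.exp t →
      DifferentiableAt ℂ τ z ∧ τ z ≠ 0 ∧ l ≤ σ * (angularDeriv τ z).re) :
    MonotoneOn (fun x : ℝ => σ * Real.log (‖τ (Complex.exp x * ζ)‖ ^ 2) - 2 * l * x)
      (Ioo s t) := by
  have hd : ∀ x ∈ Ioo s t, HasDerivAt
      (fun x : ℝ => σ * Real.log (‖τ (Complex.exp x * ζ)‖ ^ 2) - 2 * l * x)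
      (σ * (2 * (angularDeriv τ (Complex.exp x * ζ)).re) - 2 * l) x := by
    intro x hx
    have hn : ‖Complex.exp x * ζ‖ = Real.exp x := by
      rw [norm_mul, hζ, mul_one, Complex.norm_exp, Complex.ofReal_re]
    obtain ⟨h1, h2, -⟩ := h (Complex.exp x * ζ) (by rw [hn]; exact Real.exp_lt_exp.2 hx.1)
      (by rw [hn]; exact Real.exp_lt_exp.2 hx.2)
    have hc : HasDerivAt (fun x : ℝ => Complex.exp x * ζ) (Complex.exp x * ζ) x := by
      simpa using ((Complex.ofRealCLM.hasDerivAt (x := x)).cexp).mul_const ζ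
    have hg := h1.hasDerivAt.comp x hc
    have h3 := hasDerivAt_log_norm_sq hg h2
    have h4 := (h3.const_mul σ).sub ((hasDerivAt_id x).const_mul (2 * l))
    refine h4.congr_deriv ?_
    rw [Function.comp_apply, mul_one, angularDeriv, mul_comm (Complex.exp x * ζ)]
  refine monotoneOn_of_deriv_nonneg (convex_Ioo s t)
    (fun x hx => (hd x hx).continuousAt.continuousWithinAt)
    (fun x hx => (hd x (interior_subset hx)).differentiableAt.differentiableWithinAt)
    fun x hx => ?_
  rw [interior_Ioo] at hx
  rw [(hd x hx).deriv]
  have hn : ‖Complex.exp x * ζ‖ = Real.exp x := by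
    rw [norm_mul, hζ, mul_one, Complex.norm_exp, Complex.ofReal_re]
  have := (h (Complex.exp x * ζ) (by rw [hn]; exact Real.exp_lt_exp.2 hx.1)
      (by rw [hn]; exact Real.exp_lt_exp.2 hx.2)).2.2
  linarith

/-- Since log |τ| = 0 on the circle, the radial monotonicity can be started at z / |z|. With σ = -1
and l > 0 the estimate says that the two sides of the circle are interchanged. -/
theorem log_norm_growth (hτ : IsAnalyticExpandingCircleMap τ) {σ l a b : ℝ} (ha : 0 < a)
    (ha1 : a < 1) (hb1 : 1 < b)
    (h : ∀ z : ℂ, a < ‖z‖ → ‖z‖ < b →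
      DifferentiableAt ℂ τ z ∧ τ z ≠ 0 ∧ l ≤ σ * (angularDeriv τ z).re)
    {z : ℂ} (hz : a < ‖z‖) (hz' : ‖z‖ < b) :
    (1 ≤ ‖z‖ → l * Real.log ‖z‖ ≤ σ * Real.log ‖τ z‖) ∧
      (‖z‖ ≤ 1 → σ * Real.log ‖τ z‖ ≤ l * Real.log ‖z‖) := by
  have hz0 : 0 < ‖z‖ := ha.trans hz
  have hzc : (‖z‖ : ℂ) ≠ 0 := by exact_mod_cast hz0.ne'
  have hb : 0 < b := one_pos.trans hb1
  set ζ := z / (‖z‖ : ℂ)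
  have hζ : ‖ζ‖ = 1 := by simp [ζ, hz0.ne']
  have hmono := monotoneOn_radial (τ := τ) (σ := σ) (l := l) (s := Real.log a) (t := Real.log b)
    hζ (by rw [Real.exp_log ha, Real.exp_log hb]; exact h)
  have h0 : (0 : ℝ) ∈ Ioo (Real.log a) (Real.log b) := ⟨Real.log_neg ha ha1, Real.log_pos hb1⟩
  have hx : Real.log ‖z‖ ∈ Ioo (Real.log a) (Real.log b) :=
    ⟨Real.log_lt_log ha hz, Real.log_lt_log hz0 hz'⟩
  have e0 : Complex.exp ((0 : ℝ) : ℂ) * ζ = ζ := by simp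
  have e1 : Complex.exp ((Real.log ‖z‖ : ℝ) : ℂ) * ζ = z := by
    rw [← Complex.ofReal_exp, Real.exp_log hz0]
    simp only [ζ]
    field_simp
  constructor
  · intro h1
    have h2 := hmono h0 hx (Real.log_nonneg h1)
    simp only [e0, e1, hτ.norm_eq_one hζ, Real.log_pow] at h2
    norm_num at h2
    linarith
  · intro h1
    have h2 := hmono hx h0 (Real.log_nonpos hz0.le h1)
    simp only [e0, e1, hτ.norm_eq_one hζ, Real.log_pow] at h2
    norm_num at h2
    linarith

end RadialGrowth

/-! ### Choice of the two contours -/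

section ExpandingAnnulus

/-- The quantitative expansion of `τ` on the annulus `A`: the circle of radius `p` is mapped
outside of the closure of `A`, the circle of radius `q` is mapped into the inner disc, and
all preimages in `A` of points of `A` lie between these two circles. -/
structure IsExpandingOn (τ : ℂ → ℂ) (A : UnitAnnulus) (p q : ℝ) : Prop where
  differentiableAt : ∀ z ∈ A.carrier, DifferentiableAt ℂ τ z
  ne_zero : ∀ z ∈ A.carrier, τ z ≠ 0
  deriv_ne_zero : ∀ z ∈ A.carrier, deriv τ z ≠ 0
  bounded_deriv : ∃ C, ∀ z ∈ A.carrier, ‖deriv τ z‖ ≤ C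
  p_mem : p ∈ Ioo A.inner A.outer
  q_mem : q ∈ Ioo A.inner A.outer
  lt_norm : ∃ R, A.outer < R ∧ ∀ z, ‖z‖ = p → R ≤ ‖τ z‖
  norm_lt : ∃ r, 0 < r ∧ r < A.inner ∧ ∀ z, ‖z‖ = q → ‖τ z‖ ≤ r
  sign : (orientationSign τ = 1 ∧ q < p) ∨ (orientationSign τ = -1 ∧ p < q)
  preimage : ∀ z ∈ A.carrier, τ z ∈ A.carrier → min p q < ‖z‖ ∧ ‖z‖ < max p q
  circle : ∀ z ∈ A.carrier, ‖τ z‖ = 1 → ‖z‖ = 1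

variable {τ : ℂ → ℂ}

/-- The two radii are R ^ κ and r ^ κ with κ < 1 < l κ: they lie inside the annulus, and the growth
estimate sends these circles beyond it. A reversing map sends the inner circle outwards, so log r
must be compared with -log R; the condition r R = 1 makes them equal. -/
theorem exists_isExpandingOn (hτ : IsAnalyticExpandingCircleMap τ) :
    ∃ ε : ℝ, 0 < ε ∧ ∀ A : UnitAnnulus, 1 - ε < A.inner → A.outer < 1 + ε →
      (OrientationPreserving τ ∨ A.inner * A.outer = 1) → ∃ p q, IsExpandingOn τ A p q := by
  obtain ⟨ε, l, C, hε, hε1, hl, hann⟩ := hτ.exists_annulus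
  refine ⟨ε, hε, fun A hA1 hA2 hor => ?_⟩
  have hA : ∀ z ∈ A.carrier, 1 - ε < ‖z‖ ∧ ‖z‖ < 1 + ε := fun z hz =>
    ⟨hA1.trans hz.1, hz.2.trans hA2⟩
  have growth := fun (z : ℂ) (h1 : 1 - ε < ‖z‖) (h2 : ‖z‖ < 1 + ε) =>
    log_norm_growth hτ (σ := realSign τ) (l := l) (a := 1 - ε) (b := 1 + ε)
      (by linarith) (by linarith) (by linarith)
      (fun z h1 h2 => ⟨(hann z h1 h2).1, (hann z h1 h2).2.1, (hann z h1 h2).2.2.1⟩) h1 h2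
  have hdne : ∀ z ∈ A.carrier, deriv τ z ≠ 0 := by
    intro z hz h0
    have := (hann z (hA z hz).1 (hA z hz).2).2.2.1
    rw [angularDeriv, h0] at this
    simp at this
    linarith
  have hlo : 0 < Real.log A.outer := Real.log_pos A.one_lt_outer
  have hli : Real.log A.inner < 0 := Real.log_neg A.inner_pos A.inner_lt_one
  -- For l > 1 this satisfies both κ < 1 and l κ > 1.
  set κ := 2 / (1 + l) with hκ
  have hκ0 : 0 < κ := by positivity
  have hκ1 : κ < 1 := by rw [hκ, div_lt_one (by linarith)]; linarith
  have hlκ : 1 < l * κ := by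
    rw [hκ, mul_div_assoc', lt_div_iff₀ (by linarith)]; linarith
  set b := Real.exp (κ * Real.log A.outer) with hb
  set a := Real.exp (κ * Real.log A.inner) with ha
  have hb1 : 1 < b := Real.one_lt_exp_iff.2 (by positivity)
  have ha1 : a < 1 := Real.exp_lt_one_iff.2 (by nlinarith)
  have hbm : b ∈ Ioo A.inner A.outer :=
    ⟨A.inner_lt_one.trans hb1, by
      rw [hb, ← Real.lt_log_iff_exp_lt A.outer_pos]; nlinarith⟩
  have ham : a ∈ Ioo A.inner A.outer :=
    ⟨by rw [ha, ← Real.log_lt_iff_lt_exp A.inner_pos]; nlinarith, ha1.trans A.one_lt_outer⟩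
  have hlogb : Real.log b = κ * Real.log A.outer := Real.log_exp _
  have hloga : Real.log a = κ * Real.log A.inner := Real.log_exp _
  have mem_of_norm : ∀ {ρ : ℝ} {z : ℂ}, ρ ∈ Ioo A.inner A.outer → ‖z‖ = ρ → z ∈ A.carrier :=
    fun hρ hz => ⟨hz ▸ hρ.1, hz ▸ hρ.2⟩
  have hup : ∀ z ∈ A.carrier, b ≤ ‖z‖ →
      l * κ * Real.log A.outer ≤ realSign τ * Real.log ‖τ z‖ := by
    intro z hz hbz
    have h1 := (growth z (hA z hz).1 (hA z hz).2).1 (hb1.le.trans hbz)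
    have h2 := Real.log_le_log (one_pos.trans hb1) hbz
    rw [hlogb] at h2
    nlinarith
  have hdn : ∀ z ∈ A.carrier, ‖z‖ ≤ a →
      realSign τ * Real.log ‖τ z‖ ≤ l * κ * Real.log A.inner := by
    intro z hz hza
    have h1 := (growth z (hA z hz).1 (hA z hz).2).2 (hza.trans ha1.le)
    have h2 := Real.log_le_log (A.inner_pos.trans hz.1) hza
    rw [hloga] at h2
    nlinarith
  have hne : ∀ z ∈ A.carrier, τ z ≠ 0 := fun z hz => (hann z (hA z hz).1 (hA z hz).2).2.1
  have hpos : ∀ z ∈ A.carrier, 0 < ‖τ z‖ := fun z hz => norm_pos_iff.2 (hne z hz)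
  have hsign : ∀ x : ℝ, realSign τ * x = 0 → x = 0 := by
    intro x hx
    rcases realSign_cases τ with ⟨-, h, -⟩ | ⟨-, h, -⟩ <;> rw [h] at hx <;> linarith
  have hcirc : ∀ z ∈ A.carrier, ‖τ z‖ = 1 → ‖z‖ = 1 := by
    intro z hz h1
    have hz0 : 0 < ‖z‖ := A.inner_pos.trans hz.1
    obtain ⟨g1, g2⟩ := growth z (hA z hz).1 (hA z hz).2
    rw [h1, Real.log_one, mul_zero] at g1 g2
    refine Real.eq_one_of_pos_of_log_eq_zero hz0 ?_
    rcases le_total 1 ‖z‖ with h | h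
    · have := Real.log_nonneg h
      nlinarith [g1 h]
    · have := Real.log_nonpos hz0.le h
      nlinarith [g2 h]
  have hpre : ∀ z ∈ A.carrier, τ z ∈ A.carrier → a < ‖z‖ ∧ ‖z‖ < b := by
    intro z hz hτz
    have h1 := Real.log_lt_log A.inner_pos hτz.1
    have h2 := Real.log_lt_log (hpos z hz) hτz.2
    constructor
    · by_contra! h
      have h3 := hdn z hz h
      rcases realSign_cases τ with ⟨-, hs, -⟩ | ⟨hno, hs, -⟩
      · rw [hs] at h3; nlinarith
      · have h4 := Real.log_mul A.inner_pos.ne' A.outer_pos.ne'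
        rw [hor.resolve_left hno, Real.log_one] at h4
        rw [hs] at h3; nlinarith
    · by_contra! h
      have h3 := hup z hz h
      rcases realSign_cases τ with ⟨-, hs, -⟩ | ⟨hno, hs, -⟩
      · rw [hs] at h3; nlinarith
      · have h4 := Real.log_mul A.inner_pos.ne' A.outer_pos.ne'
        rw [hor.resolve_left hno, Real.log_one] at h4
        rw [hs] at h3; nlinarith
  have hR : A.outer < Real.exp (l * κ * Real.log A.outer) := by
    rw [← Real.log_lt_iff_lt_exp A.outer_pos]; nlinarith
  have hr : Real.exp (l * κ * Real.log A.inner) < A.inner := by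
    rw [← Real.lt_log_iff_exp_lt A.inner_pos]; nlinarith
  rcases realSign_cases τ with ⟨-, hs, hs'⟩ | ⟨hno, hs, hs'⟩
  · refine ⟨b, a, fun z hz => (hann z (hA z hz).1 (hA z hz).2).1, hne, hdne,
      ⟨C, fun z hz => (hann z (hA z hz).1 (hA z hz).2).2.2.2⟩, hbm, ham,
      ⟨_, hR, fun z hz => ?_⟩, ⟨_, Real.exp_pos _, hr, fun z hz => ?_⟩,
      Or.inl ⟨hs', ha1.trans hb1⟩, ?_, hcirc⟩
    · have hz' := mem_of_norm hbm hz
      have := hup z hz' hz.ge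
      rw [hs, one_mul] at this
      rwa [← Real.le_log_iff_exp_le (hpos z hz')]
    · have hz' := mem_of_norm ham hz
      have := hdn z hz' hz.le
      rw [hs, one_mul] at this
      rwa [← Real.log_le_iff_le_exp (hpos z hz')]
    · rw [min_eq_right (ha1.trans hb1).le, max_eq_left (ha1.trans hb1).le]
      exact hpre
  · have hlog : Real.log A.inner = -Real.log A.outer := by
      have h4 := Real.log_mul A.inner_pos.ne' A.outer_pos.ne'
      rw [hor.resolve_left hno, Real.log_one] at h4
      linarith
    refine ⟨a, b, fun z hz => (hann z (hA z hz).1 (hA z hz).2).1, hne, hdne,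
      ⟨C, fun z hz => (hann z (hA z hz).1 (hA z hz).2).2.2.2⟩, ham, hbm,
      ⟨_, hR, fun z hz => ?_⟩, ⟨_, Real.exp_pos _, hr, fun z hz => ?_⟩,
      Or.inr ⟨hs', ha1.trans hb1⟩, ?_, hcirc⟩
    · have hz' := mem_of_norm ham hz
      have := hdn z hz' hz.le
      rw [← Real.le_log_iff_exp_le (hpos z hz')]
      rw [hs, hlog] at this
      linarith
    · have hz' := mem_of_norm hbm hz
      have := hup z hz' hz.ge
      rw [← Real.log_le_iff_le_exp (hpos z hz'), hlog]
      rw [hs] at this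
      linarith
    · rw [min_eq_left (ha1.trans hb1).le, max_eq_right (ha1.trans hb1).le]
      exact hpre

/-- On the circle, the weight of the transfer operator for `s = 1` is `1 / |τ'|`. -/
theorem IsAnalyticExpandingCircleMap.orientationSign_mul_weight
    (hτ : IsAnalyticExpandingCircleMap τ) {ζ : ℂ} (hζ : ‖ζ‖ = 1) :
    orientationSign τ * (τ ζ / ζ / deriv τ ζ) = 1 / (‖deriv τ ζ‖ : ℂ) := by
  have h1 : angularDeriv τ ζ = ((angularDeriv τ ζ).re : ℂ) :=
    Complex.ext rfl (by simpa using hτ.angularDeriv_im hζ)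
  have h2 : τ ζ / ζ / deriv τ ζ = (angularDeriv τ ζ)⁻¹ := by
    rw [angularDeriv, inv_div, div_div]
  have h3 := hτ.realSign_mul_angularDeriv hζ
  rw [h2, h1, ← h3]
  rcases realSign_cases τ with ⟨-, hs, hs'⟩ | ⟨-, hs, hs'⟩
  · simp [hs, hs']
  · simp [hs, hs', inv_neg]

end ExpandingAnnulus

/-! ### The transfer operator through its Laurent coefficients -/

section TransferOperator

variable {A : UnitAnnulus} {τ : ℂ → ℂ} {p q : ℝ}

theorem UnitAnnulus.mem_carrier_of_norm {ρ : ℝ} (hρ : ρ ∈ Ioo A.inner A.outer) {z : ℂ}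
    (hz : ‖z‖ = ρ) : z ∈ A.carrier :=
  circle_subset hρ (by simpa using hz)

/-- The functional `f ↦ (1 / 2π) ∫ τ ^ (s - 1 - k) ζ ^ (1 - s) f dθ`, over the circle of
radius `ρ`. -/
def transferCoeff (τ : ℂ → ℂ) (s k : ℤ) (f : ℂ → ℂ) (ρ : ℝ) : ℂ :=
  laurentCoeff (fun ζ => τ ζ ^ (s - 1 - k) * f ζ) ρ (s - 1)

theorem IsExpandingOn.differentiableOn_mul (hG : IsExpandingOn τ A p q) {f : ℂ → ℂ}
    (hf : DifferentiableOn ℂ f A.carrier) (m : ℤ) :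
    DifferentiableOn ℂ (fun z => τ z ^ m * f z) A.carrier :=
  DifferentiableOn.mul (fun z hz =>
    ((hG.differentiableAt z hz).zpow (Or.inl (hG.ne_zero z hz))).differentiableWithinAt) hf

/-- The integrand is holomorphic on all of A because τ has no zeros there, so the contour may be
moved, to p or q as the sign of k requires. -/
theorem IsExpandingOn.transferCoeff_eq (hG : IsExpandingOn τ A p q) {f : ℂ → ℂ}
    (hf : DifferentiableOn ℂ f A.carrier) (s k : ℤ) {ρ : ℝ} (hρ : ρ ∈ Ioo A.inner A.outer) :
    transferCoeff τ s k f ρ = transferCoeff τ s k f 1 :=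
  laurentCoeff_eq (hG.differentiableOn_mul hf _) hρ _

/-- `transferCoeff` as a linear functional on `H²(A)`. -/
def IsExpandingOn.transferCoeffₗ (hG : IsExpandingOn τ A p q) (s k : ℤ) :
    HardySpace A →ₗ[ℂ] ℂ where
  toFun f := transferCoeff τ s k f 1
  map_add' f g := by
    change Real.circleAverage (fun z => z ^ (-(s - 1)) * (τ z ^ (s - 1 - k) *
      ((f : ℂ → ℂ) + g) z)) 0 1 = _
    rw [transferCoeff, transferCoeff, laurentCoeff, laurentCoeff, ← Real.circleAverage_fun_add
      (circleIntegrable_zpow_mul (hG.differentiableOn_mul f.mem.differentiableOn _) _)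
      (circleIntegrable_zpow_mul (hG.differentiableOn_mul g.mem.differentiableOn _) _)]
    simp only [Pi.add_apply, mul_add]
  map_smul' c f := by
    change Real.circleAverage (fun z => z ^ (-(s - 1)) * (τ z ^ (s - 1 - k) *
      (c • (f : ℂ → ℂ)) z)) 0 1 = _
    rw [RingHom.id_apply, transferCoeff, laurentCoeff, ← Real.circleAverage_fun_smul]
    simp only [Pi.smul_apply, smul_eq_mul, mul_left_comm]

/-- On the circle of radius ρ the term of index l gains θ ^ (2 |l|) relative to the weight. One
factor θ ^ |l| is absorbed by the damped bound M, the other makes the series converge. -/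
theorem norm_apply_le_of_coeff_le {θ M : ℝ} (h0 : 0 ≤ θ) (h1 : θ < 1) (f : HardySpace A)
    (hM : ∀ l, ‖coeff A l f‖ * weight A l * θ ^ l.natAbs ≤ M) {ρ : ℝ}
    (hρ : ρ ∈ Ioo A.inner A.outer) (hθ : A.rate ρ ≤ θ ^ 2) {z : ℂ} (hz : ‖z‖ = ρ) :
    ‖f z‖ ≤ M * ∑' l : ℤ, θ ^ l.natAbs := by
  have hs := ((summable_pow_natAbs h0 h1).mul_left M).hasSum
  rw [tsum_mul_left] at hs
  have hf := f.hasSum_apply (A.mem_carrier_of_norm hρ hz)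
  rw [← hf.tsum_eq]
  refine tsum_of_norm_bounded hs fun l => ?_
  have hr := UnitAnnulus.rate_pos (A := A) (A.inner_pos.trans hρ.1)
  have hw := (weight_pos (A := A) l).le
  rw [norm_mul, norm_zpow, hz]
  calc ‖coeff A l f‖ * ρ ^ l ≤ ‖coeff A l f‖ * (A.rate ρ ^ l.natAbs * weight A l) := by
        gcongr
        exact zpow_le_rate_mul_weight hρ l
    _ ≤ ‖coeff A l f‖ * ((θ ^ 2) ^ l.natAbs * weight A l) := by gcongr
    _ = ‖coeff A l f‖ * weight A l * θ ^ l.natAbs * θ ^ l.natAbs := by ring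
    _ ≤ M * θ ^ l.natAbs := by
        gcongr
        exact hM l

theorem IsExpandingOn.continuousOn_sphere (hG : IsExpandingOn τ A p q) {f : ℂ → ℂ}
    (hf : DifferentiableOn ℂ f A.carrier) (m n : ℤ) {ρ : ℝ} (hρ : ρ ∈ Ioo A.inner A.outer) :
    ContinuousOn (fun z => z ^ n * (τ z ^ m * f z)) (Metric.sphere 0 ρ) :=
  ContinuousOn.mul (fun z hz => (continuousAt_zpow₀ z _ (Or.inl (UnitAnnulus.ne_zero
    (circle_subset hρ hz)))).continuousWithinAt)
    ((hG.differentiableOn_mul hf m).continuousOn.mono (circle_subset hρ))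

theorem IsExpandingOn.exists_norm_le (hG : IsExpandingOn τ A p q) {f : ℂ → ℂ}
    (hf : DifferentiableOn ℂ f A.carrier) (m n : ℤ) {ρ : ℝ} (hρ : ρ ∈ Ioo A.inner A.outer) :
    ∃ B, 0 ≤ B ∧ ∀ z : ℂ, ‖z‖ = ρ → ‖z ^ n * (τ z ^ m * f z)‖ ≤ B := by
  obtain ⟨B, hB⟩ := (isCompact_sphere (0 : ℂ) ρ).exists_bound_of_continuousOn
    (hG.continuousOn_sphere hf m n hρ)
  refine ⟨max B 0, le_max_right _ _, fun z hz => (hB z (by simpa using hz)).trans (le_max_left _ _)⟩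

theorem weight_natCast_le (m : ℕ) : weight A m ≤ 2 * A.outer ^ m := by
  have h1 := weight_le (A := A) m
  have h2 : A.inner ^ m ≤ A.outer ^ m :=
    pow_le_pow_left₀ A.inner_pos.le (A.inner_lt_one.trans A.one_lt_outer).le m
  rw [zpow_natCast, zpow_natCast] at h1
  linarith

theorem weight_neg_natCast_le (m : ℕ) : weight A (-m) ≤ 2 * (A.inner ^ m)⁻¹ := by
  have h1 := weight_le (A := A) (-m)
  have h2 : (A.outer ^ m)⁻¹ ≤ (A.inner ^ m)⁻¹ := inv_anti₀ (pow_pos A.inner_pos m)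
    (pow_le_pow_left₀ A.inner_pos.le (A.inner_lt_one.trans A.one_lt_outer).le m)
  rw [zpow_neg, zpow_neg, zpow_natCast, zpow_natCast] at h1
  linarith

/-- The transfer operator, given by its Laurent coefficients. -/
theorem IsExpandingOn.exists_transferOperator (hG : IsExpandingOn τ A p q) (s : ℤ) :
    ∃ L : HardySpace A →L[ℂ] HardySpace A,
      (∀ k f, coeff A k (L f) = transferCoeff τ s k f 1) ∧
      ∃ a : ℝ, 0 < a ∧ (fun n : ℕ => L - truncation L n) =O[atTop]
        fun n : ℕ => Real.exp (-a * (2 * n + 1)) := by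
  obtain ⟨R, hR, hRp⟩ := hG.lt_norm
  obtain ⟨r, hr0, hr, hrq⟩ := hG.norm_lt
  have hR0 : 0 < R := A.outer_pos.trans hR
  obtain ⟨Bp, hBp0, hBp⟩ := hG.exists_norm_le (f := fun _ => 1) (differentiableOn_const 1)
    (s - 1) (-(s - 1)) hG.p_mem
  obtain ⟨Bq, hBq0, hBq⟩ := hG.exists_norm_le (f := fun _ => 1) (differentiableOn_const 1)
    (s - 1) (-(s - 1)) hG.q_mem
  -- The four ratios control the input on the two contours and the output for positive and negative
  -- k. The square root distributes the gain over the two factors θ needed on each side.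
  set x := max (max (A.rate p) (A.rate q)) (max (A.outer / R) (r / A.inner)) with hx
  have hx0 : 0 < x :=
    lt_max_of_lt_left (lt_max_of_lt_left (UnitAnnulus.rate_pos (A.inner_pos.trans hG.p_mem.1)))
  have hx1 : x < 1 := max_lt
    (max_lt (UnitAnnulus.rate_lt_one hG.p_mem) (UnitAnnulus.rate_lt_one hG.q_mem))
    (max_lt ((div_lt_one hR0).2 hR) ((div_lt_one A.inner_pos).2 hr))
  set θ := √x with hθ
  have hθ2 : θ ^ 2 = x := Real.sq_sqrt hx0.le
  have hθ0 : 0 < θ := Real.sqrt_pos.2 hx0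
  have hθ1 : θ < 1 := by rw [hθ, Real.sqrt_lt' one_pos]; simpa using hx1
  have hxp : A.rate p ≤ θ ^ 2 := by rw [hθ2]; exact (le_max_left _ _).trans (le_max_left _ _)
  have hxq : A.rate q ≤ θ ^ 2 := by rw [hθ2]; exact (le_max_right _ _).trans (le_max_left _ _)
  have hxR : A.outer / R ≤ θ ^ 2 := by
    rw [hθ2]; exact (le_max_left _ _).trans (le_max_right _ _)
  have hxr : r / A.inner ≤ θ ^ 2 := by
    rw [hθ2]; exact (le_max_right _ _).trans (le_max_right _ _)
  set c := ∑' l : ℤ, θ ^ l.natAbs with hc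
  have hc0 : 0 ≤ c := tsum_nonneg fun l => by positivity
  obtain ⟨L, hL, C, hC⟩ := exists_coeff_operator (A := A) (θ := θ) (K := 2 * c * (Bp + Bq)) hθ0 hθ1
    (by positivity) (fun k => hG.transferCoeffₗ s k) (fun f M hM k => by
      have hM0 : 0 ≤ M := (mul_nonneg (mul_nonneg (norm_nonneg _) (weight_pos 0).le)
        (pow_nonneg hθ0.le _)).trans (hM 0)
      -- The part of the integrand independent of k and f is bounded once by `Bp` or `Bq`; the power
      -- τ ^ (-k) carries the decay.
      have hfac : ∀ z : ℂ, z ∈ A.carrier → z ^ (-(s - 1)) * (τ z ^ (s - 1 - k) * f z) =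
          z ^ (-(s - 1)) * (τ z ^ (s - 1) * 1) * τ z ^ (-k) * f z := by
        intro z hz
        rw [sub_eq_add_neg (s - 1) k, zpow_add₀ (hG.ne_zero z hz)]
        ring
      change ‖transferCoeff τ s k f 1‖ * weight A k ≤ _
      obtain ⟨m, rfl | rfl⟩ := k.eq_nat_or_neg
      · rw [← hG.transferCoeff_eq f.mem.differentiableOn s _ hG.p_mem, Int.natAbs_natCast]
        have h1 : ‖transferCoeff τ s m f p‖ ≤ Bp * (R ^ m)⁻¹ * (M * c) := by
          refine norm_circleAverage_le (A.inner_pos.trans hG.p_mem.1).le fun z hz => ?_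
          have hzA := A.mem_carrier_of_norm hG.p_mem hz
          rw [hfac z hzA, norm_mul, norm_mul]
          have h2 := hBp z hz
          have h3 : ‖τ z ^ (-(m : ℤ))‖ ≤ (R ^ m)⁻¹ := by
            rw [zpow_neg, zpow_natCast, norm_inv, norm_pow]
            exact inv_anti₀ (pow_pos hR0 m) (pow_le_pow_left₀ hR0.le (hRp z hz) m)
          have h4 := norm_apply_le_of_coeff_le hθ0.le hθ1 f hM hG.p_mem hxp hz
          gcongr
        calc ‖transferCoeff τ s m f p‖ * weight A m
            ≤ (Bp * (R ^ m)⁻¹ * (M * c)) * (2 * A.outer ^ m) :=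
              mul_le_mul h1 (weight_natCast_le m) (weight_pos _).le (by positivity)
          _ = 2 * c * Bp * (A.outer / R) ^ m * M := by rw [div_pow]; ring
          _ ≤ 2 * c * (Bp + Bq) * (θ ^ 2) ^ m * M := by
              have := A.outer_pos
              gcongr
              linarith
          _ = _ := by ring
      · rw [← hG.transferCoeff_eq f.mem.differentiableOn s _ hG.q_mem, Int.natAbs_neg,
          Int.natAbs_natCast]
        have h1 : ‖transferCoeff τ s (-m) f q‖ ≤ Bq * r ^ m * (M * c) := by
          refine norm_circleAverage_le (A.inner_pos.trans hG.q_mem.1).le fun z hz => ?_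
          have hzA := A.mem_carrier_of_norm hG.q_mem hz
          rw [hfac z hzA, norm_mul, norm_mul]
          have h2 := hBq z hz
          have h3 : ‖τ z ^ (-(-(m : ℤ)))‖ ≤ r ^ m := by
            rw [neg_neg, zpow_natCast, norm_pow]
            exact pow_le_pow_left₀ (norm_nonneg _) (hrq z hz) m
          have h4 := norm_apply_le_of_coeff_le hθ0.le hθ1 f hM hG.q_mem hxq hz
          gcongr
        calc ‖transferCoeff τ s (-m) f q‖ * weight A (-m)
            ≤ (Bq * r ^ m * (M * c)) * (2 * (A.inner ^ m)⁻¹) :=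
              mul_le_mul h1 (weight_neg_natCast_le m) (weight_pos _).le (by positivity)
          _ = 2 * c * Bq * (r / A.inner) ^ m * M := by rw [div_pow]; ring
          _ ≤ 2 * c * (Bp + Bq) * (θ ^ 2) ^ m * M := by
              have := A.inner_pos
              gcongr
              linarith
          _ = _ := by ring)
  exact ⟨L, hL, isBigO_exp_of_le_pow hθ0 hθ1 hC⟩

/-- On |ζ| = p one has |z| < |τ|, so 1 / (τ - z) is the sum of z ^ n / τ ^ (n + 1). -/
theorem IsExpandingOn.hasSum_transferCoeff_nat (hG : IsExpandingOn τ A p q) {f : ℂ → ℂ}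
    (hf : DifferentiableOn ℂ f A.carrier) (s : ℤ) {z : ℂ} (hz : z ∈ A.carrier) :
    HasSum (fun n : ℕ => transferCoeff τ s n f 1 * z ^ (n : ℤ))
      (Real.circleAverage (fun ζ => ζ ^ (1 - s) * (τ ζ ^ s * f ζ) / (τ ζ - z)) 0 p) := by
  obtain ⟨R, hR, hRp⟩ := hG.lt_norm
  have hR0 : 0 < R := A.outer_pos.trans hR
  have hzR : ‖z‖ / R < 1 := (div_lt_one hR0).2 (hz.2.trans hR)
  obtain ⟨B, hB0, hB⟩ := hG.exists_norm_le hf (s - 1) (1 - s) hG.p_mem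
  have hterm : ∀ (n : ℕ) (ζ : ℂ), τ ζ ≠ 0 →
      z ^ (n : ℤ) • (ζ ^ (-(s - 1)) * (τ ζ ^ (s - 1 - n) * f ζ)) =
        ζ ^ (1 - s) * (τ ζ ^ (s - 1) * f ζ) * (z / τ ζ) ^ n := by
    intro n ζ h1
    rw [neg_sub, sub_eq_add_neg (s - 1) (n : ℤ), zpow_add₀ h1, zpow_neg, zpow_natCast,
      zpow_natCast, div_pow, smul_eq_mul]
    ring
  have key := hasSum_circleAverage (ρ := p) (u := fun n : ℕ => B * (‖z‖ / R) ^ n)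
    (F := fun (n : ℕ) ζ => z ^ (n : ℤ) • (ζ ^ (-(s - 1)) * (τ ζ ^ (s - 1 - n) * f ζ)))
    (G := fun ζ => ζ ^ (1 - s) * (τ ζ ^ s * f ζ) / (τ ζ - z)) (A.inner_pos.trans hG.p_mem.1).le
    ((summable_geometric_of_lt_one (by positivity) hzR).mul_left B) (fun n => ?_) (fun n ζ hζ => ?_)
    (fun ζ hζ => ?_)
  · refine key.congr_fun fun n => ?_
    rw [Real.circleAverage_fun_smul, ← hG.transferCoeff_eq hf s n hG.p_mem, smul_eq_mul, mul_comm]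
    rfl
  · exact (hG.continuousOn_sphere hf _ _ hG.p_mem).const_smul (z ^ (n : ℤ))
  · have hζA := A.mem_carrier_of_norm hG.p_mem hζ
    have h1 := hG.ne_zero ζ hζA
    rw [hterm n ζ h1, norm_mul, norm_pow, norm_div]
    have h3 := hB ζ hζ
    have h4 := hRp ζ hζ
    gcongr
  · have hζA := A.mem_carrier_of_norm hG.p_mem hζ
    have h1 := hG.ne_zero ζ hζA
    have h4 := hRp ζ hζ
    have h5 : ‖z / τ ζ‖ < 1 := by
      rw [norm_div, div_lt_one (hR0.trans_le h4)]
      exact hz.2.trans (hR.trans_le h4)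
    have h6 : τ ζ - z ≠ 0 := by
      rw [sub_ne_zero]
      rintro h
      rw [h, div_self (h ▸ h1), norm_one] at h5
      exact lt_irrefl _ h5
    have h7 := (hasSum_geometric_of_norm_lt_one h5).mul_left (ζ ^ (1 - s) * (τ ζ ^ (s - 1) * f ζ))
    have h8 : ζ ^ (1 - s) * (τ ζ ^ (s - 1) * f ζ) * (1 - z / τ ζ)⁻¹ =
        ζ ^ (1 - s) * (τ ζ ^ s * f ζ) / (τ ζ - z) := by
      rw [one_sub_div h1, inv_div, zpow_sub_one₀ h1]
      field_simp
    rw [h8] at h7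
    exact h7.congr_fun fun n => hterm n ζ h1

/-- On |ζ| = q one has |τ| < |z|, so -1 / (τ - z) is the sum of τ ^ n / z ^ (n + 1); the index n
stands for k = -(n + 1). -/
theorem IsExpandingOn.hasSum_transferCoeff_neg (hG : IsExpandingOn τ A p q) {f : ℂ → ℂ}
    (hf : DifferentiableOn ℂ f A.carrier) (s : ℤ) {z : ℂ} (hz : z ∈ A.carrier) :
    HasSum (fun n : ℕ => transferCoeff τ s (-(n + 1)) f 1 * z ^ (-(n + 1) : ℤ))
      (-Real.circleAverage (fun ζ => ζ ^ (1 - s) * (τ ζ ^ s * f ζ) / (τ ζ - z)) 0 q) := by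
  obtain ⟨r, hr0, hr, hrq⟩ := hG.norm_lt
  have hz0 := UnitAnnulus.ne_zero hz
  have hzn : 0 < ‖z‖ := norm_pos_iff.2 hz0
  have hzr : r / ‖z‖ < 1 := (div_lt_one hzn).2 (hr.trans hz.1)
  obtain ⟨B, hB0, hB⟩ := hG.exists_norm_le hf s (1 - s) hG.q_mem
  have hterm : ∀ (n : ℕ) (ζ : ℂ), τ ζ ≠ 0 →
      z ^ (-(n + 1) : ℤ) • (ζ ^ (-(s - 1)) * (τ ζ ^ (s - 1 - -(n + 1)) * f ζ)) =
        ζ ^ (1 - s) * (τ ζ ^ s * f ζ) * z⁻¹ * (τ ζ / z) ^ n := by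
    intro n ζ h1
    rw [neg_sub, show s - 1 - -((n : ℤ) + 1) = s + n by ring, zpow_add₀ h1, zpow_natCast,
      neg_add, zpow_add₀ hz0, zpow_neg, zpow_natCast, zpow_neg_one, div_pow, smul_eq_mul]
    ring
  have key := hasSum_circleAverage (ρ := q) (u := fun n : ℕ => B * ‖z‖⁻¹ * (r / ‖z‖) ^ n)
    (F := fun (n : ℕ) ζ => z ^ (-(n + 1) : ℤ) •
      (ζ ^ (-(s - 1)) * (τ ζ ^ (s - 1 - -(n + 1)) * f ζ)))
    (G := fun ζ => (-1 : ℂ) • (ζ ^ (1 - s) * (τ ζ ^ s * f ζ) / (τ ζ - z)))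
    (A.inner_pos.trans hG.q_mem.1).le
    ((summable_geometric_of_lt_one (by positivity) hzr).mul_left _) (fun n => ?_) (fun n ζ hζ => ?_)
    (fun ζ hζ => ?_)
  · rw [Real.circleAverage_fun_smul, neg_one_smul] at key
    refine key.congr_fun fun n => ?_
    rw [Real.circleAverage_fun_smul, ← hG.transferCoeff_eq hf s _ hG.q_mem, smul_eq_mul, mul_comm]
    rfl
  · exact (hG.continuousOn_sphere hf _ _ hG.q_mem).const_smul (z ^ (-(n + 1) : ℤ))
  · have hζA := A.mem_carrier_of_norm hG.q_mem hζ
    rw [hterm n ζ (hG.ne_zero ζ hζA), norm_mul, norm_mul, norm_pow, norm_div, norm_inv]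
    have h3 := hB ζ hζ
    have h4 := hrq ζ hζ
    gcongr
  · have hζA := A.mem_carrier_of_norm hG.q_mem hζ
    have h4 := hrq ζ hζ
    have h5 : ‖τ ζ / z‖ < 1 := by
      rw [norm_div, div_lt_one hzn]
      exact h4.trans_lt (hr.trans hz.1)
    have h6 : τ ζ - z ≠ 0 := by
      rw [sub_ne_zero]
      rintro h
      rw [h, div_self hz0, norm_one] at h5
      exact lt_irrefl _ h5
    have h7 := (hasSum_geometric_of_norm_lt_one h5).mul_left
      (ζ ^ (1 - s) * (τ ζ ^ s * f ζ) * z⁻¹)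
    have h8 : z - τ ζ ≠ 0 := by rwa [← neg_sub, neg_ne_zero]
    have h9 : ζ ^ (1 - s) * (τ ζ ^ s * f ζ) * z⁻¹ * (1 - τ ζ / z)⁻¹ =
        (-1 : ℂ) • (ζ ^ (1 - s) * (τ ζ ^ s * f ζ) / (τ ζ - z)) := by
      rw [one_sub_div hz0, inv_div, neg_one_smul, ← neg_sub z, div_neg, neg_neg]
      field_simp
    rw [h9] at h7
    exact h7.congr_fun fun n => hterm n ζ (hG.ne_zero ζ hζA)

theorem IsExpandingOn.transferOperator_apply (hG : IsExpandingOn τ A p q) {s : ℤ}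
    {L : HardySpace A →L[ℂ] HardySpace A} (hL : ∀ k f, coeff A k (L f) = transferCoeff τ s k f 1)
    (f : HardySpace A) {z : ℂ} (hz : z ∈ A.carrier) :
    L f z = Real.circleAverage (fun ζ => ζ ^ (1 - s) * (τ ζ ^ s * f ζ) / (τ ζ - z)) 0 p -
      Real.circleAverage (fun ζ => ζ ^ (1 - s) * (τ ζ ^ s * f ζ) / (τ ζ - z)) 0 q := by
  have h1 := hG.hasSum_transferCoeff_nat f.mem.differentiableOn s hz
  have h2 := hG.hasSum_transferCoeff_neg f.mem.differentiableOn s hz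
  have h3 := HasSum.of_nat_of_neg_add_one (f := fun k : ℤ => transferCoeff τ s k f 1 * z ^ k) h1 h2
  have h4 := (L f).hasSum_apply hz
  simp only [hL] at h4
  rw [h4.unique h3]
  exact (sub_eq_add_neg _ _).symm

end TransferOperator

/-! ### The residue theorem and the sum over preimages -/

section Residues

variable {A : UnitAnnulus} {τ : ℂ → ℂ} {p q : ℝ}

theorem circleAverage_div_sub_of_lt {ρ : ℝ} {w : ℂ} (hw : ‖w‖ < ρ) :
    Real.circleAverage (fun z => z / (z - w)) 0 ρ = 1 := by
  have hρ : 0 < ρ := (norm_nonneg w).trans_lt hw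
  have h := DiffContOnCl.circleAverage_smul_div (f := fun _ : ℂ => (1 : ℂ)) (c := 0) (R := ρ)
    (w := w) diffContOnCl_const (by simpa [abs_of_pos hρ] using hw)
  simpa using h

theorem circleAverage_div_sub_of_gt {ρ : ℝ} (hρ : 0 < ρ) {w : ℂ} (hw : ρ < ‖w‖) :
    Real.circleAverage (fun z => z / (z - w)) 0 ρ = 0 := by
  have hd : DiffContOnCl ℂ (fun z => z / (z - w)) (Metric.ball 0 |ρ|) := by
    refine DifferentiableOn.diffContOnCl fun z hz => ?_
    have hz1 : ‖z‖ ≤ ρ := by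
      have := Metric.closure_ball_subset_closedBall hz
      rwa [abs_of_pos hρ, mem_closedBall_zero_iff] at this
    have hz2 : z - w ≠ 0 := by
      rw [sub_ne_zero]
      rintro rfl
      linarith
    exact (differentiableAt_id.div (differentiableAt_id.sub_const w) hz2).differentiableWithinAt
  rw [hd.circleAverage, zero_div]

/-- The residue theorem for a function with simple poles between two concentric circles. -/
theorem circleAverage_sub_eq_sum_residue {a b : ℝ} (ha : a ∈ Ioo A.inner A.outer)
    (hb : b ∈ Ioo A.inner A.outer) (c : ℂ → ℂ) (Z : Finset ℂ) :
    ∀ F : ℂ → ℂ, (∀ ζ ∈ Z, a < ‖ζ‖ ∧ ‖ζ‖ < b) → DifferentiableOn ℂ F (A.carrier \ Z) →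
      (∀ ζ ∈ Z, Tendsto (fun w => (w - ζ) * F w) (𝓝[≠] ζ) (𝓝 (c ζ))) →
      Real.circleAverage (fun z => z * F z) 0 b - Real.circleAverage (fun z => z * F z) 0 a =
        ∑ ζ ∈ Z, c ζ := by
  classical
  have ha0 : 0 < a := A.inner_pos.trans ha.1
  have hb0 : 0 < b := A.inner_pos.trans hb.1
  induction Z using Finset.induction_on with
  | empty =>
    intro F _ hF _
    rw [Finset.coe_empty, sdiff_empty] at hF
    have h1 : ∀ ρ ∈ Ioo A.inner A.outer,
        Real.circleAverage (fun z => z * F z) 0 ρ = laurentCoeff F 1 (-1) := fun ρ hρ => by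
      rw [← laurentCoeff_eq hF hρ]
      simp [laurentCoeff]
    rw [h1 b hb, h1 a ha, sub_self, Finset.sum_empty]
  | insert ζ₀ Z hζ₀ ih =>
    intro F hZ hF hres
    obtain ⟨hζa, hζb⟩ := hZ ζ₀ (Finset.mem_insert_self _ _)
    have hζA : ζ₀ ∈ A.carrier := ⟨ha.1.trans hζa, hζb.trans hb.2⟩
    -- Subtracting the principal part at ζ₀ leaves a removable singularity. The principal part
    -- contributes c ζ₀ to the mean over the larger circle and nothing to the other.
    set F₁ : ℂ → ℂ := fun w => F w - c ζ₀ / (w - ζ₀) with hF₁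
    set F₂ := Function.update F₁ ζ₀ (limUnder (𝓝[≠] ζ₀) F₁) with hF₂
    have hdp : ∀ w, w ≠ ζ₀ → DifferentiableAt ℂ (fun w => c ζ₀ / (w - ζ₀)) w := fun w hw =>
      (differentiableAt_const _).div (differentiableAt_id.sub_const _) (sub_ne_zero.2 hw)
    have hs : A.carrier \ (Z : Set ℂ) ∈ 𝓝 ζ₀ :=
      (A.isOpen_carrier.sdiff Z.finite_toSet.isClosed).mem_nhds ⟨hζA, hζ₀⟩
    have hd : DifferentiableOn ℂ F₂ (A.carrier \ (Z : Set ℂ)) := by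
      refine Complex.differentiableOn_update_limUnder_of_isLittleO hs ?_ ?_
      · have hset : (A.carrier \ (Z : Set ℂ)) \ {ζ₀} = A.carrier \ ((insert ζ₀ Z : Finset ℂ)) := by
          ext w
          simp only [Set.mem_sdiff, mem_singleton_iff, Finset.coe_insert, mem_insert_iff, not_or]
          tauto
        rw [hset]
        refine hF.sub fun w hw => (hdp w ?_).differentiableWithinAt
        rintro rfl
        exact hw.2 (Finset.mem_insert_self _ _)
      · rw [Asymptotics.isLittleO_iff_tendsto']
        · have h1 := hres ζ₀ (Finset.mem_insert_self _ _)
          have h2 : Tendsto (fun w : ℂ => (w - ζ₀) * F₁ ζ₀) (𝓝[≠] ζ₀) (𝓝 0) := by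
            have : Continuous fun w : ℂ => (w - ζ₀) * F₁ ζ₀ := by fun_prop
            simpa using (this.tendsto ζ₀).mono_left nhdsWithin_le_nhds
          have h3 := (h1.sub_const (c ζ₀)).sub h2
          rw [sub_self, sub_zero] at h3
          refine h3.congr' ?_
          filter_upwards [self_mem_nhdsWithin] with w hw
          have hw0 : w - ζ₀ ≠ 0 := sub_ne_zero.2 hw
          simp only [hF₁]
          field_simp
        · filter_upwards [self_mem_nhdsWithin] with w hw h0
          exact absurd (inv_eq_zero.1 h0) (sub_ne_zero.2 hw)
    have hne : ∀ ζ ∈ Z, ζ ≠ ζ₀ := fun ζ hζ h => hζ₀ (h ▸ hζ)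
    have hres₂ : ∀ ζ ∈ Z, Tendsto (fun w => (w - ζ) * F₂ w) (𝓝[≠] ζ) (𝓝 (c ζ)) := by
      intro ζ hζ
      have h1 := hres ζ (Finset.mem_insert_of_mem hζ)
      have h2 : Tendsto (fun w : ℂ => (w - ζ) * (c ζ₀ / (w - ζ₀))) (𝓝[≠] ζ) (𝓝 0) := by
        have : ContinuousAt (fun w : ℂ => (w - ζ) * (c ζ₀ / (w - ζ₀))) ζ :=
          (continuousAt_id.sub continuousAt_const).mul (hdp ζ (hne ζ hζ)).continuousAt
        simpa using this.tendsto.mono_left nhdsWithin_le_nhds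
      have h3 := h1.sub h2
      rw [sub_zero] at h3
      refine h3.congr' ?_
      filter_upwards [(eventually_ne_nhds (hne ζ hζ)).filter_mono nhdsWithin_le_nhds] with w hw
      rw [hF₂, Function.update_of_ne hw, hF₁]
      ring
    have key := ih F₂ (fun ζ hζ => hZ ζ (Finset.mem_insert_of_mem hζ)) hd hres₂
    have hsplit : ∀ ρ ∈ Ioo A.inner A.outer, ‖ζ₀‖ ≠ ρ → (∀ ζ ∈ Z, ‖ζ‖ ≠ ρ) →
        Real.circleAverage (fun z => z * F z) 0 ρ = Real.circleAverage (fun z => z * F₂ z) 0 ρ +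
          c ζ₀ * Real.circleAverage (fun z => z / (z - ζ₀)) 0 ρ := by
      intro ρ hρ h0 hZρ
      have hρ0 : 0 < ρ := A.inner_pos.trans hρ.1
      have hne' : ∀ z ∈ Metric.sphere (0 : ℂ) ρ, z ≠ ζ₀ := by
        rintro z hz rfl
        exact h0 (by simpa using hz)
      have hc1 : CircleIntegrable (fun z => z * F₂ z) 0 ρ := by
        refine ContinuousOn.circleIntegrable hρ0.le (continuousOn_id.mul (hd.continuousOn.mono ?_))
        exact fun z hz => ⟨circle_subset hρ hz, fun h => hZρ z h (by simpa using hz)⟩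
      have hc2 : CircleIntegrable (fun z => c ζ₀ • (z / (z - ζ₀))) 0 ρ := by
        refine ContinuousOn.circleIntegrable hρ0.le fun z hz => ContinuousAt.continuousWithinAt ?_
        have h1 : ContinuousAt (fun z => z / (z - ζ₀)) z :=
          continuousAt_id.div (continuousAt_id.sub continuousAt_const) (sub_ne_zero.2 (hne' z hz))
        exact h1.const_smul (c ζ₀)
      rw [← smul_eq_mul (c ζ₀), ← Real.circleAverage_fun_smul, ← Real.circleAverage_fun_add hc1 hc2]
      refine Real.circleAverage_congr_sphere fun z hz => ?_
      rw [abs_of_pos hρ0] at hz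
      have hz0 := sub_ne_zero.2 (hne' z hz)
      simp only [hF₂, Function.update_of_ne (hne' z hz), hF₁, smul_eq_mul]
      ring
    rw [hsplit b hb hζb.ne fun ζ hζ => (hZ ζ (Finset.mem_insert_of_mem hζ)).2.ne,
      hsplit a ha hζa.ne' fun ζ hζ => (hZ ζ (Finset.mem_insert_of_mem hζ)).1.ne',
      circleAverage_div_sub_of_lt hζb, circleAverage_div_sub_of_gt ha0 hζa,
      Finset.sum_insert hζ₀, ← key]
    ring

/-- The preimages of `z` in the annulus `A`. -/
def fibre (τ : ℂ → ℂ) (A : UnitAnnulus) (z : ℂ) : Set ℂ := {ζ | ζ ∈ A.carrier ∧ τ ζ = z}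

/-- The preimages lie in a compact part of A, and an accumulation point would contradict that τ is
locally injective where τ' ≠ 0. -/
theorem IsExpandingOn.finite_fibre (hG : IsExpandingOn τ A p q) {z : ℂ} (hz : z ∈ A.carrier) :
    (fibre τ A z).Finite := by
  by_contra hinf
  have hK : IsCompact (Metric.closedBall (0 : ℂ) (max p q) ∩ {w : ℂ | min p q ≤ ‖w‖}) :=
    (isCompact_closedBall _ _).inter_right (isClosed_le continuous_const continuous_norm)
  obtain ⟨x, hxK, hx⟩ := Set.Infinite.exists_accPt_of_subset_isCompact hinf hK fun ζ hζ => by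
    have := hG.preimage ζ hζ.1 (hζ.2 ▸ hz)
    exact ⟨mem_closedBall_zero_iff.2 this.2.le, this.1.le⟩
  have hxA : x ∈ A.carrier := by
    exact ⟨lt_of_lt_of_le (lt_min hG.p_mem.1 hG.q_mem.1) hxK.2,
      lt_of_le_of_lt (mem_closedBall_zero_iff.1 hxK.1) (max_lt hG.p_mem.2 hG.q_mem.2)⟩
  have h1 := (hG.differentiableAt x hxA).hasDerivAt.eventually_ne (c := z) (hG.deriv_ne_zero x hxA)
  rw [accPt_iff_frequently_nhdsNE] at hx
  obtain ⟨y, hy, hy'⟩ := (hx.and_eventually h1).exists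
  exact hy' hy.2

/-- The pole is simple because τ' ≠ 0: the difference quotient inverts to 1 / τ'. -/
theorem IsExpandingOn.tendsto_residue (hG : IsExpandingOn τ A p q) {f : ℂ → ℂ}
    (hf : DifferentiableOn ℂ f A.carrier) (s : ℤ) {ζ : ℂ} (hζ : ζ ∈ A.carrier) :
    Tendsto (fun w => (w - ζ) * (w ^ (-s) * (τ w ^ s * f w) / (τ w - τ ζ))) (𝓝[≠] ζ)
      (𝓝 ((τ ζ / ζ) ^ s * f ζ / deriv τ ζ)) := by
  have h1 := (hasDerivAt_iff_tendsto_slope.1 (hG.differentiableAt ζ hζ).hasDerivAt).inv₀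
    (hG.deriv_ne_zero ζ hζ)
  have h2 : ContinuousAt (fun w => w ^ (-s) * (τ w ^ s * f w)) ζ :=
    (continuousAt_zpow₀ ζ _ (Or.inl (UnitAnnulus.ne_zero hζ))).mul
      ((hG.differentiableOn_mul hf s).continuousOn.continuousAt (A.isOpen_carrier.mem_nhds hζ))
  have h3 := (h2.tendsto.mono_left (nhdsWithin_le_nhds (s := {ζ}ᶜ))).mul h1
  have h4 : ζ ^ (-s) * (τ ζ ^ s * f ζ) * (deriv τ ζ)⁻¹ = (τ ζ / ζ) ^ s * f ζ / deriv τ ζ := by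
    rw [zpow_neg, div_zpow]
    ring
  rw [h4] at h3
  refine h3.congr fun w => ?_
  rw [slope_def_field, inv_div]
  ring

/-- The transfer operator as a sum over preimages. -/
theorem IsExpandingOn.transferOperator_eq_sum (hG : IsExpandingOn τ A p q) {s : ℤ}
    {L : HardySpace A →L[ℂ] HardySpace A} (hL : ∀ k f, coeff A k (L f) = transferCoeff τ s k f 1)
    (f : HardySpace A) {z : ℂ} (hz : z ∈ A.carrier) :
    L f z = orientationSign τ *
      ∑ ζ ∈ (hG.finite_fibre hz).toFinset, (z / ζ) ^ s * f ζ / deriv τ ζ := by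
  set Z := (hG.finite_fibre hz).toFinset with hZ
  have hZ' : ∀ ζ ∈ Z, ζ ∈ A.carrier ∧ τ ζ = z := fun ζ hζ => by
    rwa [hZ, Set.Finite.mem_toFinset] at hζ
  set F : ℂ → ℂ := fun w => w ^ (-s) * (τ w ^ s * f w) / (τ w - z) with hF
  have hd : DifferentiableOn ℂ F (A.carrier \ Z) := by
    intro w hw
    have hw0 : τ w - z ≠ 0 := sub_ne_zero.2 fun h => hw.2 (by
      rw [hZ, Set.Finite.coe_toFinset]; exact ⟨hw.1, h⟩)
    have h1 := (hG.differentiableOn_mul f.mem.differentiableOn s).differentiableAt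
      (A.isOpen_carrier.mem_nhds hw.1)
    exact (((differentiableAt_zpow.2 (Or.inl (UnitAnnulus.ne_zero hw.1))).mul h1).div
      ((hG.differentiableAt w hw.1).sub_const z) hw0).differentiableWithinAt
  have hres : ∀ ζ ∈ Z, Tendsto (fun w => (w - ζ) * F w) (𝓝[≠] ζ)
      (𝓝 ((z / ζ) ^ s * f ζ / deriv τ ζ)) := by
    intro ζ hζ
    obtain ⟨h1, rfl⟩ := hZ' ζ hζ
    exact hG.tendsto_residue f.mem.differentiableOn s h1
  have hbd : ∀ ζ ∈ Z, min p q < ‖ζ‖ ∧ ‖ζ‖ < max p q := fun ζ hζ =>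
    hG.preimage ζ (hZ' ζ hζ).1 ((hZ' ζ hζ).2 ▸ hz)
  have havg : ∀ ρ ∈ Ioo A.inner A.outer,
      Real.circleAverage (fun ζ => ζ ^ (1 - s) * (τ ζ ^ s * f ζ) / (τ ζ - z)) 0 ρ =
        Real.circleAverage (fun ζ => ζ * F ζ) 0 ρ := by
    intro ρ hρ
    refine Real.circleAverage_congr_sphere fun ζ hζ => ?_
    rw [abs_of_pos (A.inner_pos.trans hρ.1)] at hζ
    simp only [hF]
    rw [sub_eq_add_neg, zpow_add₀ (UnitAnnulus.ne_zero (circle_subset hρ hζ)), zpow_one]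
    ring
  rw [hG.transferOperator_apply hL f hz, havg p hG.p_mem, havg q hG.q_mem]
  -- For a reversing map p is the smaller radius, so the difference of the two means changes sign;
  -- this is the factor ω.
  rcases hG.sign with ⟨hs, hpq⟩ | ⟨hs, hpq⟩
  · rw [min_eq_right hpq.le, max_eq_left hpq.le] at hbd
    rw [hs, one_mul]
    exact circleAverage_sub_eq_sum_residue hG.q_mem hG.p_mem _ Z F hbd hd hres
  · rw [min_eq_left hpq.le, max_eq_right hpq.le] at hbd
    rw [hs, neg_one_mul, ← circleAverage_sub_eq_sum_residue hG.p_mem hG.q_mem _ Z F hbd hd hres,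
      neg_sub]

end Residues

/-! ### The number of preimages is constant -/

section Degree

variable {A : UnitAnnulus} {τ : ℂ → ℂ} {p q : ℝ}

theorem UnitAnnulus.isPreconnected_carrier (A : UnitAnnulus) : IsPreconnected A.carrier := by
  have h1 : IsPreconnected (Ioo A.inner A.outer ×ˢ (univ : Set ℝ)) :=
    isPreconnected_Ioo.prod isPreconnected_univ
  have h2 : A.carrier = (fun x : ℝ × ℝ => (x.1 : ℂ) * Complex.exp (x.2 * Complex.I)) ''
      (Ioo A.inner A.outer ×ˢ univ) := by
    ext z
    constructor
    · intro hz
      exact ⟨(‖z‖, z.arg), ⟨hz, mem_univ _⟩, Complex.norm_mul_exp_arg_mul_I z⟩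
    · rintro ⟨x, ⟨hx, -⟩, rfl⟩
      refine A.mem_carrier_of_norm hx ?_
      rw [norm_mul, Complex.norm_exp_ofReal_mul_I, mul_one, Complex.norm_real,
        Real.norm_of_nonneg (A.inner_pos.trans hx.1).le]
  rw [h2]
  exact h1.image _ (Continuous.continuousOn (by fun_prop))

theorem memHardy_of_bounded {f : ℂ → ℂ} (hf : DifferentiableOn ℂ f A.carrier) {C : ℝ}
    (hC : ∀ z ∈ A.carrier, ‖f z‖ ≤ C) : MemHardy A (A.carrier.indicator f) := by
  have hd : DifferentiableOn ℂ (A.carrier.indicator f) A.carrier :=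
    hf.congr fun z hz => indicator_of_mem hz _
  refine ⟨hd, fun z hz => indicator_of_notMem hz _, C ^ 2, fun ρ hρ => ?_⟩
  refine Real.circleAverage_mono_on_of_le_circle (circleIntegrable_normSq hd hρ) fun z hz => ?_
  rw [abs_of_pos (A.inner_pos.trans hρ.1)] at hz
  have hzA := circle_subset hρ hz
  rw [indicator_of_mem hzA]
  exact pow_le_pow_left₀ (norm_nonneg _) (hC z hzA) 2

/-- The number of preimages in `A` of a point of `A` does not depend on the point: up to the
sign, it is the image of `τ'` under the transfer operator for `s = 0`. -/
theorem IsExpandingOn.exists_ncard_fibre (hG : IsExpandingOn τ A p q) :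
    ∃ d : ℕ, ∀ z ∈ A.carrier, (fibre τ A z).ncard = d := by
  obtain ⟨C, hC⟩ := hG.bounded_deriv
  have hτ : DifferentiableOn ℂ τ A.carrier := fun z hz =>
    (hG.differentiableAt z hz).differentiableWithinAt
  obtain ⟨L, hL, -⟩ := hG.exists_transferOperator 0
  let g : HardySpace A := ⟨_, memHardy_of_bounded (hτ.deriv A.isOpen_carrier) hC⟩
  have hcard : ∀ z ∈ A.carrier, L g z = orientationSign τ * (fibre τ A z).ncard := by
    intro z hz
    rw [hG.transferOperator_eq_sum hL g hz, Set.ncard_eq_toFinset_card _ (hG.finite_fibre hz)]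
    congr 1
    rw [Finset.sum_congr rfl (g := fun _ => 1), Finset.sum_const, nsmul_one]
    intro ζ hζ
    rw [Set.Finite.mem_toFinset] at hζ
    change (z / ζ) ^ (0 : ℤ) * A.carrier.indicator (deriv τ) ζ / deriv τ ζ = 1
    rw [zpow_zero, one_mul, indicator_of_mem hζ.1, div_self (hG.deriv_ne_zero ζ hζ.1)]
  have hcont : ContinuousOn (fun z => (fibre τ A z).ncard) A.carrier := by
    rw [Nat.isClosedEmbedding_coe_real.isInducing.continuousOn_iff]
    -- As ω² = 1, a second factor ω recovers the cardinality itself. A continuous integer-valued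
    -- function on the connected annulus is constant.
    have h1 : ContinuousOn (fun z => (orientationSign τ * L g z).re) A.carrier :=
      Complex.continuous_re.comp_continuousOn
        (continuousOn_const.mul (L g).mem.differentiableOn.continuousOn)
    refine h1.congr fun z hz => ?_
    change ((fibre τ A z).ncard : ℝ) = (orientationSign τ * L g z).re
    rw [hcard z hz, ← mul_assoc]
    rcases hG.sign with ⟨h, -⟩ | ⟨h, -⟩ <;> simp [h]
  have h1 : (1 : ℂ) ∈ A.carrier := A.mem_carrier_of_norm A.one_mem norm_one
  exact ⟨(fibre τ A 1).ncard, fun z hz => A.isPreconnected_carrier.constant hcont hz h1⟩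

end Degree

/-! ### Complete systems of inverse branches -/

section Branches

variable {A : UnitAnnulus} {τ : ℂ → ℂ} {p q : ℝ}

theorem IsExpandingOn.exists_localInverse (hG : IsExpandingOn τ A p q) {ζ : ℂ}
    (hζ : ζ ∈ A.carrier) : ∃ e : OpenPartialHomeomorph ℂ ℂ, ζ ∈ e.source ∧ ⇑e = τ := by
  have hτ : DifferentiableOn ℂ τ A.carrier := fun z hz =>
    (hG.differentiableAt z hz).differentiableWithinAt
  have h1 := (hτ.analyticAt (A.isOpen_carrier.mem_nhds hζ)).hasStrictDerivAt
  have h2 := h1.hasStrictFDerivAt_equiv (hG.deriv_ne_zero ζ hζ)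
  exact ⟨h2.toOpenPartialHomeomorph τ, h2.mem_toOpenPartialHomeomorph_source,
    h2.toOpenPartialHomeomorph_coe⟩

/-- The branches are local inverses at the d preimages of z₀, restricted so that their values stay
in disjoint neighbourhoods. Near z₀ they give d distinct preimages, and these are all since each
fibre has d elements. -/
theorem IsExpandingOn.exists_inverseBranches (hG : IsExpandingOn τ A p q) {d : ℕ}
    (hd : ∀ z ∈ A.carrier, (fibre τ A z).ncard = d) {z₀ : ℂ} (hz₀ : z₀ ∈ A.carrier) :
    ∃ (U : Set ℂ) (φ : Fin d → ℂ → ℂ), z₀ ∈ U ∧ IsInverseBranches τ A U φ := by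
  classical
  have hfin := fun {z} (hz : z ∈ A.carrier) => hG.finite_fibre hz
  have hcard : ∀ {z} (hz : z ∈ A.carrier), (hfin hz).toFinset.card = d := fun hz => by
    rw [← Set.ncard_eq_toFinset_card _ (hfin hz), hd _ hz]
  let b := ((hfin hz₀).toFinset.equivFinOfCardEq (hcard hz₀)).symm
  have hb : ∀ j, (b j : ℂ) ∈ A.carrier ∧ τ (b j) = z₀ := fun j => by
    have := (b j).2
    rwa [Set.Finite.mem_toFinset] at this
  choose e he_src he using fun j => hG.exists_localInverse (hb j).1
  obtain ⟨V, hV, hdisj⟩ := (hfin hz₀).t2_separation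
  let W : Fin d → Set ℂ := fun j => (e j).target ∩ (e j).symm ⁻¹' (V (b j) ∩ A.carrier)
  have hWo : ∀ j, IsOpen (W j) := fun j =>
    (e j).isOpen_inter_preimage_symm ((hV _).2.inter A.isOpen_carrier)
  have hz₀W : ∀ j, z₀ ∈ W j := fun j => by
    have h1 : e j (b j) = z₀ := by rw [he, (hb j).2]
    have h2 := (e j).map_source (he_src j)
    have h3 := (e j).left_inv (he_src j)
    rw [h1] at h2 h3
    refine ⟨h2, ?_⟩
    rw [mem_preimage, h3]
    exact ⟨(hV _).1, (hb j).1⟩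
  have hright : ∀ j, ∀ z ∈ W j, τ ((e j).symm z) = z := fun j z hz => by
    have := (e j).right_inv hz.1
    rwa [he] at this
  refine ⟨A.carrier ∩ ⋂ j, W j, fun j => (e j).symm, ⟨hz₀, mem_iInter.2 hz₀W⟩, ?_⟩
  have hUW : ∀ z ∈ A.carrier ∩ ⋂ j, W j, ∀ j, z ∈ W j := fun z hz j => mem_iInter.1 hz.2 j
  refine ⟨A.isOpen_carrier.inter (isOpen_iInter_of_finite hWo), inter_subset_left,
    fun j z hz => ?_, fun j z hz => (hUW z hz j).2.2, fun j z hz => hright j z (hUW z hz j),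
    fun z hz ζ hζ hζz => ?_, fun j z hz h => ?_⟩
  · have hzj := hUW z hz j
    have h1 : HasDerivAt (e j) (deriv τ ((e j).symm z)) ((e j).symm z) := by
      rw [he]
      exact (hG.differentiableAt _ hzj.2.2).hasDerivAt
    exact ((e j).hasDerivAt_symm hzj.1 (hG.deriv_ne_zero _ hzj.2.2)
      h1).differentiableAt.differentiableWithinAt
  · have hinj : Function.Injective fun j => (e j).symm z := by
      intro i j hij
      by_contra hne
      have h1 : (b i : ℂ) ≠ b j := fun h => hne (b.injective (Subtype.ext h))
      have h2 := hdisj (hb i) (hb j) h1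
      have h3 : (e i).symm z ∈ V (b j) := by
        have := (hUW z hz j).2.1
        rwa [← show (e i).symm z = (e j).symm z from hij] at this
      exact Set.disjoint_left.1 h2 (hUW z hz i).2.1 h3
    have himg : Finset.univ.image (fun j => (e j).symm z) = (hfin hz.1).toFinset := by
      refine Finset.eq_of_subset_of_card_le ?_ ?_
      · intro w hw
        obtain ⟨j, -, rfl⟩ := Finset.mem_image.1 hw
        rw [Set.Finite.mem_toFinset]
        exact ⟨(hUW z hz j).2.2, hright j z (hUW z hz j)⟩
      · rw [hcard hz.1, Finset.card_image_of_injective _ hinj, Finset.card_univ, Fintype.card_fin]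
    have hmem : ζ ∈ (hfin hz.1).toFinset := by
      rw [Set.Finite.mem_toFinset]
      exact ⟨hζ, hζz⟩
    rw [← himg] at hmem
    obtain ⟨j, -, hj⟩ := Finset.mem_image.1 hmem
    exact ⟨j, hj, fun i hi => hinj (hi.trans hj.symm)⟩
  · exact hG.circle _ (hUW z hz j).2.2 (by rw [hright j z (hUW z hz j), h])

theorem IsInverseBranches.deriv_eq {U : Set ℂ} {d : ℕ} {φ : Fin d → ℂ → ℂ}
    (hφ : IsInverseBranches τ A U φ) (hG : IsExpandingOn τ A p q) (j : Fin d) {z : ℂ}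
    (hz : z ∈ U) : deriv (φ j) z = (deriv τ (φ j z))⁻¹ := by
  have hU := hφ.isOpen.mem_nhds hz
  have h1 := (hφ.differentiableOn j).differentiableAt hU
  have h2 := (hG.differentiableAt _ (hφ.mem j z hz)).hasDerivAt.comp z h1.hasDerivAt
  have h3 : HasDerivAt (τ ∘ φ j) 1 z := by
    refine (hasDerivAt_id z).congr_of_eventuallyEq ?_
    filter_upwards [hU] with w hw using hφ.right_inv j w hw
  exact eq_inv_of_mul_eq_one_right (h2.unique h3)

theorem IsInverseBranches.branchSum_eq {U : Set ℂ} {d : ℕ} {φ : Fin d → ℂ → ℂ}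
    (hφ : IsInverseBranches τ A U φ) (hG : IsExpandingOn τ A p q) (s : ℤ) (f : ℂ → ℂ) {z : ℂ}
    (hz : z ∈ U) : branchSum τ s φ f z = orientationSign τ *
      ∑ ζ ∈ (hG.finite_fibre (hφ.subset hz)).toFinset, (z / ζ) ^ s * f ζ / deriv τ ζ := by
  rw [branchSum]
  congr 1
  refine Finset.sum_bij (fun j _ => φ j z) (fun j _ => ?_) (fun i _ j _ hij => ?_) (fun ζ hζ => ?_)
    fun j _ => ?_
  · rw [Set.Finite.mem_toFinset]
    exact ⟨hφ.mem j z hz, hφ.right_inv j z hz⟩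
  · exact (hφ.existsUnique z hz _ (hφ.mem j z hz) (hφ.right_inv j z hz)).unique hij rfl
  · rw [Set.Finite.mem_toFinset] at hζ
    obtain ⟨j, hj, -⟩ := hφ.existsUnique z hz ζ hζ.1 hζ.2
    exact ⟨j, Finset.mem_univ _, hj⟩
  · rw [hφ.deriv_eq hG j hz]
    ring

/-- Over a point of the circle, all preimages in A already lie on the circle, where the weight
equals 1 / |τ'|. -/
theorem IsExpandingOn.circlePerronFrobenius_eq (hG : IsExpandingOn τ A p q)
    (hτ : IsAnalyticExpandingCircleMap τ) (f : ℂ → ℂ) {z : ℂ} (hz : z ∈ A.carrier) (hz1 : ‖z‖ = 1) :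
    circlePerronFrobenius τ f z = orientationSign τ *
      ∑ ζ ∈ (hG.finite_fibre hz).toFinset, (z / ζ) ^ (1 : ℤ) * f ζ / deriv τ ζ := by
  have hset : {ζ : ℂ | ‖ζ‖ = 1 ∧ τ ζ = z} = fibre τ A z := by
    ext ζ
    constructor
    · rintro ⟨h1, h2⟩
      exact ⟨A.mem_carrier_of_norm A.one_mem h1, h2⟩
    · rintro ⟨h1, h2⟩
      exact ⟨hG.circle ζ h1 (by rw [h2, hz1]), h2⟩
  rw [circlePerronFrobenius, hset, finsum_mem_eq_finite_toFinset_sum _ (hG.finite_fibre hz),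
    Finset.mul_sum]
  refine Finset.sum_congr rfl fun ζ hζ => ?_
  rw [Set.Finite.mem_toFinset] at hζ
  have h1 : ‖ζ‖ = 1 := hG.circle ζ hζ.1 (by rw [hζ.2, hz1])
  have h2 := hτ.orientationSign_mul_weight h1
  rw [hζ.2] at h2
  rw [zpow_one, div_eq_mul_one_div, ← h2]
  ring

end Branches

/-! ### Matrix of the truncations -/

section MatrixEntries

variable {A : UnitAnnulus} {τ : ℂ → ℂ}

/-- The exponents give L_(-k, l) for s = 1 and L_(-k-1, l+1) for s = 0. -/
theorem transferCoeff_mode (s k l : ℤ) :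
    transferCoeff τ s k (mode A l) 1 = fourierEntry τ (s - 1 - k) (l + 1 - s) := by
  rw [transferCoeff, laurentCoeff, Real.circleAverage_def, fourierEntry, one_div, Complex.real_smul]
  push_cast
  congr 1
  refine intervalIntegral.integral_congr fun θ _ => ?_
  have hmem : Complex.exp (θ * Complex.I) ∈ A.carrier :=
    A.mem_carrier_of_norm A.one_mem (Complex.norm_exp_ofReal_mul_I θ)
  have hmode : (mode A l) (Complex.exp (θ * Complex.I)) = Complex.exp (θ * Complex.I) ^ l :=
    indicator_of_mem hmem fun z : ℂ => z ^ l
  simp only [circleMap_zero, Complex.ofReal_one, one_mul, hmode]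
  rw [show l + 1 - s = -(s - 1) + l by ring, zpow_add₀ (Complex.exp_ne_zero _)]
  ring

theorem truncation_mode {s : ℤ} {L : HardySpace A →L[ℂ] HardySpace A}
    (hL : ∀ k f, coeff A k (L f) = transferCoeff τ s k f 1) (n : ℕ) {l : ℤ}
    (hl : l ∈ Finset.Icc (-(n : ℤ)) n) :
    truncation L n (mode A l) = ∑ k ∈ Finset.Icc (-(n : ℤ)) n,
      fourierEntry τ (s - 1 - k) (l + 1 - s) • mode A k := by
  have hmem : mode A l ∈ modeSpace A n :=
    Submodule.subset_span (mem_image_of_mem _ (by simpa using hl))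
  have h1 : truncation L n (mode A l) =
      (modeSpace A n).starProjection (L ((modeSpace A n).starProjection (mode A l))) := rfl
  rw [h1, Submodule.starProjection_eq_self_iff.2 hmem, starProjection_modeSpace]
  simp only [hL, transferCoeff_mode]

end MatrixEntries

end CircleEDMD

end

theorem mainTheorem1 (τ : ℂ → ℂ) (hτ : CircleEDMD.IsAnalyticExpandingCircleMap τ) :
    ∃ ε : ℝ, 0 < ε ∧ ∀ A : CircleEDMD.UnitAnnulus, 1 - ε < A.inner → A.outer < 1 + ε →
      (CircleEDMD.OrientationPreserving τ ∨ A.inner * A.outer = 1) →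
      ∃ d : ℕ,
        -- existence of the inverse branches
        (∀ z₀ ∈ A.carrier, ∃ (U : Set ℂ) (φ : Fin d → ℂ → ℂ),
          z₀ ∈ U ∧ CircleEDMD.IsInverseBranches τ A U φ) ∧
        ∀ s : ℤ, s = 0 ∨ s = 1 →
          ∃ L : CircleEDMD.HardySpace A →L[ℂ] CircleEDMD.HardySpace A,
            -- `L` is the transfer operator
            (∀ (U : Set ℂ) (φ : Fin d → ℂ → ℂ), CircleEDMD.IsInverseBranches τ A U φ →
              ∀ f : CircleEDMD.HardySpace A, ∀ z ∈ U,
                (L f) z = CircleEDMD.branchSum τ s φ f z) ∧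
            (s = 1 → ∀ f : CircleEDMD.HardySpace A, ∀ z : ℂ, ‖z‖ = 1 →
              (L f) z = CircleEDMD.circlePerronFrobenius τ f z) ∧
            -- (a) compactness
            IsCompactOperator L ∧
            -- (b) matrix representation of the truncations
            (∀ n : ℕ, ∀ l ∈ Finset.Icc (-(n : ℤ)) n,
              CircleEDMD.truncation L n (CircleEDMD.mode A l) =
                ∑ k ∈ Finset.Icc (-(n : ℤ)) n,
                  CircleEDMD.fourierEntry τ (s - 1 - k) (l + 1 - s) • CircleEDMD.mode A k) ∧
            -- (c) exponential convergence in operator norm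
            (∃ a : ℝ, 0 < a ∧
              (fun n : ℕ => L - CircleEDMD.truncation L n) =O[atTop]
                fun n : ℕ => Real.exp (-a * (2 * n + 1))) ∧
            -- (d) the spectrum of `L`
            (spectrum ℂ L \ {0}).Countable ∧
            (∀ μ ∈ spectrum ℂ L, μ ≠ 0 →
              Module.End.HasEigenvalue
                (L : CircleEDMD.HardySpace A →ₗ[ℂ] CircleEDMD.HardySpace A) μ ∧
              FiniteDimensional ℂ (CircleEDMD.genEigenspace L μ)) ∧
            (∀ μ : ℂ, AccPt μ (𝓟 (spectrum ℂ L)) → μ = 0) ∧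
            -- (d)(i)
            (∀ (u : ℕ → ℂ) (μ : ℂ), (∀ n, u n ∈ spectrum ℂ (CircleEDMD.truncation L n)) →
              Tendsto u atTop (𝓝 μ) → μ ∈ spectrum ℂ L) ∧
            -- (d)(ii)
            (∀ μ ∈ spectrum ℂ L, ∃ u : ℕ → ℂ,
              (∀ n, u n ∈ spectrum ℂ (CircleEDMD.truncation L n)) ∧
              Tendsto u atTop (𝓝 μ)) ∧
            -- (d) exponential convergence of the eigenvalues
            (∃ (e : ℕ → ℂ) (E : ℕ → ℕ → ℂ),
              CircleEDMD.IsEigenvalueEnumeration L e ∧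
              (∀ n, CircleEDMD.IsEigenvalueEnumeration (CircleEDMD.truncation L n) (E n)) ∧
              ∀ m, e m ≠ 0 → ∃ a : ℝ, 0 < a ∧
                (fun n : ℕ => E n m - e m) =O[atTop]
                  fun n : ℕ => Real.exp (-a * (2 * n + 1))) := by
  obtain ⟨ε, hε, hann⟩ := CircleEDMD.exists_isExpandingOn hτ
  refine ⟨ε, hε, fun A hA1 hA2 hor => ?_⟩
  obtain ⟨p, q, hG⟩ := hann A hA1 hA2 hor
  obtain ⟨d, hd⟩ := hG.exists_ncard_fibre
  refine ⟨d, fun z₀ hz₀ => hG.exists_inverseBranches hd hz₀, fun s hs => ?_⟩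
  obtain ⟨L, hL, a, ha, hO⟩ := hG.exists_transferOperator s
  obtain ⟨hc, hspec⟩ := CircleEDMD.spectrum_of_truncation_convergence ha hO
  refine ⟨L, fun U φ hφ f z hz => ?_, ?_, hc, fun n l hl => CircleEDMD.truncation_mode hL n hl,
    ⟨a, ha, hO⟩, hspec⟩
  -- Operator and branch formula are both compared with the sum over the fibre, so the result does
  -- not depend on the system of branches.
  · rw [hG.transferOperator_eq_sum hL f (hφ.subset hz), hφ.branchSum_eq hG s f hz]
  · rintro rfl f z hz
    have hzA := A.mem_carrier_of_norm A.one_mem hz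
    rw [hG.transferOperator_eq_sum hL f hzA, hG.circlePerronFrobenius_eq hτ f hzA hz]
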